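/- Let $d\in\{2,3\}$, let $\Omega\subset\mathbb R^d$ be a bounded Lipschitz domain (open, connected, non-empty) with boundary $\Gamma=\partial\Omega$, and let $L\in[0,\infty]$, $\beta\in\mathbb R$. If $\beta=0$ or $L=\infty$, assume that $\Gamma$ is connected. Let $m_\Omega,m_\Gamma\in C([-1,1])$ satisfy $m^\ast\le m_\Omega,m_\Gamma\le M^\ast$ on $[-1,1]$ with constants $0<m^\ast\le M^\ast$, and let $\phi:\Omega\to\mathbb R$, $\psi:\Gamma\to\mathbb R$ be measurable with $|\phi|\le1$ a.e. in $\Omega$ and $|\psi|\le1$ a.e. on $\Gamma$. Put $\mathcal H^1=H^1(\Omega)\times H^1(\Gamma)$ with its Hilbert space norm, and let $\mathcal H^1_L=\mathcal H^1$ if $L\in(0,\infty]$ and $\mathcal H^1_0=\{(u,v)\in\mathcal H^1: u=\beta v \text{ a.e. on }\Gamma\}$ if $L=0$, with the norm of $\mathcal H^1$. Let $\chi(L)=L^{-1}$ if $L\in(0,\infty)$ and $\chi(L)=0$ if $L\in\{0,\infty\}$, and $$\|(u,v)\|_L^2=\int_\Omega|\nabla u|^2\,\mathrm dx+\int_\Gamma|\nabla_\Gamma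 v|^2\,\mathrm d\Gamma+\chi(L)\int_\Gamma(\beta v-u)^2\,\mathrm d\Gamma .$$ If $L\in[0,\infty)$, let $\mathcal V^1_L$ be the set of all $(u,v)\in\mathcal H^1_L$ with $\beta\int_\Omega u\,\mathrm dx+\int_\Gamma v\,\mathrm d\Gamma=0$ and $\mathcal V^{-1}_L$ the set of all $(f,g)\in(\mathcal H^1_L)'$ with $\langle(f,g),(\beta,1)\rangle=0$. If $L=\infty$, let $\mathcal V^1_L$ be the set of all $(u,v)\in\mathcal H^1$ with $\int_\Omega u\,\mathrm dx=\int_\Gamma v\,\mathrm d\Gamma=0$ and $\mathcal V^{-1}_L$ the set of all $(f,g)\in(\mathcal H^1)'$ with $\langle(f,g),(1,0)\rangle=\langle(f,g),(0,1)\rangle=0$. A weak solution of the system $$-\operatorname{div}(m_\Omega(\phi)\nabla u)=f\ \text{ in }\Omega,\qquad -\operatorname{div}_\Gamma(m_\Gamma(\psi)\nabla_\Gamma v)+\beta m_\Omega(\phi)\partial_{\mathbf n}u=g\ \text{ on }\Gamma,\qquad L\,m_\Omega(\phi)\partial_{\mathbf n}u=\beta v-u\ \text{ on }\Gamma$$ (the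 last condition being read as $m_\Omega(\phi)\partial_{\mathbf n}u=0$ if $L=\infty$) is a pair $(u,v)\in\mathcal H^1_L$ with $$\int_\Omega m_\Omega(\phi)\nabla u\cdot\nabla\zeta\,\mathrm dx+\int_\Gamma m_\Gamma(\psi)\nabla_\Gamma v\cdot\nabla_\Gamma\xi\,\mathrm d\Gamma+\chi(L)\int_\Gamma(\beta v-u)(\beta\xi-\zeta)\,\mathrm d\Gamma=\langle(f,g),(\zeta,\xi)\rangle_{\mathcal H^1_L}$$ for all $(\zeta,\xi)\in\mathcal H^1_L$. Then for every $(f,g)\in\mathcal V^{-1}_L$ there is exactly one weak solution in $\mathcal V^1_L$. Moreover, there is a constant $C>0$, depending only on $\Omega$, $L$, $\beta$ and $m^\ast$, such that every weak solution $(u,v)\in\mathcal H^1_L$ satisfies $$\|(u,v)\|_L\le C\,\|(f,g)\|_{(\mathcal H^1_L)'} .$$ -/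

import Mathlib

open MeasureTheory Set Filter Topology
open scoped ENNReal NNReal ContDiff

noncomputable section

namespace BulkSurface

/-- The Euclidean space `ℝ^d`. -/
abbrev E (d : ℕ) := EuclideanSpace ℝ (Fin d)

/-! ### Lipschitz domains -/

/-- `(U, e, γ)` is a graph chart of the open set `Ω`: inside the open set `U` and in the rotated
coordinates given by the linear isometry `e`, the set `Ω` is the strict epigraph of the Lipschitz
function `γ`. -/
def IsGraphChart {n : ℕ} (Ω U : Set (E (n + 1))) (e : E (n + 1) ≃ₗᵢ[ℝ] WithLp 2 (E n × ℝ))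
    (γ : E n → ℝ) : Prop :=
  IsOpen U ∧ (∃ K : ℝ≥0, LipschitzWith K γ) ∧ ∀ z ∈ U, (z ∈ Ω ↔ γ (e z).fst < (e z).snd)

/-- A bounded Lipschitz domain: a non-empty connected bounded open set whose boundary is locally
the graph of a Lipschitz function, with the set on one side of it. -/
structure IsLipschitzDomain {n : ℕ} (Ω : Set (E (n + 1))) : Prop where
  isOpen : IsOpen Ω
  isConnected : IsConnected Ω
  isBounded : Bornology.IsBounded Ω
  exists_chart : ∀ x ∈ frontier Ω, ∃ (U : Set (E (n + 1)))
    (e : E (n + 1) ≃ₗᵢ[ℝ] WithLp 2 (E n × ℝ)) (γ : E n → ℝ), x ∈ U ∧ IsGraphChart Ω U e γ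

/-- The parametrization `y ↦ (y, γ y)` (in the coordinates `e`) of the graph of `γ`. -/
def graphMap {n : ℕ} (e : E (n + 1) ≃ₗᵢ[ℝ] WithLp 2 (E n × ℝ)) (γ : E n → ℝ) (y : E n) :
    E (n + 1) :=
  e.symm (WithLp.toLp 2 (y, γ y))

/-- The parameters `y` whose image lies in `U`. -/
def graphDom {n : ℕ} (U : Set (E (n + 1))) (e : E (n + 1) ≃ₗᵢ[ℝ] WithLp 2 (E n × ℝ))
    (γ : E n → ℝ) : Set (E n) :=
  {y | graphMap e γ y ∈ U}

/-- Lebesgue measure on `Ω`. -/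
abbrev bulkMeasure {d : ℕ} (Ω : Set (E d)) : Measure (E d) := volume.restrict Ω

/-- The surface measure on `Γ = ∂Ω`, that is the `n`-dimensional Hausdorff measure normalized so
as to agree with Lebesgue measure on `ℝ^n`. -/
abbrev surfMeasure {n : ℕ} (Ω : Set (E (n + 1))) : Measure (E (n + 1)) :=
  (μHE[n] : Measure (E (n + 1))).restrict (frontier Ω)

/-! ### Weak gradients -/

/-- `g` is the weak gradient of `f` in the open set `D`. -/
def HasWeakGrad {d : ℕ} (D : Set (E d)) (f : E d → ℝ) (g : E d → E d) : Prop :=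
  LocallyIntegrableOn f D ∧ LocallyIntegrableOn g D ∧
    ∀ η : E d → ℝ, ContDiff ℝ ∞ η → HasCompactSupport η → tsupport η ⊆ D → ∀ w : E d,
      ∫ x in D, f x * fderiv ℝ η x w = -∫ x in D, inner ℝ (g x) w * η x

/-- `G` is the surface gradient `∇_Γ v` of `v` on the boundary `Γ = ∂Ω`: in every graph chart with
parametrization `Φ`, the function `v ∘ Φ` has the weak gradient `(DΦ)ᵀ (G ∘ Φ)`, and `G` is
tangential to `Γ`. -/
def HasSurfGrad {n : ℕ} (Ω : Set (E (n + 1))) (v : E (n + 1) → ℝ) (G : E (n + 1) → E (n + 1)) :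
    Prop :=
  ∀ (U : Set (E (n + 1))) (e : E (n + 1) ≃ₗᵢ[ℝ] WithLp 2 (E n × ℝ)) (γ : E n → ℝ),
    IsGraphChart Ω U e γ →
      HasWeakGrad (graphDom U e γ) (fun y => v (graphMap e γ y))
        (fun y => (fderiv ℝ (graphMap e γ) y).adjoint (G (graphMap e γ y))) ∧
      ∀ᵐ y ∂(volume.restrict (graphDom U e γ)),
        G (graphMap e γ y) ∈ LinearMap.range (fderiv ℝ (graphMap e γ) y).toLinearMap

/-! ### Linearity of the notion of weak gradient -/

lemma integrable_test {d : ℕ} {D : Set (E d)} {f : E d → ℝ} {θ : E d → ℝ}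
    (hf : LocallyIntegrableOn f D) (hθ : Continuous θ) (hc : HasCompactSupport θ)
    (hs : tsupport θ ⊆ D) : Integrable (fun x => f x * θ x) (volume.restrict D) := by
  have h1 : IntegrableOn (fun x => f x * θ x) (tsupport θ) :=
    (hf.integrableOn_compact_subset hs hc).mul_continuousOn hθ.continuousOn hc
  have h2 : Integrable (fun x => f x * θ x) := by
    refine (integrableOn_iff_integrable_of_support_subset ?_).1 h1
    intro x hx
    apply subset_tsupport
    intro h0
    exact hx (by simp [h0])
  exact h2.integrableOn

lemma integrable_test_deriv {d : ℕ} {D : Set (E d)} {f : E d → ℝ} {η : E d → ℝ}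
    (hf : LocallyIntegrableOn f D) (hη : ContDiff ℝ ∞ η) (hc : HasCompactSupport η)
    (hs : tsupport η ⊆ D) (w : E d) :
    Integrable (fun x => f x * fderiv ℝ η x w) (volume.restrict D) := by
  have hsub : tsupport (fun x => fderiv ℝ η x w) ⊆ tsupport η := by
    refine closure_minimal (fun x hx => ?_) (isClosed_tsupport η)
    apply support_fderiv_subset ℝ
    intro h0
    exact hx (by simp [h0])
  refine integrable_test hf ?_ (hc.of_isClosed_subset (isClosed_tsupport _) hsub)
    (hsub.trans hs)
  exact (hη.continuous_fderiv (by simp)).clm_apply continuous_const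

lemma locallyIntegrableOn_inner {d : ℕ} {D : Set (E d)} {g : E d → E d}
    (hg : LocallyIntegrableOn g D) (w : E d) :
    LocallyIntegrableOn (fun x => inner ℝ (g x) w) D := by
  have := ((innerSL ℝ) w).locallyIntegrableOn_comp hg
  refine this.congr (Eventually.of_forall fun x => ?_)
  simp [real_inner_comm]

lemma HasWeakGrad.add {d : ℕ} {D : Set (E d)} {f f' : E d → ℝ} {g g' : E d → E d}
    (h : HasWeakGrad D f g) (h' : HasWeakGrad D f' g') :
    HasWeakGrad D (fun x => f x + f' x) (fun x => g x + g' x) := by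
  refine ⟨h.1.add h'.1, h.2.1.add h'.2.1, fun η hη hc hs w => ?_⟩
  simp only [add_mul, inner_add_left]
  rw [integral_add (integrable_test_deriv h.1 hη hc hs w) (integrable_test_deriv h'.1 hη hc hs w),
    integral_add (integrable_test (locallyIntegrableOn_inner h.2.1 w) hη.continuous hc hs)
      (integrable_test (locallyIntegrableOn_inner h'.2.1 w) hη.continuous hc hs),
    h.2.2 η hη hc hs w, h'.2.2 η hη hc hs w]
  ring

lemma HasWeakGrad.smul {d : ℕ} {D : Set (E d)} {f : E d → ℝ} {g : E d → E d}
    (h : HasWeakGrad D f g) (c : ℝ) :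
    HasWeakGrad D (fun x => c * f x) (fun x => c • g x) := by
  refine ⟨h.1.smul c, h.2.1.smul c, fun η hη hc hs w => ?_⟩
  simp only [mul_assoc, real_inner_smul_left, integral_const_mul]
  rw [h.2.2 η hη hc hs w]
  ring

lemma HasWeakGrad.congr {d : ℕ} {D : Set (E d)} {f f' : E d → ℝ} {g g' : E d → E d}
    (h : HasWeakGrad D f g) (hf : f =ᵐ[volume.restrict D] f') (hg : g =ᵐ[volume.restrict D] g') :
    HasWeakGrad D f' g' := by
  refine ⟨h.1.congr hf, h.2.1.congr hg, fun η hη hc hs w => ?_⟩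
  have h1 : ∫ x in D, f' x * fderiv ℝ η x w = ∫ x in D, f x * fderiv ℝ η x w :=
    integral_congr_ae (by filter_upwards [hf] with x hx; rw [hx])
  have h2 : ∫ x in D, inner ℝ (g' x) w * η x = ∫ x in D, inner ℝ (g x) w * η x :=
    integral_congr_ae (by filter_upwards [hg] with x hx; rw [hx])
  rw [h1, h2, h.2.2 η hη hc hs w]

lemma hasWeakGrad_const {d : ℕ} (D : Set (E d)) (a : ℝ) :
    HasWeakGrad D (fun _ => a) (fun _ => 0) := by
  refine ⟨locallyIntegrableOn_const a, locallyIntegrableOn_const 0, fun η hη hc hs w => ?_⟩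
  have hd : HasCompactSupport (fun x => fderiv ℝ η x w) := hc.fderiv_apply ℝ w
  have hcont : Continuous (fun x => fderiv ℝ η x w) :=
    (hη.continuous_fderiv (by simp)).clm_apply continuous_const
  have key := integral_mul_fderiv_eq_neg_fderiv_mul_of_integrable (μ := (volume : Measure (E d)))
    (f := fun _ => a) (g := η) (v := w)
    (by simp) ((hcont.integrable_of_hasCompactSupport hd).const_mul a)
    ((hη.continuous.integrable_of_hasCompactSupport hc).const_mul a)
    (fun x _ => by fun_prop) (fun x _ => (hη.differentiable (by simp)).differentiableAt)
  have hset : ∫ x in D, a * fderiv ℝ η x w = ∫ x, a * fderiv ℝ η x w := by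
    refine setIntegral_eq_integral_of_forall_compl_eq_zero fun x hx => ?_
    have : fderiv ℝ η x = 0 := by
      by_contra h0
      exact hx (hs (support_fderiv_subset ℝ h0))
    simp [this]
  rw [hset, key]
  simp

/-! ### Null sets of the surface measure in graph charts, and finiteness -/

lemma graphMap_mem_frontier {n : ℕ} {Ω U : Set (E (n + 1))}
    {e : E (n + 1) ≃ₗᵢ[ℝ] WithLp 2 (E n × ℝ)} {γ : E n → ℝ} (h : IsGraphChart Ω U e γ) {y : E n}
    (hy : y ∈ graphDom U e γ) : graphMap e γ y ∈ frontier Ω := by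
  obtain ⟨hU, -, hiff⟩ := h
  have hnot : graphMap e γ y ∉ Ω := by
    rw [hiff _ hy]
    simp [graphMap]
  refine ⟨?_, fun hi => hnot (interior_subset hi)⟩
  let c : ℝ → E (n + 1) := fun t => e.symm (WithLp.toLp 2 (y, γ y + t))
  have hc : Continuous c := by
    refine e.symm.continuous.comp ((WithLp.prod_continuous_toLp 2 _ _).comp ?_)
    fun_prop
  have hc0 : c 0 = graphMap e γ y := by simp [c, graphMap]
  have ht : Tendsto c (𝓝[>] 0) (𝓝 (graphMap e γ y)) := by
    rw [← hc0]
    exact hc.continuousAt.tendsto.mono_left nhdsWithin_le_nhds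
  refine mem_closure_of_tendsto ht ?_
  filter_upwards [ht (hU.mem_nhds hy), self_mem_nhdsWithin] with t htU htpos
  rw [hiff _ htU]
  simpa [c] using htpos

lemma ae_graphDom_of_ae_surf {n : ℕ} {Ω U : Set (E (n + 1))}
    {e : E (n + 1) ≃ₗᵢ[ℝ] WithLp 2 (E n × ℝ)} {γ : E n → ℝ} (h : IsGraphChart Ω U e γ)
    {p : E (n + 1) → Prop} (hp : ∀ᵐ x ∂(surfMeasure Ω), p x) :
    ∀ᵐ y ∂(volume.restrict (graphDom U e γ)), p (graphMap e γ y) := by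
  rw [ae_iff, Measure.restrict_apply₀']
  swap
  · have hγ : Continuous γ := h.2.1.choose_spec.continuous
    have hcont : Continuous (graphMap e γ) := by
      refine e.symm.continuous.comp ((WithLp.prod_continuous_toLp 2 _ _).comp ?_)
      fun_prop
    exact (h.1.preimage hcont).measurableSet.nullMeasurableSet
  rw [ae_iff, Measure.restrict_apply' isClosed_frontier.measurableSet,
    Measure.euclideanHausdorffMeasure_def, Measure.smul_apply, smul_eq_zero] at hp
  have hp0 := hp.resolve_left
    (Measure.addHaarScalarFactor_volume_hausdorffMeasure_ne_zero n)
  let π : E (n + 1) → E n := fun z => (e z).fst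
  have hπ : LipschitzWith 1 π := by
    refine LipschitzWith.of_dist_le_mul fun z z' => ?_
    simp only [NNReal.coe_one, one_mul]
    have h1 : dist (e z) (e z') = dist z z' := e.dist_map z z'
    rw [← h1, WithLp.prod_dist_eq_of_L2]
    exact Real.le_sqrt_of_sq_le (le_add_of_nonneg_right (by positivity))
  have himg := hπ.hausdorffMeasure_image_le (d := (n : ℝ)) (by positivity)
    ({a | ¬p a} ∩ frontier Ω)
  rw [hp0, mul_zero] at himg
  have hnull : volume (π '' ({a | ¬p a} ∩ frontier Ω)) = 0 := by
    rw [Measure.isAddLeftInvariant_eq_smul (volume : Measure (E n)) (μH[(n : ℝ)])]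
    simp [nonpos_iff_eq_zero.1 himg]
  refine measure_mono_null (fun y hy => ?_) hnull
  exact ⟨graphMap e γ y, ⟨hy.1, graphMap_mem_frontier h hy.2⟩, by simp [π, graphMap]⟩

lemma HasSurfGrad.add {n : ℕ} {Ω : Set (E (n + 1))} {v v' : E (n + 1) → ℝ}
    {G G' : E (n + 1) → E (n + 1)} (h : HasSurfGrad Ω v G) (h' : HasSurfGrad Ω v' G') :
    HasSurfGrad Ω (fun x => v x + v' x) (fun x => G x + G' x) := by
  intro U e γ hc
  refine ⟨?_, ?_⟩
  · have := (h U e γ hc).1.add (h' U e γ hc).1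
    simpa only [map_add] using this
  · filter_upwards [(h U e γ hc).2, (h' U e γ hc).2] with y h1 h2
    exact Submodule.add_mem _ h1 h2

lemma HasSurfGrad.smul {n : ℕ} {Ω : Set (E (n + 1))} {v : E (n + 1) → ℝ}
    {G : E (n + 1) → E (n + 1)} (h : HasSurfGrad Ω v G) (c : ℝ) :
    HasSurfGrad Ω (fun x => c * v x) (fun x => c • G x) := by
  intro U e γ hc
  refine ⟨?_, ?_⟩
  · have := (h U e γ hc).1.smul c
    simpa only [map_smul] using this
  · filter_upwards [(h U e γ hc).2] with y h1
    exact Submodule.smul_mem _ c h1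

lemma HasSurfGrad.congr {n : ℕ} {Ω : Set (E (n + 1))} {v v' : E (n + 1) → ℝ}
    {G G' : E (n + 1) → E (n + 1)} (h : HasSurfGrad Ω v G)
    (hv : v =ᵐ[surfMeasure Ω] v') (hG : G =ᵐ[surfMeasure Ω] G') : HasSurfGrad Ω v' G' := by
  intro U e γ hc
  have hv' := ae_graphDom_of_ae_surf hc hv
  have hG' := ae_graphDom_of_ae_surf hc hG
  refine ⟨(h U e γ hc).1.congr hv' ?_, ?_⟩
  · filter_upwards [hG'] with y hy
    rw [hy]
  · filter_upwards [hG', (h U e γ hc).2] with y hy h1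
    rwa [← hy]

lemma hasSurfGrad_const {n : ℕ} (Ω : Set (E (n + 1))) (a : ℝ) :
    HasSurfGrad Ω (fun _ => a) (fun _ => 0) := by
  intro U e γ _
  refine ⟨?_, Eventually.of_forall fun y => Submodule.zero_mem _⟩
  simpa only [map_zero] using hasWeakGrad_const (graphDom U e γ) a

lemma IsLipschitzDomain.isFiniteMeasure_bulk {n : ℕ} {Ω : Set (E (n + 1))}
    (hΩ : IsLipschitzDomain Ω) : IsFiniteMeasure (bulkMeasure Ω) :=
  ⟨by rw [Measure.restrict_apply_univ]; exact hΩ.isBounded.measure_lt_top⟩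

lemma IsLipschitzDomain.isFiniteMeasure_surf {n : ℕ} {Ω : Set (E (n + 1))}
    (hΩ : IsLipschitzDomain Ω) : IsFiniteMeasure (surfMeasure Ω) := by
  refine ⟨?_⟩
  rw [Measure.restrict_apply_univ]
  have hcomp : IsCompact (frontier Ω) :=
    Metric.isCompact_of_isClosed_isBounded isClosed_frontier
      (hΩ.isBounded.closure.subset frontier_subset_closure)
  suffices hH : μH[(n : ℝ)] (frontier Ω) < ⊤ by
    rw [Measure.euclideanHausdorffMeasure_def, Measure.smul_apply]
    exact ENNReal.mul_lt_top ENNReal.coe_lt_top hH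
  refine hcomp.induction_on (p := fun s => μH[(n : ℝ)] (s ∩ frontier Ω) < ⊤) (by simp)
    (fun s t hst ht => (measure_mono (by gcongr)).trans_lt ht)
    (fun s t hs ht => ?_) (fun x hx => ?_) |>.trans_eq' (by simp)
  · rw [union_inter_distrib_right]
    exact (measure_union_le _ _).trans_lt (ENNReal.add_lt_top.2 ⟨hs, ht⟩)
  · obtain ⟨U, e, γ, hxU, hU, ⟨K, hK⟩, hiff⟩ := hΩ.exists_chart x hx
    refine ⟨U ∩ Metric.ball x 1, mem_nhdsWithin_of_mem_nhds
      ((hU.inter Metric.isOpen_ball).mem_nhds ⟨hxU, by simp⟩), ?_⟩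
    have hLip : LipschitzWith (1 + K) (graphMap e γ) := by
      refine LipschitzWith.of_dist_le_mul fun y y' => ?_
      have h1 : dist (graphMap e γ y) (graphMap e γ y') =
          dist (WithLp.toLp 2 (y, γ y)) (WithLp.toLp 2 (y', γ y')) := e.symm.dist_map _ _
      rw [h1, WithLp.prod_dist_eq_of_L2]
      have h2 := hK.dist_le_mul y y'
      have h3 : (0 : ℝ) ≤ dist y y' := dist_nonneg
      have h4 : (0 : ℝ) ≤ dist (γ y) (γ y') := dist_nonneg
      refine Real.sqrt_le_iff.2 ⟨by positivity, ?_⟩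
      have h5 : dist y y' + dist (γ y) (γ y') ≤ ((1 + K : ℝ≥0) : ℝ) * dist y y' := by
        push_cast
        linarith
      have h6 := pow_le_pow_left₀ (by positivity) h5 2
      refine le_trans ?_ h6
      simp only [WithLp.toLp_fst, WithLp.toLp_snd]
      nlinarith
    have hfin : μH[(n : ℝ)] (Metric.ball (e x).fst 1) < ⊤ := Metric.isBounded_ball.measure_lt_top
    have himg := hLip.hausdorffMeasure_image_le (d := (n : ℝ)) (by positivity)
      (Metric.ball (e x).fst 1)
    refine (measure_mono fun z hz => ?_).trans_lt (himg.trans_lt (ENNReal.mul_lt_top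
      (ENNReal.rpow_lt_top_of_nonneg (by positivity) ENNReal.coe_ne_top) hfin))
    obtain ⟨⟨hzU, hzb⟩, hzf⟩ := hz
    have hdist : dist (e z).fst (e x).fst ≤ dist z x := by
      rw [← e.dist_map z x, WithLp.prod_dist_eq_of_L2]
      exact Real.le_sqrt_of_sq_le (le_add_of_nonneg_right (by positivity))
    refine ⟨(e z).fst, hdist.trans_lt hzb, ?_⟩
    have hcf : Continuous fun z => (e z).fst :=
      (WithLp.continuous_fst ..).comp e.continuous
    have hcs : Continuous fun z => (e z).snd :=
      (WithLp.continuous_snd ..).comp e.continuous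
    have heq : γ (e z).fst = (e z).snd := by
      refine le_antisymm ?_ (not_lt.1 fun hlt => ?_)
      · by_contra hlt
        have hne : ∀ᶠ z' in 𝓝 z, z' ∉ Ω := by
          filter_upwards [hU.mem_nhds hzU, (isOpen_lt hcs (hK.continuous.comp hcf)).mem_nhds
            (not_le.1 hlt)] with z' h1 h2
          rw [hiff _ h1]
          exact not_lt.2 (le_of_lt h2)
        have := mem_closure_iff_frequently.1 hzf.1
        exact this hne
      · exact hzf.2 (mem_interior_iff_mem_nhds.2 (by
          filter_upwards [hU.mem_nhds hzU, (isOpen_lt (hK.continuous.comp hcf) hcs).mem_nhds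
            hlt] with z' h1 h2
          exact (hiff _ h1).2 h2))
    have : WithLp.toLp 2 ((e z).fst, γ (e z).fst) = e z := by
      rw [heq]
      rfl
    simp [graphMap, this]

/-! ### The spaces `H¹(Ω)`, `H¹(Γ)` and their product -/

/-- `H¹(Ω)`, as the space of pairs `(u, ∇u)` in `L²(Ω) × L²(Ω; ℝ^d)`; the norm inherited from the
product is `(‖u‖² + ‖∇u‖²)^{1/2}`. -/
def bulkH1 {d : ℕ} (Ω : Set (E d)) :
    Submodule ℝ (WithLp 2 (Lp ℝ 2 (bulkMeasure Ω) × Lp (E d) 2 (bulkMeasure Ω))) where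
  carrier := {p | HasWeakGrad Ω p.fst p.snd}
  add_mem' {p q} hp hq :=
    (HasWeakGrad.add hp hq).congr (Lp.coeFn_add p.fst q.fst).symm (Lp.coeFn_add p.snd q.snd).symm
  zero_mem' := (hasWeakGrad_const Ω 0).congr (Lp.coeFn_zero _ _ _).symm (Lp.coeFn_zero _ _ _).symm
  smul_mem' c p hp :=
    (HasWeakGrad.smul hp c).congr (Lp.coeFn_smul c p.fst).symm (Lp.coeFn_smul c p.snd).symm

/-- `H¹(Γ)`, `Γ = ∂Ω`, as the space of pairs `(v, ∇_Γ v)` in `L²(Γ) × L²(Γ; ℝ^d)`; the norm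
inherited from the product is `(‖v‖² + ‖∇_Γ v‖²)^{1/2}`. -/
def surfH1 {n : ℕ} (Ω : Set (E (n + 1))) :
    Submodule ℝ (WithLp 2 (Lp ℝ 2 (surfMeasure Ω) × Lp (E (n + 1)) 2 (surfMeasure Ω))) where
  carrier := {p | HasSurfGrad Ω p.fst p.snd}
  add_mem' {p q} hp hq :=
    (HasSurfGrad.add hp hq).congr (Lp.coeFn_add p.fst q.fst).symm (Lp.coeFn_add p.snd q.snd).symm
  zero_mem' := (hasSurfGrad_const Ω 0).congr (Lp.coeFn_zero _ _ _).symm (Lp.coeFn_zero _ _ _).symm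
  smul_mem' c p hp :=
    (HasSurfGrad.smul hp c).congr (Lp.coeFn_smul c p.fst).symm (Lp.coeFn_smul c p.snd).symm

/-- The Hilbert space `ℋ¹ = H¹(Ω) × H¹(Γ)`. -/
abbrev H1 {n : ℕ} (Ω : Set (E (n + 1))) := WithLp 2 (bulkH1 Ω × surfH1 Ω)

/-- The component `u ∈ L²(Ω)` of `(u, v) ∈ ℋ¹`. -/
def H1.bulk {n : ℕ} {Ω : Set (E (n + 1))} (p : H1 Ω) : Lp ℝ 2 (bulkMeasure Ω) :=
  (p.fst : WithLp 2 (Lp ℝ 2 (bulkMeasure Ω) × Lp (E (n + 1)) 2 (bulkMeasure Ω))).fst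

/-- The gradient `∇u ∈ L²(Ω; ℝ^d)` of the first component of `(u, v) ∈ ℋ¹`. -/
def H1.bulkGrad {n : ℕ} {Ω : Set (E (n + 1))} (p : H1 Ω) : Lp (E (n + 1)) 2 (bulkMeasure Ω) :=
  (p.fst : WithLp 2 (Lp ℝ 2 (bulkMeasure Ω) × Lp (E (n + 1)) 2 (bulkMeasure Ω))).snd

/-- The component `v ∈ L²(Γ)` of `(u, v) ∈ ℋ¹`. -/
def H1.surf {n : ℕ} {Ω : Set (E (n + 1))} (p : H1 Ω) : Lp ℝ 2 (surfMeasure Ω) :=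
  (p.snd : WithLp 2 (Lp ℝ 2 (surfMeasure Ω) × Lp (E (n + 1)) 2 (surfMeasure Ω))).fst

/-- The surface gradient `∇_Γ v ∈ L²(Γ; ℝ^d)` of the second component of `(u, v) ∈ ℋ¹`. -/
def H1.surfGrad {n : ℕ} {Ω : Set (E (n + 1))} (p : H1 Ω) : Lp (E (n + 1)) 2 (surfMeasure Ω) :=
  (p.snd : WithLp 2 (Lp ℝ 2 (surfMeasure Ω) × Lp (E (n + 1)) 2 (surfMeasure Ω))).snd

/-! ### Traces -/

/-- The pairs `(φ|_Ω, φ|_Γ)` in `H¹(Ω) × L²(Γ)` with `φ` smooth on `ℝ^d`. -/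
def smoothTraceGraph {n : ℕ} (Ω : Set (E (n + 1))) :
    Submodule ℝ (bulkH1 Ω × Lp ℝ 2 (surfMeasure Ω)) where
  carrier := {q | ∃ φ : E (n + 1) → ℝ, ContDiff ℝ ∞ φ ∧
    (q.1 : WithLp 2 (Lp ℝ 2 (bulkMeasure Ω) × Lp (E (n + 1)) 2 (bulkMeasure Ω))).fst
      =ᵐ[bulkMeasure Ω] φ ∧ q.2 =ᵐ[surfMeasure Ω] φ}
  add_mem' := by
    rintro p q ⟨φ, hφ, h1, h2⟩ ⟨φ', hφ', h1', h2'⟩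
    exact ⟨φ + φ', hφ.add hφ', (Lp.coeFn_add _ _).trans (h1.add h1'),
      (Lp.coeFn_add _ _).trans (h2.add h2')⟩
  zero_mem' := ⟨0, contDiff_const, Lp.coeFn_zero _ _ _, Lp.coeFn_zero _ _ _⟩
  smul_mem' := by
    rintro c p ⟨φ, hφ, h1, h2⟩
    exact ⟨c • φ, hφ.const_smul c, (Lp.coeFn_smul _ _).trans (h1.const_smul c),
      (Lp.coeFn_smul _ _).trans (h2.const_smul c)⟩

/-- The graph of the trace operator `H¹(Ω) → L²(Γ)`, that is the continuous extension of the
restriction `φ|_Ω ↦ φ|_Γ` of smooth functions: the closure of `smoothTraceGraph`. -/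
def traceGraph {n : ℕ} (Ω : Set (E (n + 1))) :
    Submodule ℝ (bulkH1 Ω × Lp ℝ 2 (surfMeasure Ω)) :=
  (smoothTraceGraph Ω).topologicalClosure

open Classical in
/-- The trace `u|_Γ ∈ L²(Γ)` of `u ∈ H¹(Ω)`. -/
def trace {n : ℕ} {Ω : Set (E (n + 1))} (u : bulkH1 Ω) : Lp ℝ 2 (surfMeasure Ω) :=
  if h : ∃ w, (u, w) ∈ traceGraph Ω then h.choose else 0

/-! ### The spaces `ℋ¹_L`, `𝒱¹_L` and `𝒱⁻¹_L` -/

/-- The linear map `(u, v) ↦ (u, β v)` from `ℋ¹` to `H¹(Ω) × L²(Γ)`. -/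
def coupling {n : ℕ} (Ω : Set (E (n + 1))) (β : ℝ) :
    H1 Ω →ₗ[ℝ] bulkH1 Ω × Lp ℝ 2 (surfMeasure Ω) :=
  (WithLp.fstₗ 2 ℝ (bulkH1 Ω) (surfH1 Ω)).prod
    (β • (WithLp.fstₗ 2 ℝ (Lp ℝ 2 (surfMeasure Ω)) (Lp (E (n + 1)) 2 (surfMeasure Ω)) ∘ₗ
      (surfH1 Ω).subtype ∘ₗ WithLp.sndₗ 2 ℝ (bulkH1 Ω) (surfH1 Ω)))

/-- `ℋ¹_L`: all of `ℋ¹` if `L ∈ (0, ∞]`, and the pairs `(u, v)` with `u = β v` a.e. on `Γ` in the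
sense of traces if `L = 0`. -/
def H1L {n : ℕ} (Ω : Set (E (n + 1))) (L : ℝ≥0∞) (β : ℝ) : Submodule ℝ (H1 Ω) :=
  if L = 0 then (traceGraph Ω).comap (coupling Ω β) else ⊤

lemma mem_H1L_iff {n : ℕ} {Ω : Set (E (n + 1))} {L : ℝ≥0∞} {β : ℝ} {p : H1 Ω} :
    p ∈ H1L Ω L β ↔ (L = 0 → (p.fst, β • p.surf) ∈ traceGraph Ω) := by
  unfold H1L
  split_ifs with h
  · simp only [h, true_imp_iff]
    rfl
  · simp [h]

/-- The constant function `a` as an element of `H¹(Ω)`. -/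
def constBulk {n : ℕ} {Ω : Set (E (n + 1))} (hΩ : IsLipschitzDomain Ω) (a : ℝ) : bulkH1 Ω :=
  haveI := hΩ.isFiniteMeasure_bulk
  ⟨WithLp.toLp 2 ((memLp_const a : MemLp (fun _ => a) 2 (bulkMeasure Ω)).toLp, 0),
    (hasWeakGrad_const Ω a).congr
      (memLp_const a : MemLp (fun _ => a) 2 (bulkMeasure Ω)).coeFn_toLp.symm
      (Lp.coeFn_zero _ _ _).symm⟩

/-- The constant function `b` as an element of `H¹(Γ)`. -/
def constSurf {n : ℕ} {Ω : Set (E (n + 1))} (hΩ : IsLipschitzDomain Ω) (b : ℝ) : surfH1 Ω :=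
  haveI := hΩ.isFiniteMeasure_surf
  ⟨WithLp.toLp 2 ((memLp_const b : MemLp (fun _ => b) 2 (surfMeasure Ω)).toLp, 0),
    (hasSurfGrad_const Ω b).congr
      (memLp_const b : MemLp (fun _ => b) 2 (surfMeasure Ω)).coeFn_toLp.symm
      (Lp.coeFn_zero _ _ _).symm⟩

/-- The pair of constant functions `(a, b) ∈ ℋ¹`. -/
def constH1 {n : ℕ} {Ω : Set (E (n + 1))} (hΩ : IsLipschitzDomain Ω) (a b : ℝ) : H1 Ω :=
  WithLp.toLp 2 (constBulk hΩ a, constSurf hΩ b)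

lemma constH1_mem {n : ℕ} {Ω : Set (E (n + 1))} (hΩ : IsLipschitzDomain Ω) {L : ℝ≥0∞} {β a b : ℝ}
    (h : L = 0 → a = β * b) : constH1 hΩ a b ∈ H1L Ω L β := by
  refine mem_H1L_iff.2 fun hL => ?_
  have := hΩ.isFiniteMeasure_bulk
  have := hΩ.isFiniteMeasure_surf
  have h1 : (constH1 hΩ a b).surf =ᵐ[surfMeasure Ω] fun _ => b :=
    (memLp_const b : MemLp (fun _ => b) 2 (surfMeasure Ω)).coeFn_toLp
  apply Submodule.le_topologicalClosure
  refine ⟨fun _ => a, contDiff_const,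
    (memLp_const a : MemLp (fun _ => a) 2 (bulkMeasure Ω)).coeFn_toLp, ?_⟩
  filter_upwards [Lp.coeFn_smul β (constH1 hΩ a b).surf, h1] with x hx hx1
  rw [hx, Pi.smul_apply, hx1, h hL, smul_eq_mul]

/-- The element `(β, 1) ∈ ℋ¹_L`. -/
def constL {n : ℕ} {Ω : Set (E (n + 1))} (hΩ : IsLipschitzDomain Ω) (L : ℝ≥0∞) (β : ℝ) :
    H1L Ω L β :=
  ⟨constH1 hΩ β 1, constH1_mem hΩ fun _ => (mul_one β).symm⟩

/-- The measure `|Ω|` of the domain. -/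
def vol {n : ℕ} (Ω : Set (E (n + 1))) : ℝ := (bulkMeasure Ω).real univ

/-- The measure `|Γ|` of the boundary. -/
def area {n : ℕ} (Ω : Set (E (n + 1))) : ℝ := (surfMeasure Ω).real univ

/-- `𝒱¹_L`: the pairs `(u, v) ∈ ℋ¹_L` with vanishing generalized bulk-surface mean
`(β ∫_Ω u + ∫_Γ v) / (β² |Ω| + |Γ|)` if `L ∈ [0, ∞)`, and with vanishing means of `u` over `Ω` and
of `v` over `Γ` if `L = ∞`. -/
def V1 {n : ℕ} (Ω : Set (E (n + 1))) (L : ℝ≥0∞) (β : ℝ) : Set (H1L Ω L β) :=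
  {p | (L ≠ ⊤ → (β * ∫ x, (p : H1 Ω).bulk x ∂(bulkMeasure Ω)
          + ∫ x, (p : H1 Ω).surf x ∂(surfMeasure Ω)) / (β ^ 2 * vol Ω + area Ω) = 0) ∧
       (L = ⊤ → (∫ x, (p : H1 Ω).bulk x ∂(bulkMeasure Ω)) / vol Ω = 0 ∧
          (∫ x, (p : H1 Ω).surf x ∂(surfMeasure Ω)) / area Ω = 0)}

/-- `𝒱⁻¹_L`: the functionals `F = (f, g)` in the dual of `ℋ¹_L` with vanishing generalized
bulk-surface mean `⟨F, (β, 1)⟩ / (β² |Ω| + |Γ|)` if `L ∈ [0, ∞)`, and with vanishing means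
`⟨F, (1, 0)⟩ / |Ω|` of `f` and `⟨F, (0, 1)⟩ / |Γ|` of `g` if `L = ∞`. -/
def Vdual {n : ℕ} {Ω : Set (E (n + 1))} (hΩ : IsLipschitzDomain Ω) (L : ℝ≥0∞) (β : ℝ) :
    Set (StrongDual ℝ (H1L Ω L β)) :=
  {F | (L ≠ ⊤ → F (constL hΩ L β) / (β ^ 2 * vol Ω + area Ω) = 0) ∧
       ∀ hL : L = ⊤,
          F ⟨constH1 hΩ 1 0, constH1_mem hΩ fun h => absurd (hL.symm.trans h) ENNReal.top_ne_zero⟩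
            / vol Ω = 0 ∧
          F ⟨constH1 hΩ 0 1, constH1_mem hΩ fun h => absurd (hL.symm.trans h) ENNReal.top_ne_zero⟩
            / area Ω = 0}

/-! ### The elliptic system -/

/-- `χ(L) = 1 / L` if `L ∈ (0, ∞)`, and `χ(L) = 0` if `L ∈ {0, ∞}`. -/
def chi (L : ℝ≥0∞) : ℝ := if L = 0 ∨ L = ⊤ then 0 else L.toReal⁻¹

/-- The bilinear form of the elliptic system with coefficients `a` in the bulk and `b` on the
surface:
`∫_Ω a ∇u·∇ζ + ∫_Γ b ∇_Γ v·∇_Γ ξ + χ(L) ∫_Γ (β v - u) (β ξ - ζ)` for `p = (u, v)`, `q = (ζ, ξ)`. -/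
def form {n : ℕ} {Ω : Set (E (n + 1))} (L : ℝ≥0∞) (β : ℝ) (a b : E (n + 1) → ℝ) (p q : H1 Ω) : ℝ :=
  ∫ x, a x * inner ℝ (p.bulkGrad x) (q.bulkGrad x) ∂(bulkMeasure Ω)
    + ∫ x, b x * inner ℝ (p.surfGrad x) (q.surfGrad x) ∂(surfMeasure Ω)
    + chi L * ∫ x, (β * p.surf x - trace p.fst x) * (β * q.surf x - trace q.fst x)
        ∂(surfMeasure Ω)

/-- The (semi)norm `‖(u, v)‖_L` on `ℋ¹`. -/
def normL {n : ℕ} {Ω : Set (E (n + 1))} (L : ℝ≥0∞) (β : ℝ) (p : H1 Ω) : ℝ :=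
  Real.sqrt (form L β (fun _ => 1) (fun _ => 1) p p)

/-- `(u, v) ∈ ℋ¹_L` is a weak solution of the bulk-surface elliptic system with data
`F = (f, g) ∈ (ℋ¹_L)'`. -/
def IsWeakSolution {n : ℕ} {Ω : Set (E (n + 1))} {L : ℝ≥0∞} {β : ℝ} (mΩ mΓ : ℝ → ℝ)
    (φ ψ : E (n + 1) → ℝ) (F : StrongDual ℝ (H1L Ω L β)) (p : H1L Ω L β) : Prop :=
  ∀ q : H1L Ω L β,
    form L β (fun x => mΩ (φ x)) (fun x => mΓ (ψ x)) (p : H1 Ω) (q : H1 Ω) = F q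

/-- A mobility function: continuous on `[-1, 1]` with values in `[mlow, mup]` there. -/
def IsMobility (mlow mup : ℝ) (m : ℝ → ℝ) : Prop :=
  ContinuousOn m (Icc (-1) 1) ∧ ∀ s ∈ Icc (-1 : ℝ) 1, mlow ≤ m s ∧ m s ≤ mup

end BulkSurface

end

noncomputable section

namespace BulkSurface

/-! ### Mollification in `L²` -/

/-! The form annihilates certain constants: the multiples of (β, 1) if L < ∞, all pairs of constants
if L = ∞. On the complementary space 𝒱¹_L a Poincaré inequality ‖p‖ ≤ K‖p‖_L holds, and since the
coefficients are bounded below, the form is at least min(1, m*)‖p‖_L² on the diagonal; so it is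
coercive there and Lax–Milgram applies. The data vanish on the same constants, hence the identity
extends from test pairs in 𝒱¹_L to all test pairs. For the estimate, an arbitrary weak solution is
shifted by such a constant into 𝒱¹_L, which changes neither ‖·‖_L nor the value of the functional,
and is then tested with itself; this gives C = K / min(1, m*). The functional-analytic part is
`existsUnique_and_estimate`.

The Poincaré inequality for pairs (`IsLipschitzDomain.exists_norm_le_normL`) is proved directly. Let
a be the mean of u. The gradient controls u - a in Ω and, through the trace bound, u - a on Γ. The
jump βv - u is zero (L = 0) or part of the norm (0 < L < ∞), so βv - a is controlled, and the mean
condition turns this into a bound for a itself. If β ≠ 0 this also bounds v. If β = 0 or L = ∞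
nothing couples v to u, and the Poincaré inequality on Γ is needed; this is where connectedness of Γ
enters.

The analytic inputs are derived from graph charts: density of smooth functions, by mollifying into
the domain along a cone (`IsLipschitzDomain.exists_contDiff_approx`); the trace inequality, by
integrating along vertical lines above the graph (`IsLipschitzDomain.exists_local_trace_bound`); and
Poincaré inequalities in Ω and on Γ, from estimates along segments in small patches that are glued
along overlaps (`poincareOn_of_local`). -/

lemma eLpNorm_two_sq {α F : Type*} [MeasurableSpace α] [NormedAddCommGroup F] (f : α → F)
    (μ : Measure α) : eLpNorm f 2 μ ^ 2 = ∫⁻ x, ‖f x‖ₑ ^ 2 ∂μ := by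
  have := eLpNorm_nnreal_pow_eq_lintegral (μ := μ) (f := f) (p := 2) (by norm_num)
  simpa using this

/-- Jensen's inequality for the square, in the form L¹ norm ≤ L² norm on a probability space. -/
lemma enorm_integral_sq_le {α F : Type*} [MeasurableSpace α] [NormedAddCommGroup F]
    [NormedSpace ℝ F] (ν : Measure α) [IsProbabilityMeasure ν] {h : α → F}
    (hm : AEStronglyMeasurable h ν) : ‖∫ z, h z ∂ν‖ₑ ^ 2 ≤ ∫⁻ z, ‖h z‖ₑ ^ 2 ∂ν := by
  rw [← eLpNorm_two_sq]
  gcongr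
  refine (enorm_integral_le_lintegral_enorm h).trans ?_
  rw [← eLpNorm_one_eq_lintegral_enorm]
  exact eLpNorm_le_eLpNorm_of_exponent_le (by norm_num) hm

/-- Minkowski's inequality for an average of L² functions: Jensen pointwise in x, then Tonelli. -/
lemma eLpNorm_integral_le_of_forall {α X F : Type*} [MeasurableSpace α] [MeasurableSpace X]
    [NormedAddCommGroup F] [NormedSpace ℝ F] (ν : Measure α) [IsProbabilityMeasure ν]
    (μ : Measure X) [SFinite μ] {h : X → α → F}
    (hm : StronglyMeasurable (Function.uncurry h)) {ε : ℝ≥0∞}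
    (hε : ∀ᵐ z ∂ν, eLpNorm (fun x => h x z) 2 μ ≤ ε) :
    eLpNorm (fun x => ∫ z, h x z ∂ν) 2 μ ≤ ε := by
  have key : eLpNorm (fun x => ∫ z, h x z ∂ν) 2 μ ^ 2 ≤ ε ^ 2 := by
    rw [eLpNorm_two_sq]
    calc ∫⁻ x, ‖∫ z, h x z ∂ν‖ₑ ^ 2 ∂μ ≤ ∫⁻ x, ∫⁻ z, ‖h x z‖ₑ ^ 2 ∂ν ∂μ :=
          lintegral_mono fun x => enorm_integral_sq_le ν
            (hm.comp_measurable measurable_prodMk_left).aestronglyMeasurable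
      _ = ∫⁻ z, ∫⁻ x, ‖h x z‖ₑ ^ 2 ∂μ ∂ν :=
          lintegral_lintegral_swap (hm.enorm.pow_const 2).aemeasurable
      _ ≤ ∫⁻ _, ε ^ 2 ∂ν := by
          refine lintegral_mono_ae ?_
          filter_upwards [hε] with z hz
          rw [← eLpNorm_two_sq]
          gcongr
      _ = ε ^ 2 := by simp
  exact (ENNReal.pow_le_pow_left_iff two_ne_zero).1 key

/-- Translations act continuously on L², so the orbit map of f is continuous at 0. -/
lemma tendsto_eLpNorm_translate_sub {d : ℕ} {F : Type*} [NormedAddCommGroup F] {f : E d → F}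
    (hf : MemLp f 2 volume) :
    Tendsto (fun z => eLpNorm (fun x => f (x + z) - f x) 2 volume) (𝓝 0) (𝓝 0) := by
  have : Fact ((2 : ℝ≥0∞) ≠ ⊤) := ⟨by norm_num⟩
  have hcont : Continuous fun z : E d => DomAddAct.mk z +ᵥ hf.toLp f := by
    have h1 : Continuous fun z : E d => (DomAddAct.mk z : (E d)ᵈᵃᵃ) := DomAddAct.continuous_mk
    exact h1.vadd continuous_const
  have h2 := (hcont.tendsto 0).edist (tendsto_const_nhds (x := hf.toLp f))
  simp only [DomAddAct.mk_zero, zero_vadd, edist_self] at h2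
  refine h2.congr fun z => ?_
  rw [DomAddAct.mk_vadd_toLp, Lp.edist_toLp_toLp]
  refine eLpNorm_congr_ae (Eventually.of_forall fun x => ?_)
  simp [add_comm]

lemma locallyIntegrable_translate {d : ℕ} {F : Type*} [NormedAddCommGroup F] {f : E d → F}
    (hf : LocallyIntegrable f) (x : E d) : LocallyIntegrable fun z => f (x + z) := by
  refine (locallyIntegrable_map_homeomorph (Homeomorph.addLeft x)).1 ?_
  simpa [map_add_left_eq_self] using hf

/-- The averages `∫ ρ(z) f(x + z) dz`. -/
def mollify {d : ℕ} {F : Type*} [NormedAddCommGroup F] [NormedSpace ℝ F] (ρ : E d → ℝ)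
    (f : E d → F) (x : E d) : F :=
  ∫ z, ρ z • f (x + z)

lemma mollify_eq_convolution {d : ℕ} {F : Type*} [NormedAddCommGroup F] [NormedSpace ℝ F]
    (ρ : E d → ℝ) (f : E d → F) :
    mollify ρ f = convolution (fun z => ρ (-z)) f (ContinuousLinearMap.lsmul ℝ ℝ) volume := by
  ext x
  rw [mollify, convolution, ← integral_neg_eq_self]
  simp [sub_eq_add_neg]

lemma contDiff_mollify {d : ℕ} {ρ : E d → ℝ} (hρ : ContDiff ℝ ∞ ρ) (hc : HasCompactSupport ρ)
    {f : E d → ℝ} (hf : LocallyIntegrable f) : ContDiff ℝ ∞ (mollify ρ f) := by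
  rw [mollify_eq_convolution]
  exact (hc.comp_homeomorph (Homeomorph.neg (E d))).contDiff_convolution_left _
    (hρ.comp contDiff_neg) hf

/-- The derivative falls on the kernel. The result is written as f tested against the derivative of
the translate ρ(· - x), which is the shape occurring in `HasWeakGrad`. -/
lemma fderiv_mollify {d : ℕ} {ρ : E d → ℝ} (hρ : ContDiff ℝ ∞ ρ) (hc : HasCompactSupport ρ)
    {f : E d → ℝ} (hf : LocallyIntegrable f) (x w : E d) :
    fderiv ℝ (mollify ρ f) x w = -∫ s, f s * fderiv ℝ (fun s => ρ (s - x)) s w := by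
  have hc' : HasCompactSupport fun z : E d => ρ (-z) :=
    hc.comp_homeomorph (Homeomorph.neg (E d))
  have hρ' : ContDiff ℝ ∞ fun z : E d => ρ (-z) := hρ.comp contDiff_neg
  rw [mollify_eq_convolution, (hc'.hasFDerivAt_convolution_left _ (hρ'.of_le (by simp)) hf x).fderiv,
    convolution_eq_swap, ContinuousLinearMap.integral_apply, ← integral_neg]
  swap
  · have := ((hc'.fderiv ℝ).convolutionExists_left ((ContinuousLinearMap.lsmul ℝ ℝ).precompL (E d))
      (hρ'.continuous_fderiv (by simp)) hf x).integrable_swap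
    exact this
  refine integral_congr_ae (Eventually.of_forall fun s => ?_)
  have hd : Differentiable ℝ ρ := hρ.differentiable (by simp)
  have e1 : fderiv ℝ (fun z : E d => ρ (-z)) (x - s) w = -fderiv ℝ ρ (s - x) w := by
    have h1 : HasFDerivAt ρ (fderiv ℝ ρ (s - x)) (-(x - s)) := by
      rw [neg_sub]
      exact hd.differentiableAt.hasFDerivAt
    have h2 : HasFDerivAt (fun z : E d => ρ (-z)) _ (x - s) :=
      h1.comp (x - s) (hasFDerivAt_id (x - s)).fun_neg
    rw [h2.fderiv]
    simp
  have e2 : fderiv ℝ (fun s => ρ (s - x)) s = fderiv ℝ ρ (s - x) := by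
    have h2 : HasFDerivAt (fun s => ρ (s - x)) _ s :=
      hd.differentiableAt.hasFDerivAt.comp s ((hasFDerivAt_id s).sub_const x)
    rw [h2.fderiv]
    simp
  simp only [ContinuousLinearMap.precompL_apply, ContinuousLinearMap.lsmul_apply, e1, e2,
    smul_eq_mul]
  ring

/-- The translate ρ(· - x) is an admissible test function as soon as x + supp ρ lies in D; the point
x itself may lie outside D, which is what permits mollifying near the boundary. -/
lemma gradient_mollify {d : ℕ} {ρ : E d → ℝ} (hρ : ContDiff ℝ ∞ ρ) (hc : HasCompactSupport ρ)
    {D : Set (E d)} {f : E d → ℝ} {g : E d → E d} (hf : LocallyIntegrable f)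
    (hg : LocallyIntegrable g) (h : HasWeakGrad D f g) {x : E d}
    (hx : ∀ z ∈ tsupport ρ, x + z ∈ D) : gradient (mollify ρ f) x = mollify ρ g x := by
  refine ext_inner_right ℝ fun w => ?_
  have hgi : Integrable (fun z => ρ z • g (x + z)) := by
    have : LocallyIntegrable (fun z => g (x + z)) := by
      exact locallyIntegrable_translate hg x
    exact this.integrable_smul_left_of_hasCompactSupport hρ.continuous hc
  have e1 : inner ℝ (gradient (mollify ρ f) x) w = fderiv ℝ (mollify ρ f) x w := by
    rw [gradient, InnerProductSpace.toDual_symm_apply]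
  have e2 : inner ℝ (mollify ρ g x) w = ∫ z, inner ℝ (g (x + z)) w * ρ z := by
    rw [mollify, real_inner_comm, ← integral_inner hgi]
    refine integral_congr_ae (Eventually.of_forall fun z => ?_)
    simp only [inner_smul_right, real_inner_comm w]
    ring
  set η : E d → ℝ := fun s => ρ (s - x) with hη
  have hcη : HasCompactSupport η := hc.comp_homeomorph (Homeomorph.subRight x)
  have hsη : tsupport η ⊆ D := by
    intro s hs
    have : s - x ∈ tsupport ρ := by
      have := tsupport_comp_subset_preimage ρ (Homeomorph.subRight x).continuous hs
      simpa using this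
    simpa using hx _ this
  have hηs : ContDiff ℝ ∞ η := hρ.comp (contDiff_id.sub contDiff_const)
  have key := h.2.2 η hηs hcη hsη w
  have hz : ∀ s, s ∉ D → η s = 0 := fun s hs => by
    by_contra h0
    exact hs (hsη (subset_tsupport _ h0))
  have hz' : ∀ s, s ∉ D → fderiv ℝ η s = 0 := fun s hs => by
    by_contra h0
    exact hs (hsη (support_fderiv_subset ℝ h0))
  rw [setIntegral_eq_integral_of_forall_compl_eq_zero (fun s hs => by simp [hz' s hs]),
    setIntegral_eq_integral_of_forall_compl_eq_zero (fun s hs => by simp [hz s hs])] at key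
  rw [e1, e2, fderiv_mollify hρ hc hf, key, neg_neg,
    ← integral_add_left_eq_self (fun s => inner ℝ (g s) w * η s) x]
  simp [hη]

/-- The normalized bump is the density of a probability measure, so the error is an average of the
differences f(· + z) - f, each small by assumption. The bump need not be centred at 0. -/
lemma eLpNorm_mollify_sub_le {d : ℕ} {F : Type*} [NormedAddCommGroup F] [NormedSpace ℝ F]
    [CompleteSpace F] {c : E d} (b : ContDiffBump c) {f : E d → F} (hf : MemLp f 2 volume)
    {ε : ℝ≥0∞}
    (hε : ∀ z ∈ Metric.ball c b.rOut, eLpNorm (fun x => f (x + z) - f x) 2 volume ≤ ε) :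
    eLpNorm (fun x => mollify (b.normed volume) f x - f x) 2 volume ≤ ε := by
  -- Minkowski's inequality needs joint measurability of (x, z) ↦ f(x + z), so f is replaced by a
  -- strongly measurable representative, which has the same mollification.
  obtain ⟨f', hf'm, hff'⟩ := hf.1
  have hmoll : mollify (b.normed volume) f = mollify (b.normed volume) f' := by
    ext x
    refine integral_congr_ae ?_
    filter_upwards [(measurePreserving_add_left volume x).quasiMeasurePreserving.ae_eq_comp hff']
      with z hz
    simp only [Function.comp_apply] at hz
    rw [hz]
  have h1 : eLpNorm (fun x => mollify (b.normed volume) f x - f x) 2 volume =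
      eLpNorm (fun x => mollify (b.normed volume) f' x - f' x) 2 volume := by
    refine eLpNorm_congr_ae ?_
    filter_upwards [hff'] with x hx
    rw [hx, hmoll]
  have hε' : ∀ z ∈ Metric.ball c b.rOut,
      eLpNorm (fun x => f' (x + z) - f' x) 2 volume ≤ ε := fun z hz => by
    refine (eLpNorm_congr_ae ?_).trans_le (hε z hz)
    filter_upwards [hff',
      (measurePreserving_add_right volume z).quasiMeasurePreserving.ae_eq_comp hff'] with x hx hx'
    simp only [Function.comp_apply] at hx'
    rw [hx, hx']
  have hf' : MemLp f' 2 volume := hf.ae_eq hff'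
  rw [h1]
  set ρ := b.normed (volume : Measure (E d)) with hρ
  have hρc : Continuous ρ := (b.contDiff_normed (n := ⊤)).continuous
  have hρi : Integrable ρ := b.integrable_normed
  let ν : Measure (E d) := volume.withDensity fun z => ENNReal.ofReal (ρ z)
  have hm : Measurable fun z => ENNReal.ofReal (ρ z) := hρc.measurable.ennreal_ofReal
  have hν : IsProbabilityMeasure ν := ⟨by
    rw [withDensity_apply _ MeasurableSet.univ, Measure.restrict_univ,
      ← ofReal_integral_eq_lintegral_ofReal hρi (Eventually.of_forall fun z => b.nonneg_normed z),
      b.integral_normed, ENNReal.ofReal_one]⟩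
  have hint : ∀ h : E d → F, ∫ z, h z ∂ν = ∫ z, ρ z • h z := fun h => by
    rw [integral_withDensity_eq_integral_toReal_smul hm (by simp)]
    simp [ENNReal.toReal_ofReal, hρ, b.nonneg_normed]
  have hloc : LocallyIntegrable f' := hf'.locallyIntegrable (by norm_num)
  have h2 : ∀ x, mollify ρ f' x - f' x = ∫ z, f' (x + z) - f' x ∂ν := fun x => by
    have i1 : Integrable (fun z => ρ z • f' (x + z)) :=
      (locallyIntegrable_translate hloc x).integrable_smul_left_of_hasCompactSupport hρc
        b.hasCompactSupport_normed
    rw [hint]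
    simp only [smul_sub]
    rw [integral_sub i1 (hρi.smul_const _), integral_smul_const, b.integral_normed, one_smul]
    rfl
  simp only [h2]
  refine eLpNorm_integral_le_of_forall ν volume ?_ ?_
  · exact (hf'm.comp_measurable (measurable_fst.add measurable_snd)).sub
      (hf'm.comp_measurable measurable_fst)
  · rw [ae_withDensity_iff hm]
    refine Eventually.of_forall fun z hz => hε' z ?_
    rw [← b.support_normed_eq (μ := volume)]
    intro h0
    exact hz (by simp [hρ, h0])

/-- Approximation of a weakly differentiable function by smooth functions, on a set `A` from which
one stays in the domain `D` when moving by small vectors in the cone of directions `ball v r`. -/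
lemma exists_smooth_approx {d : ℕ} {D A : Set (E d)} {f : E d → ℝ} {g : E d → E d}
    (hf : MemLp f 2 volume) (hg : MemLp g 2 volume) (h : HasWeakGrad D f g)
    (hA : MeasurableSet A) {v : E d} {r : ℝ} (hr : 0 < r)
    (hD : ∀ᶠ δ : ℝ in 𝓝[>] 0, ∀ x ∈ A, ∀ z ∈ Metric.closedBall v r, x + δ • z ∈ D)
    {ε : ℝ≥0∞} (hε : 0 < ε) :
    ∃ w : E d → ℝ, ContDiff ℝ ∞ w ∧ eLpNorm (fun x => w x - f x) 2 volume ≤ ε ∧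
      eLpNorm (fun x => gradient w x - g x) 2 (volume.restrict A) ≤ ε := by
  have hsmall : ∀ᶠ δ : ℝ in 𝓝[>] 0, ∀ z ∈ Metric.closedBall (δ • v) (δ * r),
      eLpNorm (fun x => f (x + z) - f x) 2 volume ≤ ε ∧
      eLpNorm (fun x => g (x + z) - g x) 2 volume ≤ ε := by
    have hev : ∀ᶠ z in 𝓝 (0 : E d), eLpNorm (fun x => f (x + z) - f x) 2 volume ≤ ε ∧
        eLpNorm (fun x => g (x + z) - g x) 2 volume ≤ ε :=
      ((tendsto_eLpNorm_translate_sub hf).eventually_le_const hε).and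
        ((tendsto_eLpNorm_translate_sub hg).eventually_le_const hε)
    obtain ⟨s, hs, hball⟩ := Metric.eventually_nhds_iff_ball.1 hev
    have hlt : ∀ᶠ δ : ℝ in 𝓝[>] 0, δ * (‖v‖ + r) < s := by
      have : Tendsto (fun δ : ℝ => δ * (‖v‖ + r)) (𝓝[>] 0) (𝓝 (0 * (‖v‖ + r))) :=
        (tendsto_id.mono_left nhdsWithin_le_nhds).mul_const _
      rw [zero_mul] at this
      exact this.eventually_lt_const hs
    filter_upwards [hlt, self_mem_nhdsWithin] with δ hδ hpos z hz
    refine hball z ?_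
    rw [mem_ball_zero_iff]
    have hpos' : (0 : ℝ) < δ := hpos
    have h1 : ‖z - δ • v‖ ≤ δ * r := by simpa [dist_eq_norm] using hz
    have h2 : ‖δ • v‖ = δ * ‖v‖ := by rw [norm_smul, Real.norm_of_nonneg hpos'.le]
    have h3 := norm_add_le (z - δ • v) (δ • v)
    rw [sub_add_cancel] at h3
    linarith
  obtain ⟨δ, ⟨hδ1, hδ2⟩, hδ3⟩ := ((hsmall.and hD).and self_mem_nhdsWithin).exists
  have hδ : (0 : ℝ) < δ := hδ3
  -- The support of this bump is δ times the closed ball around v of radius r, so the averages only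
  -- look into the cone of admissible directions.
  let b : ContDiffBump (δ • v) := ⟨δ * r / 2, δ * r, by positivity, by
    have : 0 < δ * r := by positivity
    linarith⟩
  have hlf : LocallyIntegrable f := hf.locallyIntegrable (by norm_num)
  have hlg : LocallyIntegrable g := hg.locallyIntegrable (by norm_num)
  refine ⟨mollify (b.normed volume) f, contDiff_mollify b.contDiff_normed
    b.hasCompactSupport_normed hlf, eLpNorm_mollify_sub_le b hf fun z hz =>
      (hδ1 z (Metric.ball_subset_closedBall hz)).1, ?_⟩
  have hgrad : ∀ x ∈ A, gradient (mollify (b.normed volume) f) x =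
      mollify (b.normed volume) g x := fun x hx => by
    refine gradient_mollify b.contDiff_normed b.hasCompactSupport_normed hlf hlg h fun z hz => ?_
    rw [b.tsupport_normed_eq] at hz
    have hz' : δ⁻¹ • z ∈ Metric.closedBall v r := by
      rw [mem_closedBall_iff_norm] at hz ⊢
      have : δ⁻¹ • z - v = δ⁻¹ • (z - δ • v) := by
        rw [smul_sub, smul_smul, inv_mul_cancel₀ hδ.ne', one_smul]
      rw [this, norm_smul, norm_inv, Real.norm_of_nonneg hδ.le, inv_mul_le_iff₀ hδ]
      exact hz
    have := hδ2 x hx _ hz'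
    rwa [smul_smul, mul_inv_cancel₀ hδ.ne', one_smul] at this
  refine le_trans ?_ (eLpNorm_mollify_sub_le b hg fun z hz =>
    (hδ1 z (Metric.ball_subset_closedBall hz)).2)
  refine le_trans (eLpNorm_congr_ae ?_).le (eLpNorm_mono_measure _ Measure.restrict_le_self)
  filter_upwards [ae_restrict_mem hA] with x hx
  rw [hgrad x hx]

/-! ### Graph charts and the surface measure -/

lemma euclideanHausdorffMeasure_image_le {X Y : Type*} [EMetricSpace X] [EMetricSpace Y]
    [MeasurableSpace X] [BorelSpace X] [MeasurableSpace Y] [BorelSpace Y] {K : ℝ≥0} {f : X → Y}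
    (hf : LipschitzWith K f) (n : ℕ) (s : Set X) : μHE[n] (f '' s) ≤ (K : ℝ≥0∞) ^ n * μHE[n] s := by
  have := hf.hausdorffMeasure_image_le (d := (n : ℝ)) (by positivity) s
  rw [ENNReal.rpow_natCast] at this
  rw [Measure.euclideanHausdorffMeasure_def, Measure.euclideanHausdorffMeasure_def,
    Measure.smul_apply, Measure.smul_apply]
  simp only [ENNReal.smul_def, smul_eq_mul]
  rw [mul_left_comm]
  gcongr

section Charts

variable {n : ℕ} {Ω U : Set (E (n + 1))} {e : E (n + 1) ≃ₗᵢ[ℝ] WithLp 2 (E n × ℝ)} {γ : E n → ℝ}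

lemma lipschitzWith_graphMap (e : E (n + 1) ≃ₗᵢ[ℝ] WithLp 2 (E n × ℝ)) {K : ℝ≥0}
    (hK : LipschitzWith K γ) : LipschitzWith (1 + K) (graphMap e γ) := by
  refine LipschitzWith.of_dist_le_mul fun y y' => ?_
  have h1 : dist (graphMap e γ y) (graphMap e γ y') =
      dist (WithLp.toLp 2 (y, γ y)) (WithLp.toLp 2 (y', γ y')) := e.symm.dist_map _ _
  rw [h1, WithLp.prod_dist_eq_of_L2]
  have h2 := hK.dist_le_mul y y'
  have h3 : (0 : ℝ) ≤ dist y y' := dist_nonneg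
  have h4 : (0 : ℝ) ≤ dist (γ y) (γ y') := dist_nonneg
  refine Real.sqrt_le_iff.2 ⟨by positivity, ?_⟩
  have h5 : dist y y' + dist (γ y) (γ y') ≤ ((1 + K : ℝ≥0) : ℝ) * dist y y' := by
    push_cast
    linarith
  refine le_trans ?_ (pow_le_pow_left₀ (by positivity) h5 2)
  simp only [WithLp.toLp_fst, WithLp.toLp_snd]
  nlinarith

lemma lipschitzWith_fst (e : E (n + 1) ≃ₗᵢ[ℝ] WithLp 2 (E n × ℝ)) :
    LipschitzWith 1 fun z => (e z).fst := by
  refine LipschitzWith.of_dist_le_mul fun z z' => ?_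
  simp only [NNReal.coe_one, one_mul]
  rw [← e.dist_map z z', WithLp.prod_dist_eq_of_L2]
  exact Real.le_sqrt_of_sq_le (le_add_of_nonneg_right (by positivity))

lemma lipschitzWith_snd (e : E (n + 1) ≃ₗᵢ[ℝ] WithLp 2 (E n × ℝ)) :
    LipschitzWith 1 fun z => (e z).snd := by
  refine LipschitzWith.of_dist_le_mul fun z z' => ?_
  simp only [NNReal.coe_one, one_mul]
  rw [← e.dist_map z z', WithLp.prod_dist_eq_of_L2]
  exact Real.le_sqrt_of_sq_le (le_add_of_nonneg_left (by positivity))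

@[simp] lemma fst_graphMap (y : E n) : (e (graphMap e γ y)).fst = y := by simp [graphMap]

/-- A point strictly above the graph is interior to Ω and a point strictly below it is interior to
the complement, so boundary points lie on the graph. -/
lemma IsGraphChart.snd_eq (h : IsGraphChart Ω U e γ) {z : E (n + 1)} (hzU : z ∈ U)
    (hz : z ∈ frontier Ω) : (e z).snd = γ (e z).fst := by
  obtain ⟨hU, ⟨K, hK⟩, hiff⟩ := h
  have hcf : Continuous fun z => (e z).fst := (lipschitzWith_fst e).continuous
  have hcs : Continuous fun z => (e z).snd := (lipschitzWith_snd e).continuous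
  refine le_antisymm (not_lt.1 fun hlt => ?_) (not_lt.1 fun hlt => ?_)
  · refine hz.2 (mem_interior_iff_mem_nhds.2 ?_)
    filter_upwards [hU.mem_nhds hzU, (isOpen_lt (hK.continuous.comp hcf) hcs).mem_nhds
      hlt] with z' h1 h2
    exact (hiff _ h1).2 h2
  · have hne : ∀ᶠ z' in 𝓝 z, z' ∉ Ω := by
      filter_upwards [hU.mem_nhds hzU, (isOpen_lt hcs (hK.continuous.comp hcf)).mem_nhds
        hlt] with z' h1 h2
      rw [hiff _ h1]
      exact not_lt.2 (le_of_lt h2)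
    exact mem_closure_iff_frequently.1 hz.1 hne

lemma IsGraphChart.graphMap_fst (h : IsGraphChart Ω U e γ) {z : E (n + 1)} (hzU : z ∈ U)
    (hz : z ∈ frontier Ω) : graphMap e γ (e z).fst = z := by
  rw [graphMap, ← h.snd_eq hzU hz]
  exact e.symm_apply_apply z

lemma IsGraphChart.continuous_graphMap (h : IsGraphChart Ω U e γ) : Continuous (graphMap e γ) :=
  (lipschitzWith_graphMap e h.2.1.choose_spec).continuous

lemma IsGraphChart.isOpen_graphDom (h : IsGraphChart Ω U e γ) : IsOpen (graphDom U e γ) :=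
  h.1.preimage h.continuous_graphMap

/-- The projection to the parameter domain does not increase the surface measure. -/
lemma IsGraphChart.map_graphMap_le (h : IsGraphChart Ω U e γ) :
    Measure.map (graphMap e γ) (volume.restrict (graphDom U e γ)) ≤ surfMeasure Ω := by
  refine Measure.le_iff.2 fun A hA => ?_
  rw [Measure.map_apply h.continuous_graphMap.measurable hA,
    Measure.restrict_apply (h.continuous_graphMap.measurable hA), Measure.restrict_apply hA,
    ← EuclideanSpace.euclideanHausdorffMeasure_eq_volume]
  have h1 := euclideanHausdorffMeasure_image_le (lipschitzWith_fst e) n (A ∩ frontier Ω)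
  simp only [ENNReal.coe_one, one_pow, one_mul] at h1
  refine (measure_mono ?_).trans h1
  rintro y ⟨hy1, hy2⟩
  -- Each parameter is the image of its graph point under the 1-Lipschitz projection, so the bound
  -- for Hausdorff measure of Lipschitz images applies with constant 1.
  exact ⟨graphMap e γ y, ⟨hy1, graphMap_mem_frontier h hy2⟩, by simp⟩

/-- The surface measure is controlled by Lebesgue measure in the parameter domain. -/
lemma IsGraphChart.surfMeasure_restrict_le (h : IsGraphChart Ω U e γ) {K : ℝ≥0}
    (hK : LipschitzWith K γ) {B : Set (E n)} {N : Set (E (n + 1))}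
    (hNU : N ⊆ U) (hNB : ∀ z ∈ N, z ∈ frontier Ω → (e z).fst ∈ B) :
    (surfMeasure Ω).restrict N ≤
      ((1 + K : ℝ≥0) : ℝ≥0∞) ^ n • Measure.map (graphMap e γ) (volume.restrict B) := by
  refine Measure.le_iff.2 fun A hA => ?_
  have hm := h.continuous_graphMap.measurable hA
  rw [Measure.restrict_apply hA, Measure.restrict_apply' isClosed_frontier.measurableSet,
    Measure.smul_apply, Measure.map_apply h.continuous_graphMap.measurable hA,
    Measure.restrict_apply hm, smul_eq_mul,
    ← EuclideanSpace.euclideanHausdorffMeasure_eq_volume]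
  refine (measure_mono ?_).trans
    (euclideanHausdorffMeasure_image_le (lipschitzWith_graphMap e hK) n _)
  rintro z ⟨⟨hzA, hzN⟩, hzf⟩
  have := h.graphMap_fst (hNU hzN) hzf
  exact ⟨(e z).fst, ⟨by simpa [this] using hzA, hNB z hzN hzf⟩, this⟩

lemma IsGraphChart.quasiMeasurePreserving (h : IsGraphChart Ω U e γ) :
    Measure.QuasiMeasurePreserving (graphMap e γ) (volume.restrict (graphDom U e γ))
      (surfMeasure Ω) :=
  ⟨h.continuous_graphMap.measurable, h.map_graphMap_le.absolutelyContinuous⟩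

lemma IsGraphChart.eLpNorm_comp_le (h : IsGraphChart Ω U e γ) {F : Type*} [NormedAddCommGroup F]
    {f : E (n + 1) → F} (hf : AEStronglyMeasurable f (surfMeasure Ω)) :
    eLpNorm (fun y => f (graphMap e γ y)) 2 (volume.restrict (graphDom U e γ)) ≤
      eLpNorm f 2 (surfMeasure Ω) := by
  refine le_trans (le_of_eq ?_) (eLpNorm_mono_measure f h.map_graphMap_le)
  rw [eLpNorm_map_measure (hf.mono_ac h.map_graphMap_le.absolutelyContinuous)
    h.continuous_graphMap.aemeasurable]
  rfl

lemma norm_adjoint_fderiv_graphMap_le (e : E (n + 1) ≃ₗᵢ[ℝ] WithLp 2 (E n × ℝ)) {K : ℝ≥0}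
    (hK : LipschitzWith K γ) (y : E n) (x : E (n + 1)) :
    ‖(fderiv ℝ (graphMap e γ) y).adjoint x‖ ≤ (1 + K : ℝ≥0) * ‖x‖ := by
  refine (ContinuousLinearMap.le_opNorm _ _).trans ?_
  rw [LinearIsometryEquiv.norm_map]
  gcongr
  exact norm_fderiv_le_of_lipschitz ℝ (lipschitzWith_graphMap e hK)

lemma IsGraphChart.aestronglyMeasurable_pullback (h : IsGraphChart Ω U e γ)
    {G : E (n + 1) → E (n + 1)} (hG : AEStronglyMeasurable G (surfMeasure Ω)) :
    AEStronglyMeasurable (fun y => (fderiv ℝ (graphMap e γ) y).adjoint (G (graphMap e γ y)))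
      (volume.restrict (graphDom U e γ)) := by
  have h1 : AEStronglyMeasurable (fun y => G (graphMap e γ y))
      (volume.restrict (graphDom U e γ)) :=
    hG.comp_quasiMeasurePreserving h.quasiMeasurePreserving
  have h2 : StronglyMeasurable fun y => (fderiv ℝ (graphMap e γ) y).adjoint := by
    have := (measurable_fderiv ℝ (graphMap e γ)).stronglyMeasurable
    exact (LinearIsometryEquiv.continuous _).comp_stronglyMeasurable this
  exact isBoundedBilinearMap_apply.continuous.comp_aestronglyMeasurable
    (h2.aestronglyMeasurable.prodMk h1)

lemma IsGraphChart.memLp_pullback (h : IsGraphChart Ω U e γ)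
    {G : E (n + 1) → E (n + 1)} (hG : MemLp G 2 (surfMeasure Ω)) :
    MemLp (fun y => (fderiv ℝ (graphMap e γ) y).adjoint (G (graphMap e γ y))) 2
      (volume.restrict (graphDom U e γ)) := by
  obtain ⟨K, hK⟩ := h.2.1
  refine MemLp.of_le_mul (c := ((1 + K : ℝ≥0) : ℝ)) (g := fun y => G (graphMap e γ y)) ?_
    (h.aestronglyMeasurable_pullback hG.1)
    (Eventually.of_forall fun y => norm_adjoint_fderiv_graphMap_le e hK y _)
  exact ⟨hG.1.comp_quasiMeasurePreserving h.quasiMeasurePreserving,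
    (h.eLpNorm_comp_le hG.1).trans_lt hG.2⟩

lemma IsGraphChart.eLpNorm_pullback_le (h : IsGraphChart Ω U e γ) {K : ℝ≥0}
    (hK : LipschitzWith K γ) {G : E (n + 1) → E (n + 1)}
    (hG : AEStronglyMeasurable G (surfMeasure Ω)) :
    eLpNorm (fun y => (fderiv ℝ (graphMap e γ) y).adjoint (G (graphMap e γ y))) 2
      (volume.restrict (graphDom U e γ)) ≤ (1 + K : ℝ≥0) * eLpNorm G 2 (surfMeasure Ω) := by
  refine (eLpNorm_le_nnreal_smul_eLpNorm_of_ae_le_mul (c := 1 + K)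
    (g := fun y => G (graphMap e γ y)) (Eventually.of_forall fun y => ?_) 2).trans ?_
  · exact norm_adjoint_fderiv_graphMap_le e hK y _
  · rw [ENNReal.smul_def, smul_eq_mul]
    gcongr
    exact h.eLpNorm_comp_le hG

end Charts

/-! ### Weak gradients: limits, uniqueness, smooth functions -/

/-- By Hölder, L² convergence of one factor gives L¹ convergence of the product. -/
lemma tendsto_integral_mul_of_tendsto_eLpNorm {α : Type*} [MeasurableSpace α] {μ : Measure α}
    {f : ℕ → α → ℝ} {f₀ θ : α → ℝ} (hf : ∀ k, MemLp (f k) 2 μ) (hf₀ : MemLp f₀ 2 μ)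
    (hθ : MemLp θ 2 μ) (h : Tendsto (fun k => eLpNorm (fun x => f k x - f₀ x) 2 μ) atTop (𝓝 0)) :
    Tendsto (fun k => ∫ x, f k x * θ x ∂μ) atTop (𝓝 (∫ x, f₀ x * θ x ∂μ)) := by
  refine tendsto_integral_of_L1 _ (hf₀.1.mul hθ.1)
    (Eventually.of_forall fun k => (hf k).integrable_mul hθ) ?_
  have hlim : Tendsto (fun k => eLpNorm (fun x => f k x - f₀ x) 2 μ * eLpNorm θ 2 μ) atTop
      (𝓝 0) := by
    have := ENNReal.Tendsto.mul_const h (Or.inr hθ.2.ne)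
    rwa [zero_mul] at this
  refine tendsto_of_tendsto_of_tendsto_of_le_of_le tendsto_const_nhds hlim
    (fun _ => zero_le) fun k => ?_
  have := eLpNorm_smul_le_mul_eLpNorm (p := 2) (q := 2) (r := 1) hθ.1 ((hf k).sub hf₀).1
  rw [eLpNorm_one_eq_lintegral_enorm] at this
  refine le_trans (le_of_eq ?_) this
  simp only [Pi.smul_apply', Pi.sub_apply, Pi.mul_apply, smul_eq_mul, sub_mul]

lemma memLp_two_of_continuous_of_hasCompactSupport {d : ℕ} {F : Type*} [NormedAddCommGroup F]
    {θ : E d → F} (hθ : Continuous θ) (hc : HasCompactSupport θ) (D : Set (E d)) :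
    MemLp θ 2 (volume.restrict D) :=
  (hθ.memLp_of_hasCompactSupport hc).restrict D

/-- For a fixed test function, both sides of the defining identity are L² continuous in f and g.
This closedness makes the H¹ spaces complete. -/
lemma HasWeakGrad.of_tendsto {d : ℕ} {D : Set (E d)} {f : ℕ → E d → ℝ} {g : ℕ → E d → E d}
    {f₀ : E d → ℝ} {g₀ : E d → E d} (h : ∀ k, HasWeakGrad D (f k) (g k))
    (hf : ∀ k, MemLp (f k) 2 (volume.restrict D)) (hg : ∀ k, MemLp (g k) 2 (volume.restrict D))
    (hf₀ : MemLp f₀ 2 (volume.restrict D)) (hg₀ : MemLp g₀ 2 (volume.restrict D))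
    (hlf : Tendsto (fun k => eLpNorm (fun x => f k x - f₀ x) 2 (volume.restrict D)) atTop (𝓝 0))
    (hlg : Tendsto (fun k => eLpNorm (fun x => g k x - g₀ x) 2 (volume.restrict D)) atTop (𝓝 0)) :
    HasWeakGrad D f₀ g₀ := by
  refine ⟨locallyIntegrableOn_of_locallyIntegrable_restrict (hf₀.locallyIntegrable (by norm_num)),
    locallyIntegrableOn_of_locallyIntegrable_restrict (hg₀.locallyIntegrable (by norm_num)),
    fun η hη hc hs w => ?_⟩
  have hθ : MemLp (fun x => fderiv ℝ η x w) 2 (volume.restrict D) :=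
    memLp_two_of_continuous_of_hasCompactSupport
      ((hη.continuous_fderiv (by simp)).clm_apply continuous_const) (hc.fderiv_apply ℝ w) D
  have hη' : MemLp η 2 (volume.restrict D) :=
    memLp_two_of_continuous_of_hasCompactSupport hη.continuous hc D
  have h1 := tendsto_integral_mul_of_tendsto_eLpNorm hf hf₀ hθ hlf
  have h2 := tendsto_integral_mul_of_tendsto_eLpNorm (f := fun k x => inner ℝ (g k x) w)
    (fun k => (hg k).inner_const w) (hg₀.inner_const w) hη' (by
      have hlim := ENNReal.Tendsto.const_mul (a := (‖w‖₊ : ℝ≥0∞)) hlg (Or.inr ENNReal.coe_ne_top)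
      rw [mul_zero] at hlim
      refine tendsto_of_tendsto_of_tendsto_of_le_of_le tendsto_const_nhds hlim
        (fun _ => zero_le) fun k => ?_
      have := eLpNorm_le_nnreal_smul_eLpNorm_of_ae_le_mul (c := ‖w‖₊) (p := 2)
        (μ := volume.restrict D) (f := fun x => inner ℝ (g k x) w - inner ℝ (g₀ x) w)
        (g := fun x => g k x - g₀ x) (Eventually.of_forall fun x => by
          rw [← inner_sub_left, mul_comm]
          exact norm_inner_le_norm _ _)
      rwa [ENNReal.smul_def, smul_eq_mul] at this)
  refine tendsto_nhds_unique h1 ?_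
  refine (h2.neg).congr fun k => ?_
  rw [(h k).2.2 η hη hc hs w]

/-- The fundamental lemma of the calculus of variations, applied to the difference of the two
gradients. It later identifies the gradient component of an element of `smoothTraceGraph` with the
classical gradient. -/
lemma HasWeakGrad.unique {d : ℕ} {D : Set (E d)} (hD : IsOpen D) {f : E d → ℝ}
    {g g' : E d → E d} (h : HasWeakGrad D f g) (h' : HasWeakGrad D f g') :
    g =ᵐ[volume.restrict D] g' := by
  have hsub : LocallyIntegrableOn (fun x => g x - g' x) D := h.2.1.sub h'.2.1
  have key := hD.ae_eq_zero_of_integral_contDiff_smul_eq_zero hsub (fun η hη hc hs => by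
    refine ext_inner_right ℝ fun w => ?_
    have hz : ∀ x, x ∉ D → η x = 0 := fun x hx => by
      by_contra h0
      exact hx (hs (subset_tsupport _ h0))
    have hint : ∀ {k : E d → E d}, LocallyIntegrableOn k D → Integrable fun x => η x • k x := by
      intro k hk
      refine (integrableOn_iff_integrable_of_support_subset (s := tsupport η) ?_).1
        ((hk.integrableOn_compact_subset hs hc).continuousOn_smul hη.continuous.continuousOn hc)
      intro x hx
      apply subset_tsupport
      intro h0
      exact hx (by simp [h0])
    have e1 : ∀ {k : E d → E d}, LocallyIntegrableOn k D → inner ℝ (∫ x, η x • k x) w =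
        ∫ x in D, inner ℝ (k x) w * η x := by
      intro k hk
      rw [real_inner_comm, ← integral_inner (hint hk),
        setIntegral_eq_integral_of_forall_compl_eq_zero (fun x hx => by simp [hz x hx])]
      refine integral_congr_ae (Eventually.of_forall fun x => ?_)
      simp only [inner_smul_right, real_inner_comm w]
      ring
    have e2 := h.2.2 η hη hc hs w
    rw [h'.2.2 η hη hc hs w, neg_inj] at e2
    simp only [smul_sub]
    rw [integral_sub (hint h.2.1) (hint h'.2.1), inner_sub_left, e1 h.2.1, e1 h'.2.1, e2,
      sub_self, inner_zero_left])
  rw [EventuallyEq, ae_restrict_iff' hD.measurableSet]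
  filter_upwards [key] with x hx hxD
  exact sub_eq_zero.1 (hx hxD)

lemma continuous_gradient {d : ℕ} {φ : E d → ℝ} (hφ : ContDiff ℝ ∞ φ) :
    Continuous (gradient φ) :=
  (LinearIsometryEquiv.continuous _).comp (hφ.continuous_fderiv (by simp))

lemma inner_gradient {d : ℕ} (φ : E d → ℝ) (x w : E d) :
    inner ℝ (gradient φ x) w = fderiv ℝ φ x w := by
  rw [gradient, InnerProductSpace.toDual_symm_apply]

lemma norm_gradient {d : ℕ} (φ : E d → ℝ) (x : E d) : ‖gradient φ x‖ = ‖fderiv ℝ φ x‖ := by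
  rw [gradient, LinearIsometryEquiv.norm_map]

lemma hasWeakGrad_of_contDiff {d : ℕ} (D : Set (E d)) {φ : E d → ℝ} (hφ : ContDiff ℝ ∞ φ) :
    HasWeakGrad D φ (gradient φ) := by
  refine ⟨hφ.continuous.locallyIntegrable.locallyIntegrableOn D,
    (continuous_gradient hφ).locallyIntegrable.locallyIntegrableOn D, fun η hη hc hs w => ?_⟩
  have hd : HasCompactSupport (fun x => fderiv ℝ η x w) := hc.fderiv_apply ℝ w
  have hcont : Continuous (fun x => fderiv ℝ η x w) :=
    (hη.continuous_fderiv (by simp)).clm_apply continuous_const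
  have hcont' : Continuous (fun x => fderiv ℝ φ x w) :=
    (hφ.continuous_fderiv (by simp)).clm_apply continuous_const
  have key := integral_mul_fderiv_eq_neg_fderiv_mul_of_integrable (μ := (volume : Measure (E d)))
    (f := φ) (g := η) (v := w)
    ((hcont'.mul hη.continuous).integrable_of_hasCompactSupport hc.mul_left)
    ((hφ.continuous.mul hcont).integrable_of_hasCompactSupport hd.mul_left)
    ((hφ.continuous.mul hη.continuous).integrable_of_hasCompactSupport hc.mul_left)
    (fun x _ => (hφ.differentiable (by simp)).differentiableAt)
    (fun x _ => (hη.differentiable (by simp)).differentiableAt)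
  have hz : ∀ x, x ∉ D → η x = 0 := fun x hx => by
    by_contra h0
    exact hx (hs (subset_tsupport _ h0))
  have hz' : ∀ x, x ∉ D → fderiv ℝ η x = 0 := fun x hx => by
    by_contra h0
    exact hx (hs (support_fderiv_subset ℝ h0))
  simp only [inner_gradient]
  rw [setIntegral_eq_integral_of_forall_compl_eq_zero (fun x hx => by simp [hz' x hx]),
    setIntegral_eq_integral_of_forall_compl_eq_zero (fun x hx => by simp [hz x hx]), key]

lemma memLp_of_continuous_of_isBounded {d : ℕ} {F : Type*} [NormedAddCommGroup F]
    {D : Set (E d)} (hD : Bornology.IsBounded D) {f : E d → F} (hf : Continuous f) :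
    MemLp f 2 (volume.restrict D) := by
  obtain ⟨C, hC⟩ := (hD.isCompact_closure.image hf.norm).bddAbove
  have : IsFiniteMeasure (volume.restrict (closure D)) :=
    ⟨by rw [Measure.restrict_apply_univ]; exact hD.isCompact_closure.measure_lt_top⟩
  have h1 : MemLp f 2 (volume.restrict (closure D)) :=
    MemLp.of_bound hf.aestronglyMeasurable C
      ((ae_restrict_iff' isClosed_closure.measurableSet).2
        (Eventually.of_forall fun x hx => hC ⟨x, hx, rfl⟩))
  exact h1.mono_measure (Measure.restrict_mono subset_closure le_rfl)

/-! ### Completeness of `H¹(Ω)` and `H¹(Γ)` -/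

lemma isClosed_bulkH1 {d : ℕ} (Ω : Set (E d)) :
    IsClosed (bulkH1 Ω : Set (WithLp 2 (Lp ℝ 2 (bulkMeasure Ω) × Lp (E d) 2 (bulkMeasure Ω)))) := by
  refine IsSeqClosed.isClosed fun p p₀ hp hlim => ?_
  have h1 := ((WithLp.continuous_fst 2 _ _).tendsto p₀).comp hlim
  have h2 := ((WithLp.continuous_snd 2 _ _).tendsto p₀).comp hlim
  rw [Lp.tendsto_Lp_iff_tendsto_eLpNorm'] at h1 h2
  exact HasWeakGrad.of_tendsto (f := fun k => (p k).fst) (g := fun k => (p k).snd) hp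
    (fun k => Lp.memLp _) (fun k => Lp.memLp _) (Lp.memLp _) (Lp.memLp _) h1 h2

/-- Pulling back to a chart is bounded in L², so the weak gradient identity passes to the limit.
Tangency passes along an a.e. convergent subsequence, because the tangent space is
finite-dimensional and hence closed. -/
lemma HasSurfGrad.of_tendsto {n : ℕ} {Ω : Set (E (n + 1))} {v : ℕ → E (n + 1) → ℝ}
    {G : ℕ → E (n + 1) → E (n + 1)} {v₀ : E (n + 1) → ℝ} {G₀ : E (n + 1) → E (n + 1)}
    (h : ∀ k, HasSurfGrad Ω (v k) (G k)) (hv : ∀ k, MemLp (v k) 2 (surfMeasure Ω))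
    (hG : ∀ k, MemLp (G k) 2 (surfMeasure Ω)) (hv₀ : MemLp v₀ 2 (surfMeasure Ω))
    (hG₀ : MemLp G₀ 2 (surfMeasure Ω))
    (h1 : Tendsto (fun k => eLpNorm (v k - v₀) 2 (surfMeasure Ω)) atTop (𝓝 0))
    (h2 : Tendsto (fun k => eLpNorm (G k - G₀) 2 (surfMeasure Ω)) atTop (𝓝 0)) :
    HasSurfGrad Ω v₀ G₀ := by
  intro U e γ hc
  obtain ⟨K, hK⟩ := hc.2.1
  have hmem : ∀ f : E (n + 1) → ℝ, MemLp f 2 (surfMeasure Ω) →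
      MemLp (fun y => f (graphMap e γ y)) 2 (volume.restrict (graphDom U e γ)) := fun f hf =>
    ⟨hf.1.comp_quasiMeasurePreserving hc.quasiMeasurePreserving,
      (hc.eLpNorm_comp_le hf.1).trans_lt hf.2⟩
  constructor
  · refine HasWeakGrad.of_tendsto (fun k => (h k U e γ hc).1) (fun k => hmem _ (hv k))
      (fun k => hc.memLp_pullback (hG k)) (hmem _ hv₀) (hc.memLp_pullback hG₀) ?_ ?_
    · exact tendsto_of_tendsto_of_tendsto_of_le_of_le tendsto_const_nhds h1 (fun _ => zero_le)
        fun k => hc.eLpNorm_comp_le (f := v k - v₀) ((hv k).1.sub hv₀.1)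
    · have hlim' := ENNReal.Tendsto.const_mul (a := ((1 + K : ℝ≥0) : ℝ≥0∞)) h2
        (Or.inr ENNReal.coe_ne_top)
      rw [mul_zero] at hlim'
      refine tendsto_of_tendsto_of_tendsto_of_le_of_le tendsto_const_nhds hlim'
        (fun _ => zero_le) fun k => ?_
      simp only [← map_sub]
      exact hc.eLpNorm_pullback_le hK (G := G k - G₀) ((hG k).1.sub hG₀.1)
  · obtain ⟨ns, -, hns⟩ := (tendstoInMeasure_of_tendsto_eLpNorm two_ne_zero
      (fun k => (hG k).1) hG₀.1 h2).exists_seq_tendsto_ae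
    filter_upwards [ae_graphDom_of_ae_surf hc hns, ae_all_iff.2 fun k => (h k U e γ hc).2]
      with y hy hy'
    exact (Submodule.closed_of_finiteDimensional _).mem_of_tendsto hy
      (Eventually.of_forall fun k => hy' (ns k))

lemma isClosed_surfH1 {n : ℕ} (Ω : Set (E (n + 1))) :
    IsClosed (surfH1 Ω : Set (WithLp 2 (Lp ℝ 2 (surfMeasure Ω) ×
      Lp (E (n + 1)) 2 (surfMeasure Ω)))) := by
  refine IsSeqClosed.isClosed fun p p₀ hp hlim => ?_
  have h1 := ((WithLp.continuous_fst 2 _ _).tendsto p₀).comp hlim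
  have h2 := ((WithLp.continuous_snd 2 _ _).tendsto p₀).comp hlim
  rw [Lp.tendsto_Lp_iff_tendsto_eLpNorm'] at h1 h2
  exact HasSurfGrad.of_tendsto (v := fun k => (p k).fst) (G := fun k => (p k).snd) hp
    (fun k => Lp.memLp _) (fun k => Lp.memLp _) (Lp.memLp _) (Lp.memLp _) h1 h2

instance {d : ℕ} (Ω : Set (E d)) : CompleteSpace (bulkH1 Ω) :=
  (isClosed_bulkH1 Ω).completeSpace_coe

instance {n : ℕ} (Ω : Set (E (n + 1))) : CompleteSpace (surfH1 Ω) :=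
  (isClosed_surfH1 Ω).completeSpace_coe

/-- For L = 0 the constraint is the preimage under a continuous map of the trace graph, which is
closed by definition; no trace inequality is needed. -/
lemma isClosed_H1L {n : ℕ} (Ω : Set (E (n + 1))) (L : ℝ≥0∞) (β : ℝ) :
    IsClosed (H1L Ω L β : Set (H1 Ω)) := by
  unfold H1L
  split_ifs
  · refine (Submodule.isClosed_topologicalClosure (smoothTraceGraph Ω)).preimage
      (f := coupling Ω β) ?_
    have h1 : Continuous fun p : H1 Ω => (p.fst, β • (p.snd : WithLp 2 (Lp ℝ 2 (surfMeasure Ω) ×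
        Lp (E (n + 1)) 2 (surfMeasure Ω))).fst) :=
      (WithLp.continuous_fst 2 _ _).prodMk (((WithLp.continuous_fst 2 _ _).comp
        (continuous_subtype_val.comp (WithLp.continuous_snd 2 _ _))).const_smul β)
    exact h1
  · exact isClosed_univ

instance {n : ℕ} (Ω : Set (E (n + 1))) (L : ℝ≥0∞) (β : ℝ) : CompleteSpace (H1L Ω L β) :=
  (isClosed_H1L Ω L β).completeSpace_coe

/-! ### Density of the smooth functions in `H¹(Ω)` -/

/-- The interior cone property. At interior points every short move is allowed; at boundary points
the axis is the vertical direction of the chart, and the aperture is dictated by the Lipschitz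
constant. -/
lemma IsLipschitzDomain.exists_cone {n : ℕ} {Ω : Set (E (n + 1))} (hΩ : IsLipschitzDomain Ω)
    {x : E (n + 1)} (hx : x ∈ closure Ω) :
    ∃ V : Set (E (n + 1)), IsOpen V ∧ x ∈ V ∧ ∃ (v : E (n + 1)) (r : ℝ), 0 < r ∧
      ∀ᶠ δ : ℝ in 𝓝[>] 0, ∀ y ∈ V ∩ Ω, ∀ z ∈ Metric.closedBall v r, y + δ • z ∈ Ω := by
  have hmove : ∀ {O : Set (E (n + 1))}, IsOpen O → x ∈ O → ∀ (v : E (n + 1)) (r : ℝ), 0 < r →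
      ∃ V : Set (E (n + 1)), IsOpen V ∧ x ∈ V ∧ V ⊆ O ∧
        ∀ᶠ δ : ℝ in 𝓝[>] 0, ∀ y ∈ V, ∀ z ∈ Metric.closedBall v r, y + δ • z ∈ O := by
    intro O hO hxO v r hr
    obtain ⟨ρ, hρ, hball⟩ := Metric.isOpen_iff.1 hO x hxO
    refine ⟨Metric.ball x (ρ / 2), Metric.isOpen_ball, Metric.mem_ball_self (by positivity),
      (Metric.ball_subset_ball (by linarith)).trans hball, ?_⟩
    have hlt : ∀ᶠ δ : ℝ in 𝓝[>] 0, δ * (‖v‖ + r) < ρ / 2 := by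
      have : Tendsto (fun δ : ℝ => δ * (‖v‖ + r)) (𝓝[>] 0) (𝓝 (0 * (‖v‖ + r))) :=
        (tendsto_id.mono_left nhdsWithin_le_nhds).mul_const _
      rw [zero_mul] at this
      exact this.eventually_lt_const (by positivity)
    filter_upwards [hlt, self_mem_nhdsWithin] with δ hδ hpos y hy z hz
    have hpos' : (0 : ℝ) < δ := hpos
    apply hball
    rw [mem_ball_iff_norm] at hy ⊢
    rw [mem_closedBall_iff_norm] at hz
    have h1 : ‖z‖ ≤ ‖v‖ + r := by
      have := norm_add_le (z - v) v
      rw [sub_add_cancel] at this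
      linarith
    have h2 : ‖y + δ • z - x‖ ≤ ‖y - x‖ + δ * ‖z‖ := by
      have := norm_add_le (y - x) (δ • z)
      rw [norm_smul, Real.norm_of_nonneg hpos'.le] at this
      rwa [add_sub_right_comm]
    nlinarith [mul_le_mul_of_nonneg_left h1 hpos'.le]
  by_cases hxΩ : x ∈ Ω
  · obtain ⟨V, hV, hxV, -, h⟩ := hmove hΩ.isOpen hxΩ 0 1 one_pos
    exact ⟨V, hV, hxV, 0, 1, one_pos, h.mono fun δ hδ y hy => hδ y hy.1⟩
  · obtain ⟨U, e, γ, hxU, hU, ⟨K, hK⟩, hiff⟩ :=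
      hΩ.exists_chart x ⟨hx, fun h => hxΩ (interior_subset h)⟩
    -- With r = 1/(K + 1) one has K r = 1 - r: the graph rises by at most δKr while the point rises
    -- by at least δ(1 - r). Strictness is inherited from y being above the graph.
    have hr : (0 : ℝ) < 1 / (K + 1) := by positivity
    set v : E (n + 1) := e.symm (WithLp.toLp 2 (0, 1)) with hv
    obtain ⟨V, hV, hxV, hVU, h⟩ := hmove hU hxU v _ hr
    refine ⟨V, hV, hxV, v, _, hr, ?_⟩
    filter_upwards [h, self_mem_nhdsWithin] with δ hδ hpos y hy z hz
    have hpos' : (0 : ℝ) < δ := hpos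
    rw [hiff _ (hδ y hy.1 z hz)]
    have hyΩ := (hiff _ (hVU hy.1)).1 hy.2
    rw [Metric.mem_closedBall] at hz
    have h1 : ‖(e z).fst‖ ≤ 1 / (K + 1) := by
      have := (lipschitzWith_fst e).dist_le_mul z v
      simp only [hv, LinearIsometryEquiv.apply_symm_apply, WithLp.toLp_fst, NNReal.coe_one,
        one_mul, dist_zero_right] at this
      exact this.trans hz
    have h2 : 1 - 1 / (K + 1) ≤ (e z).snd := by
      have := (lipschitzWith_snd e).dist_le_mul z v
      simp only [hv, LinearIsometryEquiv.apply_symm_apply, NNReal.coe_one, one_mul,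
        Real.dist_eq] at this
      have h0 := (abs_le.1 (this.trans hz)).1
      have e0 : (WithLp.toLp 2 ((0 : E n), (1 : ℝ))).snd = 1 := rfl
      rw [e0] at h0
      linarith
    have h3 : (e (y + δ • z)).fst = (e y).fst + δ • (e z).fst := by simp
    have h4 : (e (y + δ • z)).snd = (e y).snd + δ * (e z).snd := by simp
    have h5 : γ (e (y + δ • z)).fst ≤ γ (e y).fst + K * (δ * ‖(e z).fst‖) := by
      have := hK.dist_le_mul (e (y + δ • z)).fst (e y).fst
      rw [h3, dist_eq_norm, dist_eq_norm, add_sub_cancel_left, norm_smul,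
        Real.norm_of_nonneg hpos'.le] at this
      have := (le_abs_self _).trans this
      rw [h3]
      linarith
    have h6 : (K : ℝ) * (1 / (K + 1)) = 1 - 1 / (K + 1) := by
      field_simp
      ring
    rw [h4]
    have h7 : K * (δ * ‖(e z).fst‖) ≤ δ * (K * (1 / (K + 1))) := by
      rw [mul_left_comm]
      gcongr
    have h8 := mul_le_mul_of_nonneg_left h2 hpos'.le
    rw [h6] at h7
    linarith

lemma exists_smooth_partition {d : ℕ} {S : Set (E d)} (hS : IsCompact S)
    (V : E d → Set (E d)) (hV : ∀ x ∈ S, IsOpen (V x) ∧ x ∈ V x) :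
    ∃ (t : Finset (E d)) (θ : E d → E d → ℝ), (∀ i ∈ t, i ∈ S) ∧ (∀ i, ContDiff ℝ ∞ (θ i)) ∧
      (∀ i ∈ t, tsupport (θ i) ⊆ V i) ∧ (∀ i x, |θ i x| ≤ 1) ∧ ∀ x ∈ S, ∑ i ∈ t, θ i x = 1 := by
  obtain ⟨t, htS, hcov⟩ := hS.elim_nhds_subcover V fun x hx => (hV x hx).1.mem_nhds (hV x hx).2
  obtain ⟨f, hf⟩ := SmoothPartitionOfUnity.exists_isSubordinate (modelWithCornersSelf ℝ (E d))
    hS.isClosed (fun i : t => V i) (fun i => (hV i (htS i i.2)).1)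
    (by simpa [iUnion_subtype] using hcov)
  classical
  refine ⟨t, fun i => if h : i ∈ t then f ⟨i, h⟩ else 0, htS, fun i => ?_, fun i hi => ?_,
    fun i x => ?_, fun x hx => ?_⟩
  · dsimp only
    split_ifs with h
    · exact (f ⟨i, h⟩).contMDiff.contDiff
    · exact contDiff_const
  · simp only [hi, dif_pos]
    exact hf ⟨i, hi⟩
  · dsimp only
    split_ifs with h
    · rw [abs_of_nonneg (f.nonneg _ x)]
      exact f.le_one _ x
    · simp
  · rw [← f.sum_eq_one hx, finsum_eq_sum_of_fintype, ← Finset.sum_coe_sort]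
    exact Finset.sum_congr rfl fun i _ => by simp

lemma gradient_mul {d : ℕ} {θ w : E d → ℝ} (hθ : ContDiff ℝ ∞ θ) (hw : ContDiff ℝ ∞ w)
    (x : E d) : gradient (fun y => θ y * w y) x = θ x • gradient w x + w x • gradient θ x := by
  have h1 := (hθ.differentiable (by simp)).differentiableAt (x := x)
  have h2 := (hw.differentiable (by simp)).differentiableAt (x := x)
  rw [gradient, fderiv_fun_mul h1 h2]
  simp [gradient]

lemma gradient_sum {d : ℕ} {ι : Type*} (t : Finset ι) {w : ι → E d → ℝ}
    (hw : ∀ i ∈ t, ContDiff ℝ ∞ (w i)) (x : E d) :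
    gradient (fun y => ∑ i ∈ t, w i y) x = ∑ i ∈ t, gradient (w i) x := by
  rw [gradient, fderiv_fun_sum fun i hi => ((hw i hi).differentiable (by simp)).differentiableAt]
  simp [gradient]

/-- On each patch of a finite cover of the closure, f is mollified in the directions of the local
cone, and the local approximations w i are patched by a partition of unity. Each w i approximates f
on all of space but its gradient only on V i ∩ Ω, which is enough because θ i vanishes off V i. -/
lemma IsLipschitzDomain.exists_contDiff_approx {n : ℕ} {Ω : Set (E (n + 1))}
    (hΩ : IsLipschitzDomain Ω) {f : E (n + 1) → ℝ} {g : E (n + 1) → E (n + 1)}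
    (hf : MemLp f 2 (bulkMeasure Ω)) (hg : MemLp g 2 (bulkMeasure Ω)) (h : HasWeakGrad Ω f g)
    {ε : ℝ≥0∞} (hε : 0 < ε) :
    ∃ φ : E (n + 1) → ℝ, ContDiff ℝ ∞ φ ∧ eLpNorm (fun x => φ x - f x) 2 (bulkMeasure Ω) ≤ ε ∧
      eLpNorm (fun x => gradient φ x - g x) 2 (bulkMeasure Ω) ≤ ε := by
  have hΩm := hΩ.isOpen.measurableSet
  have hf' : MemLp (Ω.indicator f) 2 volume := (memLp_indicator_iff_restrict hΩm).2 hf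
  have hg' : MemLp (Ω.indicator g) 2 volume := (memLp_indicator_iff_restrict hΩm).2 hg
  have h' : HasWeakGrad Ω (Ω.indicator f) (Ω.indicator g) :=
    h.congr (indicator_ae_eq_restrict hΩm).symm (indicator_ae_eq_restrict hΩm).symm
  have hcomp : IsCompact (closure Ω) := hΩ.isBounded.isCompact_closure
  choose! V hVo hVx v r hr hV using fun x (hx : x ∈ closure Ω) => hΩ.exists_cone hx
  obtain ⟨t, θ, htS, hθ, hθV, hθ1, hsum⟩ :=
    exists_smooth_partition hcomp V fun x hx => ⟨hVo x hx, hVx x hx⟩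
  obtain ⟨M, hM⟩ : ∃ M : ℝ≥0, ∀ i ∈ t, ∀ x ∈ closure Ω, ‖gradient (θ i) x‖ ≤ M := by
    have : ∀ i, ∃ M : ℝ≥0, ∀ x ∈ closure Ω, ‖gradient (θ i) x‖ ≤ M := fun i => by
      obtain ⟨C, hC⟩ := hcomp.exists_bound_of_continuousOn (continuous_gradient (hθ i)).continuousOn
      exact ⟨C.toNNReal, fun x hx => (hC x hx).trans (Real.le_coe_toNNReal C)⟩
    choose M hM using this
    exact ⟨t.sup M, fun i hi x hx => (hM i x hx).trans (by exact_mod_cast Finset.le_sup hi)⟩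
  -- By the product rule each of the `t.card` patches contributes at most (1 + M) ε' to the gradient
  -- error, where M bounds the gradients of the weights.
  set ε' : ℝ≥0∞ := ε / (t.card * (1 + M) + 1) with hε'
  have hden : (t.card * (1 + M) + 1 : ℝ≥0∞) ≠ ⊤ := by finiteness
  have hε'0 : 0 < ε' := ENNReal.div_pos hε.ne' hden
  have hεle : (t.card * (1 + M) : ℝ≥0∞) * ε' ≤ ε :=
    (mul_le_mul_left (le_self_add) ε').trans ENNReal.mul_div_le
  choose! w hw hw1 hw2 using fun i (hi : i ∈ closure Ω) =>
    exists_smooth_approx hf' hg' h' ((hVo i hi).measurableSet.inter hΩm) (hr i hi) (hV i hi) hε'0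
  have hφ : ContDiff ℝ ∞ fun x => ∑ i ∈ t, θ i x * w i x :=
    ContDiff.sum fun i hi => (hθ i).mul (hw i (htS i hi))
  refine ⟨_, hφ, ?_, ?_⟩
  · have heq : (fun x => ∑ i ∈ t, θ i x * w i x - f x) =ᵐ[bulkMeasure Ω]
        ∑ i ∈ t, fun x => θ i x * (w i x - Ω.indicator f x) := by
      filter_upwards [ae_restrict_mem hΩm] with x hx
      simp only [Finset.sum_apply, mul_sub, Finset.sum_sub_distrib, ← Finset.sum_mul,
        hsum x (subset_closure hx), indicator_of_mem hx, one_mul]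
    rw [eLpNorm_congr_ae heq]
    refine (eLpNorm_sum_le (fun i hi => ?_) (by norm_num)).trans
      ((Finset.sum_le_card_nsmul t _ ε' fun i hi => ?_).trans ?_)
    · exact (hθ i).continuous.aestronglyMeasurable.mul
        ((hw i (htS i hi)).continuous.aestronglyMeasurable.sub hf'.1.restrict)
    · refine le_trans ?_ (hw1 i (htS i hi))
      refine (eLpNorm_mono fun x => ?_).trans (eLpNorm_mono_measure _ Measure.restrict_le_self)
      rw [norm_mul]
      exact mul_le_of_le_one_left (norm_nonneg _) (hθ1 i x)
    · refine le_trans ?_ hεle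
      rw [nsmul_eq_mul]
      gcongr
      exact le_mul_of_one_le_right (zero_le) le_self_add
  -- The weights sum to 1 near each point of Ω, so their gradients cancel there. Hence w i may be
  -- replaced by w i - f in the terms containing ∇θ i, and these become small.
  · have hgsum : ∀ x ∈ Ω, ∑ i ∈ t, gradient (θ i) x = 0 := fun x hx => by
      rw [← gradient_sum t (fun i _ => hθ i)]
      have : (fun y => ∑ i ∈ t, θ i y) =ᶠ[𝓝 x] fun _ => 1 := by
        filter_upwards [hΩ.isOpen.mem_nhds hx] with y hy using hsum y (subset_closure hy)
      rw [gradient, this.fderiv_eq]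
      simp
    have heq : (fun x => gradient (fun y => ∑ i ∈ t, θ i y * w i y) x - g x) =ᵐ[bulkMeasure Ω]
        ∑ i ∈ t, ((fun x => θ i x • (gradient (w i) x - Ω.indicator g x)) +
          fun x => (w i x - Ω.indicator f x) • gradient (θ i) x) := by
      filter_upwards [ae_restrict_mem hΩm] with x hx
      rw [gradient_sum t fun i hi => (hθ i).mul (hw i (htS i hi)),
        Finset.sum_congr rfl fun i hi => gradient_mul (hθ i) (hw i (htS i hi)) x]
      simp only [Finset.sum_apply, Pi.add_apply, smul_sub, sub_smul, Finset.sum_add_distrib,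
        Finset.sum_sub_distrib, ← Finset.sum_smul, ← Finset.smul_sum, hgsum x hx,
        hsum x (subset_closure hx), indicator_of_mem hx, one_smul, smul_zero]
      abel
    have hm1 : ∀ i ∈ t, AEStronglyMeasurable
        (fun x => θ i x • (gradient (w i) x - Ω.indicator g x)) (bulkMeasure Ω) := fun i hi =>
      (hθ i).continuous.aestronglyMeasurable.smul
        ((continuous_gradient (hw i (htS i hi))).aestronglyMeasurable.sub hg'.1.restrict)
    have hm2 : ∀ i ∈ t, AEStronglyMeasurable
        (fun x => (w i x - Ω.indicator f x) • gradient (θ i) x) (bulkMeasure Ω) := fun i hi =>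
      ((hw i (htS i hi)).continuous.aestronglyMeasurable.sub hf'.1.restrict).smul
        (continuous_gradient (hθ i)).aestronglyMeasurable
    rw [eLpNorm_congr_ae heq]
    refine (eLpNorm_sum_le (fun i hi => (hm1 i hi).add (hm2 i hi)) (by norm_num)).trans
      ((Finset.sum_le_card_nsmul t _ ((1 + M) * ε') fun i hi => ?_).trans ?_)
    · refine (eLpNorm_add_le (hm1 i hi) (hm2 i hi) (by norm_num)).trans ?_
      rw [add_mul, one_mul]
      gcongr
      · refine le_trans ?_ (hw2 i (htS i hi))
        have hVm := (hVo i (htS i hi)).measurableSet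
        rw [← Measure.restrict_restrict hVm, ← eLpNorm_indicator_eq_eLpNorm_restrict hVm]
        refine eLpNorm_mono fun x => ?_
        by_cases hx : x ∈ V i
        · rw [indicator_of_mem hx, norm_smul]
          exact mul_le_of_le_one_left (norm_nonneg _) (hθ1 i x)
        · have : θ i x = 0 := by
            by_contra h0
            exact hx (hθV i hi (subset_tsupport _ h0))
          simp [this, hx]
      · refine (eLpNorm_le_nnreal_smul_eLpNorm_of_ae_le_mul (c := M)
          (g := fun x => w i x - Ω.indicator f x) ?_ 2).trans ?_
        · filter_upwards [ae_restrict_mem hΩm] with x hx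
          rw [nnnorm_smul, mul_comm]
          gcongr
          exact hM i hi x (subset_closure hx)
        · rw [ENNReal.smul_def, smul_eq_mul]
          gcongr
          exact (eLpNorm_mono_measure _ Measure.restrict_le_self).trans (hw1 i (htS i hi))
    · rw [nsmul_eq_mul, ← mul_assoc]
      exact hεle

/-! ### The trace inequality for smooth functions -/

lemma lintegral_sq_le {α : Type*} [MeasurableSpace α] (μ : Measure α) {g : α → ℝ≥0∞}
    (hg : AEMeasurable g μ) : (∫⁻ x, g x ∂μ) ^ 2 ≤ μ univ * ∫⁻ x, g x ^ 2 ∂μ := by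
  have h := ENNReal.lintegral_mul_le_Lp_mul_Lq μ (Real.HolderConjugate.two_two)
    (aemeasurable_const (b := (1 : ℝ≥0∞))) hg
  simp only [Pi.mul_apply, one_mul, one_pow, lintegral_const, ENNReal.rpow_two] at h
  have h2 := pow_le_pow_left₀ (zero_le) h 2
  refine h2.trans_eq ?_
  rw [mul_pow, ← ENNReal.rpow_natCast, ← ENNReal.rpow_natCast, ← ENNReal.rpow_mul,
    ← ENNReal.rpow_mul]
  norm_num

lemma ennreal_add_sq_le (a b : ℝ≥0∞) : (a + b) ^ 2 ≤ 2 * (a ^ 2 + b ^ 2) := by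
  have := ENNReal.rpow_add_le_mul_rpow_add_rpow a b one_le_two
  norm_num at this
  exact this

/-- The fundamental theorem of calculus followed by Cauchy–Schwarz on (0, h]. -/
lemma enorm_sub_sq_le_lintegral_deriv {u u' : ℝ → ℝ} (hu : ∀ t, HasDerivAt u (u' t) t)
    (hu' : Continuous u') {h s : ℝ} (hs : s ∈ Ioc 0 h) :
    ‖u s - u 0‖ₑ ^ 2 ≤ ENNReal.ofReal h * ∫⁻ t in Ioc 0 h, ‖u' t‖ₑ ^ 2 := by
  have h1 : u s - u 0 = ∫ t in Ioc 0 s, u' t := by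
    rw [← intervalIntegral.integral_of_le hs.1.le,
      intervalIntegral.integral_eq_sub_of_hasDerivAt (fun t _ => hu t)
        (hu'.intervalIntegrable _ _)]
  have h2 : ‖u s - u 0‖ₑ ≤ ∫⁻ t in Ioc 0 h, ‖u' t‖ₑ := by
    rw [h1]
    exact (enorm_integral_le_lintegral_enorm _).trans
      (lintegral_mono_set (Ioc_subset_Ioc_right hs.2))
  refine (pow_le_pow_left₀ zero_le h2 2).trans ?_
  refine (lintegral_sq_le _ hu'.enorm.measurable.aemeasurable).trans_eq ?_
  rw [Measure.restrict_apply_univ, Real.volume_Ioc, sub_zero]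

/-- The one-dimensional trace inequality: compare u(0) with u(s) and integrate over s in (0, h]. -/
lemma enorm_sq_le_lintegral {u u' : ℝ → ℝ} (hu : ∀ t, HasDerivAt u (u' t) t)
    (hu' : Continuous u') {h : ℝ} :
    ENNReal.ofReal h * ‖u 0‖ₑ ^ 2 ≤ 2 * (∫⁻ t in Ioc 0 h, ‖u t‖ₑ ^ 2) +
      2 * ENNReal.ofReal h ^ 2 * ∫⁻ t in Ioc 0 h, ‖u' t‖ₑ ^ 2 := by
  have hc : Continuous u := continuous_iff_continuousAt.2 fun t => (hu t).continuousAt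
  set I := ∫⁻ t in Ioc 0 h, ‖u' t‖ₑ ^ 2 with hI
  have h1 : ∀ s ∈ Ioc 0 h, ‖u 0‖ₑ ^ 2 ≤ 2 * ‖u s‖ₑ ^ 2 + 2 * (ENNReal.ofReal h * I) := by
    intro s hs
    have h2 : ‖u 0‖ₑ ≤ ‖u s‖ₑ + ‖u s - u 0‖ₑ := by
      have := enorm_sub_le (a := u s) (b := u s - u 0)
      rwa [sub_sub_cancel] at this
    refine (pow_le_pow_left₀ zero_le h2 2).trans ((ennreal_add_sq_le _ _).trans ?_)
    rw [mul_add]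
    gcongr
    exact enorm_sub_sq_le_lintegral_deriv hu hu' hs
  calc ENNReal.ofReal h * ‖u 0‖ₑ ^ 2 = ∫⁻ _ in Ioc 0 h, ‖u 0‖ₑ ^ 2 := by
        rw [setLIntegral_const, Real.volume_Ioc, sub_zero, mul_comm]
    _ ≤ ∫⁻ s in Ioc 0 h, (2 * ‖u s‖ₑ ^ 2 + 2 * (ENNReal.ofReal h * I)) :=
        setLIntegral_mono' measurableSet_Ioc h1
    _ = _ := by
        rw [lintegral_add_right _ measurable_const, setLIntegral_const, Real.volume_Ioc, sub_zero,
          lintegral_const_mul _ (hc.enorm.measurable.pow_const 2)]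
        ring

lemma hasDerivAt_line {d : ℕ} {φ : E d → ℝ} (hφ : ContDiff ℝ ∞ φ) (x v : E d) (t : ℝ) :
    HasDerivAt (fun t : ℝ => φ (x + t • v)) (fderiv ℝ φ (x + t • v) v) t := by
  have h1 : HasDerivAt (fun t : ℝ => x + t • v) v t := by
    simpa using ((hasDerivAt_id t).smul_const v).const_add x
  exact ((hφ.differentiable (by simp)).differentiableAt.hasFDerivAt).comp_hasDerivAt t h1

lemma continuous_fderiv_line {d : ℕ} {φ : E d → ℝ} (hφ : ContDiff ℝ ∞ φ) (x v : E d) :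
    Continuous fun t : ℝ => fderiv ℝ φ (x + t • v) v :=
  ((hφ.continuous_fderiv (by simp)).comp (by fun_prop)).clm_apply continuous_const

lemma enorm_fderiv_apply_le {d : ℕ} (φ : E d → ℝ) (x v : E d) :
    ‖fderiv ℝ φ x v‖ₑ ≤ ‖gradient φ x‖ₑ * ‖v‖ₑ := by
  have := (fderiv ℝ φ x).le_opENorm v
  rwa [← enorm_norm (fderiv ℝ φ x), ← norm_gradient, enorm_norm] at this

/-- The map `(y, s) ↦ (y, γ y + s)` in the coordinates `e`. -/
def graphShift {n : ℕ} (e : E (n + 1) ≃ₗᵢ[ℝ] WithLp 2 (E n × ℝ)) (γ : E n → ℝ) (p : E n × ℝ) :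
    E (n + 1) :=
  e.symm (WithLp.toLp 2 (p.1, γ p.1 + p.2))

lemma graphShift_eq {n : ℕ} (e : E (n + 1) ≃ₗᵢ[ℝ] WithLp 2 (E n × ℝ)) (γ : E n → ℝ) (y : E n)
    (s : ℝ) : graphShift e γ (y, s) = graphMap e γ y + s • e.symm (WithLp.toLp 2 (0, 1)) := by
  rw [graphShift, graphMap, ← map_smul, ← map_add, ← WithLp.toLp_smul, ← WithLp.toLp_add]
  simp

/-- A shear, which translates each vertical line, followed by an isometry. -/
lemma measurePreserving_graphShift {n : ℕ} (e : E (n + 1) ≃ₗᵢ[ℝ] WithLp 2 (E n × ℝ))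
    {γ : E n → ℝ} (hγ : Continuous γ) : MeasurePreserving (graphShift e γ) := by
  have h1 : MeasurePreserving (fun p : E n × ℝ => (p.1, γ p.1 + p.2)) :=
    (MeasurePreserving.id volume).skew_product (μc := volume) (μd := volume)
      (g := fun y s => γ y + s) (by
        have : Continuous fun p : E n × ℝ => γ p.1 + p.2 := by fun_prop
        exact this.measurable)
      (Eventually.of_forall fun y => map_add_left_eq_self _ _)
  exact e.symm.measurePreserving.comp ((WithLp.volume_preserving_toLp (E n) ℝ).comp h1)

lemma lintegral_graphShift_le {n : ℕ} {Ω : Set (E (n + 1))} (hΩ : MeasurableSet Ω)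
    (e : E (n + 1) ≃ₗᵢ[ℝ] WithLp 2 (E n × ℝ)) {γ : E n → ℝ} (hγ : Continuous γ) {B : Set (E n)}
    {h : ℝ}
    (hBΩ : ∀ y ∈ B, ∀ s ∈ Ioc 0 h, graphShift e γ (y, s) ∈ Ω) {F : E (n + 1) → ℝ≥0∞}
    (hF : Measurable F) :
    ∫⁻ y in B, ∫⁻ s in Ioc 0 h, F (graphShift e γ (y, s)) ≤ ∫⁻ x in Ω, F x := by
  have hmp := measurePreserving_graphShift e hγ
  rw [← hmp.setLIntegral_comp_preimage hΩ hF, ← setLIntegral_prod (f := fun p => F (graphShift e γ p))]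
  · exact lintegral_mono_set fun p hp => hBΩ p.1 hp.1 p.2 hp.2
  · exact (hF.comp hmp.measurable).aemeasurable

/-- The one-dimensional trace inequality is applied on the vertical segment above each graph point
and integrated over the parameters. The segments sweep out part of Ω without change of volume, and
the surface measure is at most (1 + K)ⁿ times the parameter measure. -/
lemma IsLipschitzDomain.exists_local_trace_bound {n : ℕ} {Ω : Set (E (n + 1))}
    (hΩ : IsLipschitzDomain Ω) {x : E (n + 1)} (hx : x ∈ frontier Ω) :
    ∃ N ∈ 𝓝 x, ∃ C : ℝ≥0∞, C ≠ ⊤ ∧ ∀ φ : E (n + 1) → ℝ, ContDiff ℝ ∞ φ →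
      ∫⁻ z in N, ‖φ z‖ₑ ^ 2 ∂(surfMeasure Ω) ≤
        C * ((∫⁻ z in Ω, ‖φ z‖ₑ ^ 2) + ∫⁻ z in Ω, ‖gradient φ z‖ₑ ^ 2) := by
  obtain ⟨U, e, γ, hxU, hc⟩ := hΩ.exists_chart x hx
  obtain ⟨hU, ⟨K, hK⟩, hiff⟩ := id hc
  obtain ⟨ρ, hρ, hball⟩ := Metric.isOpen_iff.1 hU x hxU
  set v : E (n + 1) := e.symm (WithLp.toLp 2 (0, 1)) with hv
  have hvn : ‖v‖ = 1 := by
    rw [hv, LinearIsometryEquiv.norm_map, WithLp.prod_norm_eq_of_L2]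
    simp
  -- A foot within ρ/2 of x, lifted by at most ρ/4 along a unit vector, stays in the ball of radius
  -- ρ where the chart describes Ω.
  set h : ℝ := ρ / 4 with hh
  have hpos : 0 < h := by positivity
  set N := Metric.ball x (ρ / 2) with hN
  set B : Set (E n) := graphMap e γ ⁻¹' N with hB
  have hBo : IsOpen B := Metric.isOpen_ball.preimage hc.continuous_graphMap
  have hNU : N ⊆ U := (Metric.ball_subset_ball (by linarith)).trans hball
  have hmem : ∀ y ∈ B, ∀ s ∈ Ioc 0 h, graphShift e γ (y, s) ∈ Ω := by
    intro y hy s hs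
    have hsU : graphShift e γ (y, s) ∈ U := by
      apply hball
      have hy' : dist (graphMap e γ y) x < ρ / 2 := hy
      rw [graphShift_eq, Metric.mem_ball]
      have h1 : dist (graphMap e γ y + s • v) (graphMap e γ y) = s := by
        rw [dist_eq_norm, add_sub_cancel_left, norm_smul, hvn, mul_one,
          Real.norm_of_nonneg hs.1.le]
      have h2 := dist_triangle (graphMap e γ y + s • v) (graphMap e γ y) x
      linarith [hs.2]
    rw [hiff _ hsU]
    simpa [graphShift] using hs.1
  set c : ℝ≥0∞ := ((1 + K : ℝ≥0) : ℝ≥0∞) ^ n with hcdef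
  refine ⟨N, Metric.ball_mem_nhds x (by positivity),
    c * ((ENNReal.ofReal h)⁻¹ * (2 + 2 * ENNReal.ofReal h ^ 2)), ?_, fun φ hφ => ?_⟩
  · have : (ENNReal.ofReal h)⁻¹ ≠ ⊤ := by simpa using hpos
    finiteness
  have hh0 : ENNReal.ofReal h ≠ 0 := by simpa using hpos
  have hφm : Measurable fun z => ‖φ z‖ₑ ^ 2 := hφ.continuous.enorm.measurable.pow_const 2
  have hgm : Measurable fun z => ‖gradient φ z‖ₑ ^ 2 :=
    (continuous_gradient hφ).enorm.measurable.pow_const 2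
  have hstep1 : ∫⁻ z in N, ‖φ z‖ₑ ^ 2 ∂(surfMeasure Ω) ≤
      c * ∫⁻ y in B, ‖φ (graphMap e γ y)‖ₑ ^ 2 := by
    have hle := hc.surfMeasure_restrict_le hK (B := B) hNU fun z hz hzf => by
      rw [hB, mem_preimage, hc.graphMap_fst (hNU hz) hzf]
      exact hz
    refine (lintegral_mono' hle le_rfl).trans_eq ?_
    rw [lintegral_smul_measure, lintegral_map hφm hc.continuous_graphMap.measurable, smul_eq_mul]
  have hline : ∀ y, ENNReal.ofReal h * ‖φ (graphMap e γ y)‖ₑ ^ 2 ≤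
      2 * (∫⁻ s in Ioc 0 h, ‖φ (graphShift e γ (y, s))‖ₑ ^ 2) +
        2 * ENNReal.ofReal h ^ 2 * ∫⁻ s in Ioc 0 h, ‖gradient φ (graphShift e γ (y, s))‖ₑ ^ 2 := by
    intro y
    have := enorm_sq_le_lintegral (h := h) (hasDerivAt_line hφ (graphMap e γ y) v)
      (continuous_fderiv_line hφ (graphMap e γ y) v)
    simp only [zero_smul, add_zero, ← graphShift_eq, hv] at this
    refine this.trans ?_
    gcongr with s
    have h1 := enorm_fderiv_apply_le φ (graphShift e γ (y, s)) v
    rwa [← ofReal_norm v, hvn, ENNReal.ofReal_one, mul_one] at h1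
  have hcs : Continuous (graphShift e γ) :=
    e.symm.continuous.comp ((WithLp.prod_continuous_toLp 2 _ _).comp
      (by have := hK.continuous; fun_prop))
  have hstep2 : ENNReal.ofReal h * ∫⁻ y in B, ‖φ (graphMap e γ y)‖ₑ ^ 2 ≤
      (2 + 2 * ENNReal.ofReal h ^ 2) *
        ((∫⁻ z in Ω, ‖φ z‖ₑ ^ 2) + ∫⁻ z in Ω, ‖gradient φ z‖ₑ ^ 2) := by
    have m0 : Measurable fun y => ‖φ (graphMap e γ y)‖ₑ ^ 2 :=
      hφm.comp hc.continuous_graphMap.measurable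
    rw [← lintegral_const_mul _ m0]
    refine (lintegral_mono hline).trans ?_
    have m1 : Measurable fun y => ∫⁻ s in Ioc 0 h, ‖φ (graphShift e γ (y, s))‖ₑ ^ 2 :=
      (hφm.comp hcs.measurable).lintegral_prod_right'
    have m2 : Measurable fun y => ∫⁻ s in Ioc 0 h, ‖gradient φ (graphShift e γ (y, s))‖ₑ ^ 2 :=
      (hgm.comp hcs.measurable).lintegral_prod_right'
    rw [lintegral_add_left (m1.const_mul _), lintegral_const_mul _ m1, lintegral_const_mul _ m2,
      add_mul]
    gcongr
    · exact (lintegral_graphShift_le hΩ.isOpen.measurableSet e hK.continuous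
        hmem hφm).trans le_self_add
    · exact (lintegral_graphShift_le hΩ.isOpen.measurableSet e hK.continuous
        hmem hgm).trans le_add_self
  refine hstep1.trans ?_
  rw [mul_assoc, mul_assoc]
  gcongr
  rwa [← ENNReal.mul_le_iff_le_inv hh0 ENNReal.ofReal_ne_top]

lemma IsLipschitzDomain.isCompact_frontier {n : ℕ} {Ω : Set (E (n + 1))}
    (hΩ : IsLipschitzDomain Ω) : IsCompact (frontier Ω) :=
  Metric.isCompact_of_isClosed_isBounded isClosed_frontier
    (hΩ.isBounded.closure.subset frontier_subset_closure)

lemma IsLipschitzDomain.exists_trace_bound {n : ℕ} {Ω : Set (E (n + 1))}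
    (hΩ : IsLipschitzDomain Ω) :
    ∃ C : ℝ≥0∞, C ≠ ⊤ ∧ ∀ φ : E (n + 1) → ℝ, ContDiff ℝ ∞ φ →
      ∫⁻ z, ‖φ z‖ₑ ^ 2 ∂(surfMeasure Ω) ≤
        C * ((∫⁻ z in Ω, ‖φ z‖ₑ ^ 2) + ∫⁻ z in Ω, ‖gradient φ z‖ₑ ^ 2) := by
  suffices h : ∃ C : ℝ≥0∞, C ≠ ⊤ ∧ ∀ φ : E (n + 1) → ℝ, ContDiff ℝ ∞ φ →
      ∫⁻ z in frontier Ω, ‖φ z‖ₑ ^ 2 ∂(surfMeasure Ω) ≤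
        C * ((∫⁻ z in Ω, ‖φ z‖ₑ ^ 2) + ∫⁻ z in Ω, ‖gradient φ z‖ₑ ^ 2) by
    rwa [Measure.restrict_restrict isClosed_frontier.measurableSet, inter_self] at h
  refine hΩ.isCompact_frontier.induction_on (p := fun s => ∃ C : ℝ≥0∞, C ≠ ⊤ ∧
    ∀ φ : E (n + 1) → ℝ, ContDiff ℝ ∞ φ → ∫⁻ z in s, ‖φ z‖ₑ ^ 2 ∂(surfMeasure Ω) ≤
      C * ((∫⁻ z in Ω, ‖φ z‖ₑ ^ 2) + ∫⁻ z in Ω, ‖gradient φ z‖ₑ ^ 2))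
    ⟨0, by simp, fun φ _ => by simp⟩ ?_ ?_ fun x hx => ?_
  · rintro s t hst ⟨C, hC, h⟩
    exact ⟨C, hC, fun φ hφ => (lintegral_mono_set hst).trans (h φ hφ)⟩
  · rintro s t ⟨C, hC, h⟩ ⟨C', hC', h'⟩
    refine ⟨C + C', by finiteness, fun φ hφ => (lintegral_union_le _ s t).trans ?_⟩
    rw [add_mul]
    exact add_le_add (h φ hφ) (h' φ hφ)
  · obtain ⟨N, hN, C, hC, h⟩ := hΩ.exists_local_trace_bound hx
    exact ⟨N, mem_nhdsWithin_of_mem_nhds hN, C, hC, h⟩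

/-! ### Gluing local Poincaré inequalities -/

lemma eLpNorm_restrict_union_le {X F : Type*} [MeasurableSpace X] [NormedAddCommGroup F]
    {μ : Measure X} (f : X → F) (A B : Set X) :
    eLpNorm f 2 (μ.restrict (A ∪ B)) ≤ eLpNorm f 2 (μ.restrict A) + eLpNorm f 2 (μ.restrict B) := by
  refine (ENNReal.pow_le_pow_left_iff two_ne_zero).1 ?_
  calc eLpNorm f 2 (μ.restrict (A ∪ B)) ^ 2
      ≤ eLpNorm f 2 (μ.restrict A) ^ 2 + eLpNorm f 2 (μ.restrict B) ^ 2 := by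
        simp only [eLpNorm_two_sq]
        exact lintegral_union_le _ A B
    _ ≤ _ := by
        rw [add_sq]
        gcongr
        exact le_self_add

/-- A Poincaré inequality, for the members of a family of functions `f i` with Dirichlet energies
`D i`, in the set `A`. -/
def PoincareOn {X ι : Type*} [MeasurableSpace X] (μ : Measure X) (f : ι → X → ℝ) (D : ι → ℝ≥0∞)
    (A : Set X) : Prop :=
  ∃ C : ℝ≥0∞, C ≠ ⊤ ∧ ∀ i, ∃ a : ℝ, eLpNorm (fun x => f i x - a) 2 (μ.restrict A) ≤ C * D i

section Glue

variable {X ι : Type*} [MeasurableSpace X] {μ : Measure X} {f : ι → X → ℝ} {D : ι → ℝ≥0∞}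

lemma PoincareOn.mono {A B : Set X} (h : PoincareOn μ f D B) (hAB : A ⊆ B) :
    PoincareOn μ f D A := by
  obtain ⟨C, hC, h⟩ := h
  refine ⟨C, hC, fun i => ?_⟩
  obtain ⟨a, ha⟩ := h i
  exact ⟨a, (eLpNorm_mono_measure _ (Measure.restrict_mono hAB le_rfl)).trans ha⟩

/-- On the overlap, which has positive measure, f is close to both a and b; this bounds |b - a| by
the energy, so a serves on B as well. -/
lemma PoincareOn.union [IsFiniteMeasure μ] (hf : ∀ i, AEStronglyMeasurable (f i) μ) {A B : Set X}
    (hA : PoincareOn μ f D A) (hB : PoincareOn μ f D B) (hAB : μ (A ∩ B) ≠ 0) :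
    PoincareOn μ f D (A ∪ B) := by
  obtain ⟨C₁, hC₁, h₁⟩ := hA
  obtain ⟨C₂, hC₂, h₂⟩ := hB
  set m := μ (A ∩ B) ^ (1 / (2 : ℝ)) with hm
  have hm0 : m ≠ 0 := by simp [hm, hAB]
  have hmt : m ≠ ⊤ := by simp [hm]
  set M := μ univ ^ (1 / (2 : ℝ)) with hM
  have hMt : M ≠ ⊤ := by simp [hM]
  refine ⟨C₁ + (C₂ + (C₁ + C₂) / m * M), ?_, fun i => ?_⟩
  · have : (C₁ + C₂) / m ≠ ⊤ := ENNReal.div_ne_top (by finiteness) hm0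
    finiteness
  obtain ⟨a, ha⟩ := h₁ i
  obtain ⟨b, hb⟩ := h₂ i
  have hma : ∀ c : ℝ, ∀ S, AEStronglyMeasurable (fun x => f i x - c) (μ.restrict S) := fun c S =>
    ((hf i).sub aestronglyMeasurable_const).restrict
  have hconst : ∀ ν : Measure X, eLpNorm (fun _ : X => b - a) 2 ν =
      ‖b - a‖ₑ * ν univ ^ (1 / (2 : ℝ)) := fun ν => by
    rw [eLpNorm_const' _ (by norm_num) (by norm_num)]
    simp
  have hab : ‖b - a‖ₑ ≤ (C₁ + C₂) * D i / m := by
    rw [ENNReal.le_div_iff_mul_le (Or.inl hm0) (Or.inl hmt)]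
    have h0 := hconst (μ.restrict (A ∩ B))
    rw [Measure.restrict_apply_univ] at h0
    rw [hm, ← h0]
    have : (fun _ : X => b - a) = (fun x => f i x - a) - fun x => f i x - b := by
      ext x
      simp
    rw [this]
    refine (eLpNorm_sub_le (hma a _) (hma b _) (by norm_num)).trans ?_
    rw [add_mul]
    exact add_le_add
      ((eLpNorm_mono_measure _ (Measure.restrict_mono inter_subset_left le_rfl)).trans ha)
      ((eLpNorm_mono_measure _ (Measure.restrict_mono inter_subset_right le_rfl)).trans hb)
  refine ⟨a, (eLpNorm_restrict_union_le _ A B).trans ?_⟩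
  rw [add_mul]
  gcongr
  have : (fun x => f i x - a) = (fun x => f i x - b) + fun _ => b - a := by
    ext x
    simp
  rw [this]
  refine (eLpNorm_add_le (hma b _) aestronglyMeasurable_const (by norm_num)).trans ?_
  rw [add_mul]
  gcongr
  rw [hconst, Measure.restrict_apply_univ]
  calc ‖b - a‖ₑ * μ B ^ (1 / (2 : ℝ)) ≤ (C₁ + C₂) * D i / m * M := by
        gcongr
        exact ENNReal.rpow_le_rpow (measure_mono (subset_univ B)) (by norm_num)
    _ = (C₁ + C₂) / m * M * D i := by
        simp only [div_eq_mul_inv]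
        ring

/-- Local Poincaré inequalities give a Poincaré inequality in a connected set. -/
lemma poincareOn_of_local [TopologicalSpace X] [IsFiniteMeasure μ]
    (hf : ∀ i, AEStronglyMeasurable (f i) μ) {S : Set X} (hS : IsConnected S)
    (hSc : IsCompact (closure S))
    (hpos : ∀ O, IsOpen O → (O ∩ S).Nonempty → μ (O ∩ S) ≠ 0)
    (hloc : ∀ x ∈ closure S, ∃ N, IsOpen N ∧ x ∈ N ∧ PoincareOn μ f D (N ∩ S)) :
    PoincareOn μ f D S := by
  have hglue : ∀ {N M : Set X}, IsOpen N → IsOpen M → PoincareOn μ f D (N ∩ S) →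
      PoincareOn μ f D (M ∩ S) → ∀ x ∈ S, x ∈ N → x ∈ M → PoincareOn μ f D ((N ∪ M) ∩ S) := by
    intro N M hN hM h h' x hx hxN hxM
    rw [union_inter_distrib_right]
    refine h.union hf h' ?_
    rw [← inter_inter_distrib_right]
    exact hpos _ (hN.inter hM) ⟨x, ⟨hxN, hxM⟩, hx⟩
  obtain ⟨x₀, hx₀⟩ := hS.nonempty
  have hconn : ∀ x ∈ S, ∃ N, IsOpen N ∧ x₀ ∈ N ∧ x ∈ N ∧ PoincareOn μ f D (N ∩ S) := by
    intro x hx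
    -- Lying in a common open set that carries a Poincaré inequality is a symmetric and transitive
    -- relation on S, true for nearby points; on a connected set it therefore relates all points.
    refine hS.isPreconnected.induction₂
      (fun x y => ∃ N, IsOpen N ∧ x ∈ N ∧ y ∈ N ∧ PoincareOn μ f D (N ∩ S)) ?_ ?_ ?_ hx₀ hx
    · intro y hy
      obtain ⟨N, hN, hyN, h⟩ := hloc y (subset_closure hy)
      filter_upwards [mem_nhdsWithin_of_mem_nhds (hN.mem_nhds hyN)] with z hz
      exact ⟨N, hN, hyN, hz, h⟩
    · rintro x y z - hy - ⟨N, hN, hxN, hyN, h⟩ ⟨M, hM, hyM, hzM, h'⟩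
      exact ⟨N ∪ M, hN.union hM, Or.inl hxN, Or.inr hzM, hglue hN hM h h' y hy hyN hyM⟩
    · rintro x y - - ⟨N, hN, hxN, hyN, h⟩
      exact ⟨N, hN, hyN, hxN, h⟩
  -- Compactness reduces to finitely many patches. Each is first enlarged, through a point of S it
  -- contains, so as to include x₀; then any two overlap at x₀ and can be glued.
  obtain ⟨N, -, hSN, -, h⟩ := hSc.induction_on
    (p := fun s => ∃ N, IsOpen N ∧ s ∩ S ⊆ N ∧ x₀ ∈ N ∧ PoincareOn μ f D (N ∩ S))
    (by
      obtain ⟨N, hN, h0, -, h⟩ := hconn x₀ hx₀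
      exact ⟨N, hN, by simp, h0, h⟩)
    (fun s t hst ⟨N, hN, h1, h⟩ => ⟨N, hN, (inter_subset_inter_left S hst).trans h1, h⟩)
    (fun s t ⟨N, hN, h1, h2, h3⟩ ⟨M, hM, h1', h2', h3'⟩ =>
      ⟨N ∪ M, hN.union hM, by
        rw [union_inter_distrib_right]
        exact union_subset_union h1 h1', Or.inl h2, hglue hN hM h3 h3' x₀ hx₀ h2 h2'⟩)
    (fun x hx => by
      obtain ⟨N, hN, hxN, h⟩ := hloc x hx
      obtain ⟨y, hyN, hyS⟩ := mem_closure_iff.1 hx N hN hxN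
      obtain ⟨M, hM, h0M, hyM, h'⟩ := hconn y hyS
      exact ⟨N, mem_nhdsWithin_of_mem_nhds (hN.mem_nhds hxN), N ∪ M, hN.union hM,
        inter_subset_left.trans subset_union_left, Or.inr h0M, hglue hN hM h h' y hyS hyN hyM⟩)
  exact h.mono fun x hx => ⟨hSN ⟨subset_closure hx, hx⟩, hx⟩

end Glue

/-! ### Local Poincaré inequalities for smooth functions -/

/-- Change of variables; the Jacobian factor t⁻ᵈ is at most 2ᵈ because t ≥ 1/2. -/
lemma lintegral_comp_add_smul_le {d : ℕ} {A O : Set (E d)} (hO : MeasurableSet O)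
    {F : E d → ℝ≥0∞} (hF : Measurable F) (c : E d) {t : ℝ} (ht : 1 / 2 ≤ t)
    (hA : ∀ z ∈ A, c + t • z ∈ O) :
    ∫⁻ z in A, F (c + t • z) ≤ 2 ^ d * ∫⁻ x in O, F x := by
  have ht0 : 0 < t := lt_of_lt_of_le (by norm_num) ht
  have hm : Measurable fun z : E d => c + t • z := by fun_prop
  have hmap : Measure.map (fun z : E d => c + t • z) volume =
      ENNReal.ofReal (|(t ^ d)⁻¹|) • volume := by
    have h1 := Measure.map_addHaar_smul (volume : Measure (E d)) ht0.ne'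
    have h2 : (fun z : E d => c + t • z) = (fun z => c + z) ∘ fun z => t • z := rfl
    rw [h2, ← Measure.map_map (by fun_prop) (by fun_prop), h1, Measure.map_smul,
      map_add_left_eq_self]
    simp
  calc ∫⁻ z in A, F (c + t • z) ≤ ∫⁻ z in (fun z : E d => c + t • z) ⁻¹' O, F (c + t • z) :=
        lintegral_mono_set hA
    _ = ∫⁻ x in O, F x ∂(Measure.map (fun z : E d => c + t • z) volume) := by
        rw [setLIntegral_map hO hF hm]
    _ = ENNReal.ofReal (|(t ^ d)⁻¹|) * ∫⁻ x in O, F x := by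
        rw [hmap, Measure.restrict_smul, lintegral_smul_measure, smul_eq_mul]
    _ ≤ 2 ^ d * ∫⁻ x in O, F x := by
        gcongr
        have h3 : |(t ^ d)⁻¹| ≤ 2 ^ d := by
          rw [abs_of_pos (by positivity), ← inv_pow]
          refine pow_le_pow_left₀ (by positivity) ?_ d
          rw [inv_le_comm₀ ht0 (by norm_num)]
          linarith
        refine (ENNReal.ofReal_le_ofReal h3).trans_eq ?_
        rw [ENNReal.ofReal_pow (by norm_num)]
        norm_num

/-- The point on the segment is (1 - t) x + t z. One of the two coefficients is at least 1/2;
integrating first in that variable keeps the Jacobian bounded uniformly in t. -/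
lemma lintegral_segment_le {d : ℕ} {A B O : Set (E d)} (hA : MeasurableSet A)
    (hB : MeasurableSet B) (hO : MeasurableSet O) {t : ℝ}
    (hseg : ∀ x ∈ A, ∀ z ∈ B, x + t • (z - x) ∈ O) {F : E d → ℝ≥0∞} (hF : Measurable F) :
    ∫⁻ z in B, ∫⁻ x in A, F (x + t • (z - x)) ≤
      2 ^ d * (volume A + volume B) * ∫⁻ x in O, F x := by
  rcases le_total (1 / 2) t with h | h
  · rw [lintegral_lintegral_swap (by
      have : Measurable fun p : E d × E d => F (p.2 + t • (p.1 - p.2)) := hF.comp (by fun_prop)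
      exact this.aemeasurable)]
    calc ∫⁻ x in A, ∫⁻ z in B, F (x + t • (z - x))
        ≤ ∫⁻ _ in A, 2 ^ d * ∫⁻ x in O, F x := by
          refine setLIntegral_mono' hA fun x hx => ?_
          have e1 : ∀ z, x + t • (z - x) = (x - t • x) + t • z := fun z => by
            rw [smul_sub]
            abel
          simp only [e1]
          refine lintegral_comp_add_smul_le hO hF _ h fun z hz => ?_
          rw [← e1]
          exact hseg x hx z hz
      _ = 2 ^ d * volume A * ∫⁻ x in O, F x := by
          rw [setLIntegral_const]
          ring
      _ ≤ _ := by
          gcongr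
          exact le_self_add
  · calc ∫⁻ z in B, ∫⁻ x in A, F (x + t • (z - x))
        ≤ ∫⁻ _ in B, 2 ^ d * ∫⁻ x in O, F x := by
          refine setLIntegral_mono' hB fun z hz => ?_
          have e1 : ∀ x, x + t • (z - x) = t • z + (1 - t) • x := fun x => by
            rw [smul_sub, sub_smul, one_smul]
            abel
          simp only [e1]
          refine lintegral_comp_add_smul_le hO hF _ (by linarith) fun x hx => ?_
          rw [← e1]
          exact hseg x hx z hz
      _ = 2 ^ d * volume B * ∫⁻ x in O, F x := by
          rw [setLIntegral_const]
          ring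
      _ ≤ _ := by
          gcongr
          exact le_add_self

lemma lintegral_segments_le {d : ℕ} {A B O : Set (E d)} (hA : MeasurableSet A)
    (hB : MeasurableSet B) (hO : MeasurableSet O)
    (hseg : ∀ x ∈ A, ∀ z ∈ B, ∀ t ∈ Ioc (0 : ℝ) 1, x + t • (z - x) ∈ O) {F : E d → ℝ≥0∞}
    (hF : Measurable F) :
    ∫⁻ z in B, ∫⁻ x in A, ∫⁻ t in Ioc (0 : ℝ) 1, F (x + t • (z - x)) ≤
      2 ^ d * (volume A + volume B) * ∫⁻ x in O, F x := by
  have m2 : Measurable fun p : (E d × ℝ) × E d => F (p.2 + p.1.2 • (p.1.1 - p.2)) :=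
    hF.comp (by fun_prop)
  have m3 : Measurable fun p : E d × ℝ => ∫⁻ x in A, F (x + p.2 • (p.1 - x)) :=
    m2.lintegral_prod_right'
  calc ∫⁻ z in B, ∫⁻ x in A, ∫⁻ t in Ioc (0 : ℝ) 1, F (x + t • (z - x))
      = ∫⁻ z in B, ∫⁻ t in Ioc (0 : ℝ) 1, ∫⁻ x in A, F (x + t • (z - x)) := by
        refine lintegral_congr fun z => ?_
        have : Measurable fun p : E d × ℝ => F (p.1 + p.2 • (z - p.1)) := hF.comp (by fun_prop)
        exact lintegral_lintegral_swap (f := fun x t => F (x + t • (z - x))) this.aemeasurable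
    _ = ∫⁻ t in Ioc (0 : ℝ) 1, ∫⁻ z in B, ∫⁻ x in A, F (x + t • (z - x)) :=
        lintegral_lintegral_swap (f := fun z t => ∫⁻ x in A, F (x + t • (z - x))) m3.aemeasurable
    _ ≤ ∫⁻ _ in Ioc (0 : ℝ) 1, 2 ^ d * (volume A + volume B) * ∫⁻ x in O, F x :=
        setLIntegral_mono' measurableSet_Ioc fun t ht =>
          lintegral_segment_le hA hB hO (fun x hx z hz => hseg x hx z hz t ht) hF
    _ = _ := by
        rw [setLIntegral_const, Real.volume_Ioc]
        simp

/-- The double integral form of the Poincaré inequality, for two sets `A`, `B` such that the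
segments from `A` to `B` lie in `O`. -/
lemma lintegral_lintegral_sub_sq_le {d : ℕ} {A B O : Set (E d)} (hA : MeasurableSet A)
    (hB : MeasurableSet B) (hO : MeasurableSet O) {R : ℝ}
    (hR : ∀ x ∈ A, ∀ z ∈ B, ‖z - x‖ ≤ R)
    (hseg : ∀ x ∈ A, ∀ z ∈ B, ∀ t ∈ Ioc (0 : ℝ) 1, x + t • (z - x) ∈ O) {φ : E d → ℝ}
    (hφ : ContDiff ℝ ∞ φ) :
    ∫⁻ z in B, ∫⁻ x in A, ‖φ z - φ x‖ₑ ^ 2 ≤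
      ENNReal.ofReal R ^ 2 * (2 ^ d * (volume A + volume B)) *
        ∫⁻ x in O, ‖gradient φ x‖ₑ ^ 2 := by
  have hF : Measurable fun x => ‖gradient φ x‖ₑ ^ 2 :=
    (continuous_gradient hφ).enorm.measurable.pow_const 2
  have hpt : ∀ z ∈ B, ∀ x ∈ A, ‖φ z - φ x‖ₑ ^ 2 ≤
      ENNReal.ofReal R ^ 2 * ∫⁻ t in Ioc (0 : ℝ) 1, ‖gradient φ (x + t • (z - x))‖ₑ ^ 2 := by
    intro z hz x hx
    have h1 := enorm_sub_sq_le_lintegral_deriv (hasDerivAt_line hφ x (z - x))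
      (continuous_fderiv_line hφ x (z - x)) (h := 1) (s := 1) ⟨one_pos, le_rfl⟩
    rw [one_smul, zero_smul, add_zero, add_sub_cancel, ENNReal.ofReal_one, one_mul] at h1
    refine h1.trans ?_
    have hm : Measurable fun t : ℝ => ‖gradient φ (x + t • (z - x))‖ₑ ^ 2 :=
      hF.comp (by fun_prop)
    rw [← lintegral_const_mul _ hm]
    refine lintegral_mono fun t => ?_
    rw [mul_comm, ← mul_pow]
    refine pow_le_pow_left₀ zero_le ((enorm_fderiv_apply_le φ _ _).trans ?_) 2
    gcongr
    rw [← ofReal_norm]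
    exact ENNReal.ofReal_le_ofReal (hR x hx z hz)
  have m0 : Measurable fun p : (E d × E d) × ℝ =>
      ‖gradient φ (p.1.2 + p.2 • (p.1.1 - p.1.2))‖ₑ ^ 2 := hF.comp (by fun_prop)
  have m1 : Measurable fun p : E d × E d =>
      ∫⁻ t in Ioc (0 : ℝ) 1, ‖gradient φ (p.2 + t • (p.1 - p.2))‖ₑ ^ 2 := m0.lintegral_prod_right'
  have m3 : ∀ z, Measurable fun x : E d =>
      ∫⁻ t in Ioc (0 : ℝ) 1, ‖gradient φ (x + t • (z - x))‖ₑ ^ 2 := fun z => by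
    have : Measurable fun p : E d × ℝ => ‖gradient φ (p.1 + p.2 • (z - p.1))‖ₑ ^ 2 :=
      hF.comp (by fun_prop)
    exact this.lintegral_prod_right'
  have m2 : Measurable fun z : E d =>
      ∫⁻ x in A, ∫⁻ t in Ioc (0 : ℝ) 1, ‖gradient φ (x + t • (z - x))‖ₑ ^ 2 :=
    m1.lintegral_prod_right'
  calc ∫⁻ z in B, ∫⁻ x in A, ‖φ z - φ x‖ₑ ^ 2
      ≤ ∫⁻ z in B, ∫⁻ x in A, ENNReal.ofReal R ^ 2 *
          ∫⁻ t in Ioc (0 : ℝ) 1, ‖gradient φ (x + t • (z - x))‖ₑ ^ 2 :=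
        setLIntegral_mono' hB fun z hz => setLIntegral_mono' hA fun x hx => hpt z hz x hx
    _ = ∫⁻ z in B, ENNReal.ofReal R ^ 2 *
          ∫⁻ x in A, ∫⁻ t in Ioc (0 : ℝ) 1, ‖gradient φ (x + t • (z - x))‖ₑ ^ 2 :=
by
        refine lintegral_congr fun z => ?_
        rw [lintegral_const_mul _ (m3 z)]
    _ = ENNReal.ofReal R ^ 2 *
          ∫⁻ z in B, ∫⁻ x in A, ∫⁻ t in Ioc (0 : ℝ) 1, ‖gradient φ (x + t • (z - x))‖ₑ ^ 2 :=
        lintegral_const_mul _ m2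
    _ ≤ _ := by
        rw [mul_assoc]
        exact mul_le_mul_right (lintegral_segments_le hA hB hO hseg hF) _

/-- The constant is a value of φ at one good point of B. Neither A nor O has to be convex: only the
segments joining A to B matter. -/
lemma exists_poincare_of_segments {d : ℕ} {A B O : Set (E d)} (hA : MeasurableSet A)
    (hAb : Bornology.IsBounded A) (hB : IsOpen B) (hBb : Bornology.IsBounded B)
    (hBne : B.Nonempty) (hO : MeasurableSet O)
    (hseg : ∀ x ∈ A, ∀ z ∈ B, ∀ t ∈ Ioc (0 : ℝ) 1, x + t • (z - x) ∈ O) :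
    ∃ C : ℝ≥0∞, C ≠ ⊤ ∧ ∀ φ : E d → ℝ, ContDiff ℝ ∞ φ → ∃ a : ℝ,
      eLpNorm (fun x => φ x - a) 2 (volume.restrict A) ≤
        C * eLpNorm (gradient φ) 2 (volume.restrict O) := by
  obtain ⟨R, hR⟩ := Metric.isBounded_iff.1 (hAb.union hBb)
  have hBpos : volume B ≠ 0 := (hB.measure_pos volume hBne).ne'
  have hBfin : volume B ≠ ⊤ := hBb.measure_lt_top.ne
  have hAfin : volume A ≠ ⊤ := hAb.measure_lt_top.ne
  set c : ℝ≥0∞ := ENNReal.ofReal R ^ 2 * (2 ^ d * (volume A + volume B)) / volume B with hc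
  have hct : c ≠ ⊤ := ENNReal.div_ne_top (by finiteness) hBpos
  refine ⟨c ^ (1 / (2 : ℝ)), by finiteness, fun φ hφ => ?_⟩
  have key := lintegral_lintegral_sub_sq_le hA hB.measurableSet hO (R := R)
    (fun x hx z hz => by
      rw [← dist_eq_norm]
      exact hR (Or.inr hz) (Or.inl hx)) hseg hφ
  have hm : Measurable fun z => ∫⁻ x in A, ‖φ z - φ x‖ₑ ^ 2 := by
    have : Continuous fun p : E d × E d => ‖φ p.1 - φ p.2‖ₑ ^ 2 :=
      (ENNReal.continuous_pow 2).comp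
        ((hφ.continuous.comp continuous_fst).sub (hφ.continuous.comp continuous_snd)).enorm
    exact this.measurable.lintegral_prod_right'
  -- Some z in B does no worse than the average over B of the integral over A of |φ z - φ x|².
  obtain ⟨z, hz, hle⟩ := exists_le_setLAverage hBpos hBfin hm.aemeasurable
  refine ⟨φ z, (ENNReal.pow_le_pow_left_iff two_ne_zero).1 ?_⟩
  rw [setLAverage_eq] at hle
  rw [mul_pow, eLpNorm_two_sq, eLpNorm_two_sq]
  have e1 : (c ^ (1 / (2 : ℝ))) ^ 2 = c := by
    rw [← ENNReal.rpow_natCast, ← ENNReal.rpow_mul]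
    norm_num
  rw [e1]
  calc ∫⁻ x in A, ‖φ x - φ z‖ₑ ^ 2 = ∫⁻ x in A, ‖φ z - φ x‖ₑ ^ 2 := by
        refine lintegral_congr fun x => ?_
        rw [enorm_sub_rev]
    _ ≤ _ := hle
    _ ≤ ENNReal.ofReal R ^ 2 * (2 ^ d * (volume A + volume B)) *
          (∫⁻ x in O, ‖gradient φ x‖ₑ ^ 2) / volume B := by gcongr
    _ = _ := by
        simp only [hc, div_eq_mul_inv]
        ring

/-! ### Poincaré inequalities on the domain and on its boundary -/

/-- Up to a factor 2 the mean is as good as any constant: f minus its mean is f - a minus the mean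
of f - a, and averaging contracts the L² norm. -/
lemma eLpNorm_sub_average_le {X : Type*} [MeasurableSpace X] {μ : Measure X} [IsFiniteMeasure μ]
    {f : X → ℝ} (hf : MemLp f 2 μ) (a : ℝ) :
    eLpNorm (fun x => f x - ⨍ y, f y ∂μ) 2 μ ≤ 2 * eLpNorm (fun x => f x - a) 2 μ := by
  rcases eq_or_ne μ 0 with rfl | hμ
  · simp
  have : NeZero μ := ⟨hμ⟩
  have hfa : MemLp (fun x => f x - a) 2 μ := hf.sub (memLp_const a)
  have hfi : Integrable f μ := hf.integrable (by norm_num)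
  have h1 : (fun x => f x - ⨍ y, f y ∂μ) = (fun x => f x - a) - fun _ => ⨍ y, (f y - a) ∂μ := by
    ext x
    rw [Pi.sub_apply, average_eq, average_eq, integral_sub hfi (integrable_const a), smul_sub,
      integral_const, smul_smul, inv_mul_cancel₀ (measureReal_univ_pos.ne'), one_smul]
    ring
  have hμ0 : μ univ ≠ 0 := Measure.measure_univ_ne_zero.2 hμ
  have hμt : μ univ ≠ ⊤ := measure_ne_top μ univ
  rw [h1, two_mul]
  refine (eLpNorm_sub_le hfa.1 aestronglyMeasurable_const (by norm_num)).trans ?_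
  gcongr
  refine (ENNReal.pow_le_pow_left_iff two_ne_zero).1 ?_
  rw [eLpNorm_two_sq, lintegral_const, eLpNorm_two_sq]
  have h2 : ‖⨍ y, (f y - a) ∂μ‖ₑ ≤ (μ univ)⁻¹ * ∫⁻ x, ‖f x - a‖ₑ ∂μ := by
    rw [average_eq']
    refine (enorm_integral_le_lintegral_enorm _).trans_eq ?_
    rw [lintegral_smul_measure, smul_eq_mul]
  calc ‖⨍ y, (f y - a) ∂μ‖ₑ ^ 2 * μ univ
      ≤ ((μ univ)⁻¹ * ∫⁻ x, ‖f x - a‖ₑ ∂μ) ^ 2 * μ univ := by gcongr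
    _ = (μ univ)⁻¹ * ((μ univ)⁻¹ * μ univ) * (∫⁻ x, ‖f x - a‖ₑ ∂μ) ^ 2 := by ring
    _ = (μ univ)⁻¹ * (∫⁻ x, ‖f x - a‖ₑ ∂μ) ^ 2 := by
        rw [ENNReal.inv_mul_cancel hμ0 hμt, mul_one]
    _ ≤ (μ univ)⁻¹ * (μ univ * ∫⁻ x, ‖f x - a‖ₑ ^ 2 ∂μ) := by
        gcongr
        exact lintegral_sq_le μ hfa.1.enorm
    _ = _ := by rw [← mul_assoc, ENNReal.inv_mul_cancel hμ0 hμt, one_mul]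

/-- Transfers a Poincaré inequality from smooth to weakly differentiable functions. The constant
provided for φ varies with φ; passing to the mean of f removes this dependence before the limit is
taken. -/
lemma eLpNorm_sub_average_le_of_approx {d : ℕ} {A O : Set (E d)} (hA : Bornology.IsBounded A)
    {C : ℝ≥0∞} (hC : C ≠ ⊤)
    (hP : ∀ φ : E d → ℝ, ContDiff ℝ ∞ φ → ∃ a : ℝ,
      eLpNorm (fun x => φ x - a) 2 (volume.restrict A) ≤
        C * eLpNorm (gradient φ) 2 (volume.restrict O))
    {f : E d → ℝ} {g : E d → E d} (hf : MemLp f 2 (volume.restrict A))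
    (hg : MemLp g 2 (volume.restrict O))
    (happ : ∀ ε : ℝ≥0∞, 0 < ε → ∃ φ : E d → ℝ, ContDiff ℝ ∞ φ ∧
      eLpNorm (fun x => φ x - f x) 2 (volume.restrict A) ≤ ε ∧
      eLpNorm (fun x => gradient φ x - g x) 2 (volume.restrict O) ≤ ε) :
    eLpNorm (fun x => f x - ⨍ y in A, f y) 2 (volume.restrict A) ≤
      2 * C * eLpNorm g 2 (volume.restrict O) := by
  have : IsFiniteMeasure (volume.restrict A) :=
    ⟨by rw [Measure.restrict_apply_univ]; exact hA.measure_lt_top⟩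
  refine ENNReal.le_of_forall_pos_le_add fun δ hδ _ => ?_
  have hden : 2 * C + 2 ≠ ⊤ := by finiteness
  -- The gradient error enters with the factor 2C and the function error with the factor 2.
  obtain ⟨φ, hφ, h1, h2⟩ := happ (δ / (2 * C + 2)) (ENNReal.div_pos (by simpa using hδ.ne') hden)
  set ε : ℝ≥0∞ := δ / (2 * C + 2) with hε
  obtain ⟨a, ha⟩ := hP φ hφ
  have hφm : ∀ ν : Measure (E d), AEStronglyMeasurable φ ν := fun ν =>
    hφ.continuous.aestronglyMeasurable
  have h3 : eLpNorm (fun x => f x - a) 2 (volume.restrict A) ≤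
      C * (eLpNorm g 2 (volume.restrict O) + ε) + ε := by
    have e1 : (fun x => f x - a) = (fun x => φ x - a) - fun x => φ x - f x := by
      ext x
      simp
    rw [e1]
    refine (eLpNorm_sub_le ((hφm _).sub aestronglyMeasurable_const) ((hφm _).sub hf.1)
      (by norm_num)).trans (add_le_add (ha.trans ?_) h1)
    gcongr
    have e2 : gradient φ = g + fun x => gradient φ x - g x := by
      ext1 x
      simp
    rw [e2]
    refine (eLpNorm_add_le hg.1 ((continuous_gradient hφ).aestronglyMeasurable.sub hg.1)
      (by norm_num)).trans (add_le_add le_rfl h2)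
  refine (eLpNorm_sub_average_le hf a).trans ?_
  calc 2 * eLpNorm (fun x => f x - a) 2 (volume.restrict A)
      ≤ 2 * (C * (eLpNorm g 2 (volume.restrict O) + ε) + ε) := by gcongr
    _ = 2 * C * eLpNorm g 2 (volume.restrict O) + (2 * C + 2) * ε := by ring
    _ ≤ _ := by
        gcongr
        exact ENNReal.mul_div_le

lemma add_smul_sub_mem_ball {d : ℕ} {c x z : E d} {r t : ℝ} (hx : x ∈ Metric.ball c r)
    (hz : z ∈ Metric.ball c r) (ht : t ∈ Ioc (0 : ℝ) 1) : x + t • (z - x) ∈ Metric.ball c r :=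
  (convex_ball c r).add_smul_sub_mem hx hz ⟨ht.1.le, ht.2⟩

lemma exists_poincare_ball {d : ℕ} (c : E d) {r : ℝ} (hr : 0 < r) :
    ∃ C : ℝ≥0∞, C ≠ ⊤ ∧ ∀ φ : E d → ℝ, ContDiff ℝ ∞ φ → ∃ a : ℝ,
      eLpNorm (fun x => φ x - a) 2 (volume.restrict (Metric.ball c r)) ≤
        C * eLpNorm (gradient φ) 2 (volume.restrict (Metric.ball c r)) :=
  exists_poincare_of_segments measurableSet_ball Metric.isBounded_ball Metric.isOpen_ball
    Metric.isBounded_ball ⟨c, Metric.mem_ball_self hr⟩ measurableSet_ball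
    fun _ hx _ hz _ ht => add_smul_sub_mem_ball hx hz ht

/-- Near the boundary, every point of Ω close to x sees a fixed ball placed above x in the vertical
direction of the chart: the connecting segments stay above the graph. -/
lemma IsLipschitzDomain.exists_local_poincare {n : ℕ} {Ω : Set (E (n + 1))}
    (hΩ : IsLipschitzDomain Ω) {x : E (n + 1)} (hx : x ∈ closure Ω) :
    ∃ N, IsOpen N ∧ x ∈ N ∧ ∃ C : ℝ≥0∞, C ≠ ⊤ ∧ ∀ φ : E (n + 1) → ℝ, ContDiff ℝ ∞ φ → ∃ a : ℝ,
      eLpNorm (fun x => φ x - a) 2 (volume.restrict (N ∩ Ω)) ≤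
        C * eLpNorm (gradient φ) 2 (volume.restrict Ω) := by
  have hΩm := hΩ.isOpen.measurableSet
  by_cases hxΩ : x ∈ Ω
  · obtain ⟨r, hr, hball⟩ := Metric.isOpen_iff.1 hΩ.isOpen x hxΩ
    refine ⟨Metric.ball x r, Metric.isOpen_ball, Metric.mem_ball_self hr, ?_⟩
    exact exists_poincare_of_segments (B := Metric.ball x r)
      (measurableSet_ball.inter hΩm) (Metric.isBounded_ball.subset inter_subset_left)
      Metric.isOpen_ball Metric.isBounded_ball ⟨x, Metric.mem_ball_self hr⟩ hΩm
      fun y hy z hz t ht => hball (add_smul_sub_mem_ball hy.1 hz ht)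
  · obtain ⟨U, e, γ, hxU, hU, ⟨K, hK⟩, hiff⟩ :=
      hΩ.exists_chart x ⟨hx, fun h => hxΩ (interior_subset h)⟩
    obtain ⟨ρ, hρ, hball⟩ := Metric.isOpen_iff.1 hU x hxU
    set v : E (n + 1) := e.symm (WithLp.toLp 2 (0, 1)) with hv
    have hvn : ‖v‖ = 1 := by
      rw [hv, LinearIsometryEquiv.norm_map, WithLp.prod_norm_eq_of_L2]
      simp
    set h : ℝ := ρ / 2 with hh
    -- This makes h - 2r = 2rK. Along the segment the horizontal displacement is at most 2r, so the
    -- graph rises by at most 2rK, while the segment rises by at least h - 2r; both bounds scale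
    -- with t.
    set r : ℝ := h / (2 * K + 2) with hr
    have hh0 : 0 < h := by positivity
    have hr0 : 0 < r := by positivity
    have hrK : 2 * r * K + 2 * r = h := by
      rw [hr]
      field_simp
    have hrh : 2 * r ≤ h := by
      have : 0 ≤ 2 * r * K := by positivity
      linarith
    refine ⟨Metric.ball x r, Metric.isOpen_ball, Metric.mem_ball_self hr0, ?_⟩
    refine exists_poincare_of_segments (B := Metric.ball (x + h • v) r)
      (measurableSet_ball.inter hΩm) (Metric.isBounded_ball.subset inter_subset_left)
      Metric.isOpen_ball Metric.isBounded_ball ⟨_, Metric.mem_ball_self hr0⟩ hΩm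
      fun y hy z hz t ht => ?_
    have hyρ : y ∈ Metric.ball x ρ := Metric.ball_subset_ball (by linarith) hy.1
    have hzρ : z ∈ Metric.ball x ρ := by
      rw [Metric.mem_ball] at hz ⊢
      have h1 : dist (x + h • v) x = h := by
        rw [dist_eq_norm, add_sub_cancel_left, norm_smul, hvn, mul_one,
          Real.norm_of_nonneg hh0.le]
      have := dist_triangle z (x + h • v) x
      linarith
    have hyU : y ∈ U := hball hyρ
    rw [hiff _ (hball (add_smul_sub_mem_ball hyρ hzρ ht))]
    have hyΩ := (hiff _ hyU).1 hy.2
    have hy' : dist y x < r := hy.1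
    have hz' : dist z (x + h • v) < r := hz
    have f1 : dist (e y).fst (e x).fst ≤ r := by
      have := (lipschitzWith_fst e).dist_le_mul y x
      simp only [NNReal.coe_one, one_mul] at this
      linarith
    have f2 : dist (e z).fst (e x).fst ≤ r := by
      have := (lipschitzWith_fst e).dist_le_mul z (x + h • v)
      simp only [NNReal.coe_one, one_mul] at this
      have e0 : (e (x + h • v)).fst = (e x).fst := by simp [hv]
      rw [e0] at this
      linarith
    have s1 : (e y).snd ≤ (e x).snd + r := by
      have := (lipschitzWith_snd e).dist_le_mul y x
      simp only [NNReal.coe_one, one_mul, Real.dist_eq] at this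
      have := (le_abs_self _).trans this
      linarith
    have s2 : (e x).snd + h - r ≤ (e z).snd := by
      have := (lipschitzWith_snd e).dist_le_mul z (x + h • v)
      simp only [NNReal.coe_one, one_mul, Real.dist_eq] at this
      have e0 : (e (x + h • v)).snd = (e x).snd + h := by simp [hv]
      rw [e0] at this
      have := (neg_abs_le _).trans' (neg_le_neg this)
      linarith
    have hd : ‖(e z).fst - (e y).fst‖ ≤ 2 * r := by
      rw [← dist_eq_norm]
      have := dist_triangle_right (e z).fst (e y).fst (e x).fst
      linarith
    have h3 : (e (y + t • (z - y))).fst = (e y).fst + t • ((e z).fst - (e y).fst) := by simp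
    have h4 : (e (y + t • (z - y))).snd = (e y).snd + t * ((e z).snd - (e y).snd) := by simp
    have h5 : γ (e (y + t • (z - y))).fst ≤ γ (e y).fst + K * (t * (2 * r)) := by
      have := hK.dist_le_mul (e (y + t • (z - y))).fst (e y).fst
      rw [h3, dist_eq_norm, dist_eq_norm, add_sub_cancel_left, norm_smul,
        Real.norm_of_nonneg ht.1.le] at this
      have h6 := (le_abs_self _).trans this
      have h7 : (K : ℝ) * (t * ‖(e z).fst - (e y).fst‖) ≤ K * (t * (2 * r)) := by
        have := ht.1.le
        gcongr
      rw [h3]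
      linarith
    rw [h4]
    have h8 : t * (2 * r * K) ≤ t * ((e z).snd - (e y).snd) :=
      mul_le_mul_of_nonneg_left (by linarith) ht.1.le
    have h9 : K * (t * (2 * r)) = t * (2 * r * K) := by ring
    linarith

/-- The Poincaré inequality in a Lipschitz domain. -/
lemma IsLipschitzDomain.exists_poincare_bulk {n : ℕ} {Ω : Set (E (n + 1))}
    (hΩ : IsLipschitzDomain Ω) :
    ∃ C : ℝ≥0∞, C ≠ ⊤ ∧ ∀ (f : E (n + 1) → ℝ) (g : E (n + 1) → E (n + 1)),
      MemLp f 2 (bulkMeasure Ω) → MemLp g 2 (bulkMeasure Ω) → HasWeakGrad Ω f g →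
      eLpNorm (fun x => f x - ⨍ y, f y ∂(bulkMeasure Ω)) 2 (bulkMeasure Ω) ≤
        C * eLpNorm g 2 (bulkMeasure Ω) := by
  have := hΩ.isFiniteMeasure_bulk
  have hΩm := hΩ.isOpen.measurableSet
  have key : PoincareOn (bulkMeasure Ω)
      (fun φ : {φ : E (n + 1) → ℝ // ContDiff ℝ ∞ φ} => (φ : E (n + 1) → ℝ))
      (fun φ => eLpNorm (gradient (φ : E (n + 1) → ℝ)) 2 (bulkMeasure Ω)) Ω := by
    refine poincareOn_of_local (fun φ => φ.2.continuous.aestronglyMeasurable) hΩ.isConnected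
      hΩ.isBounded.isCompact_closure (fun O hO hne => ?_) fun x hx => ?_
    · rw [Measure.restrict_apply (hO.measurableSet.inter hΩm), inter_assoc, inter_self]
      exact ((hO.inter hΩ.isOpen).measure_pos volume hne).ne'
    · obtain ⟨N, hN, hxN, C, hC, h⟩ := hΩ.exists_local_poincare hx
      refine ⟨N, hN, hxN, C, hC, fun φ => ?_⟩
      obtain ⟨a, ha⟩ := h φ φ.2
      exact ⟨a, (eLpNorm_mono_measure _
        (Measure.restrict_mono_measure Measure.restrict_le_self _)).trans ha⟩
  obtain ⟨C, hC, h⟩ := key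
  refine ⟨2 * C, by finiteness, fun f g hf hg hfg => ?_⟩
  refine eLpNorm_sub_average_le_of_approx hΩ.isBounded hC (fun φ hφ => ?_) hf hg
    fun ε hε => hΩ.exists_contDiff_approx hf hg hfg hε
  obtain ⟨a, ha⟩ := h ⟨φ, hφ⟩
  rw [Measure.restrict_restrict hΩm, inter_self] at ha
  exact ⟨a, ha⟩

/-- If the piece of boundary were null, so would be its parameter set in a chart, which is a
non-empty open set. This provides the overlaps of positive measure needed for gluing on Γ. -/
lemma IsLipschitzDomain.surfMeasure_ne_zero {n : ℕ} {Ω : Set (E (n + 1))}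
    (hΩ : IsLipschitzDomain Ω) {O : Set (E (n + 1))} (hO : IsOpen O)
    (hne : (O ∩ frontier Ω).Nonempty) : surfMeasure Ω (O ∩ frontier Ω) ≠ 0 := by
  obtain ⟨x, hxO, hx⟩ := hne
  obtain ⟨U, e, γ, hxU, hc⟩ := hΩ.exists_chart x hx
  intro h0
  have hae : ∀ᵐ z ∂(surfMeasure Ω), z ∉ O := by
    rw [ae_iff]
    rw [Measure.restrict_apply' isClosed_frontier.measurableSet, inter_assoc, inter_self] at h0
    rw [Measure.restrict_apply' isClosed_frontier.measurableSet]
    simpa using h0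
  have h1 := ae_graphDom_of_ae_surf hc hae
  rw [ae_restrict_iff' hc.isOpen_graphDom.measurableSet, ae_iff] at h1
  have hopen : IsOpen (graphDom U e γ ∩ graphMap e γ ⁻¹' O) :=
    hc.isOpen_graphDom.inter (hO.preimage hc.continuous_graphMap)
  have hmap := hc.graphMap_fst hxU hx
  refine (hopen.measure_pos volume ⟨(e x).fst, ?_, ?_⟩).ne' (measure_mono_null ?_ h1)
  · rwa [graphDom, mem_ofPred_eq, hmap]
  · rwa [mem_preimage, hmap]
  · rintro y ⟨hy1, hy2⟩
    simpa using ⟨hy1, hy2⟩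

/-- The function is pulled back to a ball of parameters, where the Euclidean Poincaré inequality
holds. The comparison of surface and Lebesgue measure and the bound for the derivative of the chart
carry it back to Γ. -/
lemma IsLipschitzDomain.exists_local_poincare_surf {n : ℕ} {Ω : Set (E (n + 1))}
    (hΩ : IsLipschitzDomain Ω) {x : E (n + 1)} (hx : x ∈ frontier Ω) :
    ∃ N, IsOpen N ∧ x ∈ N ∧ ∃ C : ℝ≥0∞, C ≠ ⊤ ∧ ∀ (v : E (n + 1) → ℝ)
      (G : E (n + 1) → E (n + 1)), MemLp v 2 (surfMeasure Ω) → MemLp G 2 (surfMeasure Ω) →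
      HasSurfGrad Ω v G → ∃ a : ℝ,
      eLpNorm (fun x => v x - a) 2 ((surfMeasure Ω).restrict N) ≤
        C * eLpNorm G 2 (surfMeasure Ω) := by
  obtain ⟨U, e, γ, hxU, hc⟩ := hΩ.exists_chart x hx
  obtain ⟨hU, ⟨K, hK⟩, hiff⟩ := id hc
  set y₀ := (e x).fst with hy₀
  have hy₀D : y₀ ∈ graphDom U e γ := by
    rwa [graphDom, mem_ofPred_eq, hc.graphMap_fst hxU hx]
  have hDm := hc.isOpen_graphDom.measurableSet
  obtain ⟨ρ, hρ, hball⟩ := Metric.isOpen_iff.1 hc.isOpen_graphDom y₀ hy₀D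
  set r : ℝ := ρ / 2 with hr
  have hr0 : 0 < r := by positivity
  set A := Metric.ball y₀ r with hA
  have hAD : A ⊆ graphDom U e γ := (Metric.ball_subset_ball (by linarith)).trans hball
  obtain ⟨C, hC, hP⟩ := exists_poincare_ball y₀ hr0
  set c : ℝ≥0∞ := ((1 + K : ℝ≥0) : ℝ≥0∞) ^ n with hcdef
  have hct : c ≠ ⊤ := by finiteness
  refine ⟨U ∩ (fun z => (e z).fst) ⁻¹' A,
    hU.inter (Metric.isOpen_ball.preimage (lipschitzWith_fst e).continuous),
    ⟨hxU, Metric.mem_ball_self hr0⟩, c ^ (1 / (2 : ℝ)) * (2 * C * (1 + K : ℝ≥0)), by finiteness,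
    fun v G hv hG hvG => ?_⟩
  set w : E n → ℝ := fun y => v (graphMap e γ y) with hw
  set W : E n → E n := fun y => (fderiv ℝ (graphMap e γ) y).adjoint (G (graphMap e γ y)) with hW
  have hwm : MemLp w 2 (volume.restrict (graphDom U e γ)) :=
    ⟨hv.1.comp_quasiMeasurePreserving hc.quasiMeasurePreserving,
      (hc.eLpNorm_comp_le hv.1).trans_lt hv.2⟩
  have hWm : MemLp W 2 (volume.restrict (graphDom U e γ)) := hc.memLp_pullback hG
  have hAle : volume.restrict A ≤ volume.restrict (graphDom U e γ) :=
    Measure.restrict_mono hAD le_rfl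
  have hgrad := (hvG U e γ hc).1.congr (indicator_ae_eq_restrict hDm).symm
    (indicator_ae_eq_restrict hDm).symm
  have happ : ∀ ε : ℝ≥0∞, 0 < ε → ∃ φ : E n → ℝ, ContDiff ℝ ∞ φ ∧
      eLpNorm (fun x => φ x - w x) 2 (volume.restrict A) ≤ ε ∧
      eLpNorm (fun x => gradient φ x - W x) 2 (volume.restrict A) ≤ ε := by
    intro ε hε
    -- The ball A has half the radius of one contained in the parameter domain, so there is room in
    -- all directions: the cone is the full unit ball, v = 0.
    obtain ⟨φ, hφ, h1, h2⟩ := exists_smooth_approx ((memLp_indicator_iff_restrict hDm).2 hwm)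
      ((memLp_indicator_iff_restrict hDm).2 hWm) hgrad (A := A) measurableSet_ball (v := 0)
      one_pos (by
        have hlt : ∀ᶠ δ : ℝ in 𝓝[>] 0, δ < r :=
          nhdsWithin_le_nhds (eventually_lt_nhds hr0)
        filter_upwards [hlt, self_mem_nhdsWithin] with δ hδ hpos y hy z hz
        have hpos' : (0 : ℝ) < δ := hpos
        apply hball
        rw [mem_closedBall_zero_iff] at hz
        rw [hA, mem_ball_iff_norm] at hy
        rw [mem_ball_iff_norm, add_sub_right_comm]
        refine (norm_add_le _ _).trans_lt ?_
        rw [norm_smul, Real.norm_of_nonneg hpos'.le]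
        nlinarith) hε
    refine ⟨φ, hφ, ?_, ?_⟩
    · refine (eLpNorm_congr_ae ?_).trans_le
        ((eLpNorm_mono_measure _ Measure.restrict_le_self).trans h1)
      filter_upwards [ae_restrict_mem measurableSet_ball] with y hy
      rw [indicator_of_mem (hAD hy)]
    · refine (eLpNorm_congr_ae ?_).trans_le h2
      filter_upwards [ae_restrict_mem measurableSet_ball] with y hy
      rw [indicator_of_mem (hAD hy)]
  have hPA := eLpNorm_sub_average_le_of_approx Metric.isBounded_ball hC hP
    (hwm.mono_measure hAle) (hWm.mono_measure hAle) happ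
  set a : ℝ := ⨍ y in A, w y with ha
  refine ⟨a, ?_⟩
  have hmeas := hc.surfMeasure_restrict_le hK (B := A) (N := U ∩ (fun z => (e z).fst) ⁻¹' A)
    inter_subset_left fun z hz _ => hz.2
  have hmap : Measure.map (graphMap e γ) (volume.restrict A) ≤ surfMeasure Ω :=
    (Measure.map_mono hAle hc.continuous_graphMap.measurable).trans hc.map_graphMap_le
  have hva : AEStronglyMeasurable (fun x => v x - a)
      (Measure.map (graphMap e γ) (volume.restrict A)) :=
    (hv.1.mono_measure hmap).sub aestronglyMeasurable_const
  refine (eLpNorm_mono_measure _ hmeas).trans ?_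
  -- Multiplying the measure by c multiplies the L² norm by c to the power 1/2.
  rw [eLpNorm_smul_measure_of_ne_top (by norm_num), smul_eq_mul,
    eLpNorm_map_measure hva hc.continuous_graphMap.aemeasurable, mul_assoc, mul_assoc]
  have htwo : (1 / 2 : ℝ≥0∞).toReal = 1 / 2 := by simp
  rw [htwo]
  gcongr
  exact hPA.trans (mul_le_mul_right
    ((eLpNorm_mono_measure _ hAle).trans (hc.eLpNorm_pullback_le hK hG.1)) _)

/-- The Poincaré inequality on the boundary of a Lipschitz domain, if it is connected. -/
lemma IsLipschitzDomain.exists_poincare_surf {n : ℕ} {Ω : Set (E (n + 1))}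
    (hΩ : IsLipschitzDomain Ω) (hconn : IsConnected (frontier Ω)) :
    ∃ C : ℝ≥0∞, C ≠ ⊤ ∧ ∀ (v : E (n + 1) → ℝ) (G : E (n + 1) → E (n + 1)),
      MemLp v 2 (surfMeasure Ω) → MemLp G 2 (surfMeasure Ω) → HasSurfGrad Ω v G →
      eLpNorm (fun x => v x - ⨍ y, v y ∂(surfMeasure Ω)) 2 (surfMeasure Ω) ≤
        C * eLpNorm G 2 (surfMeasure Ω) := by
  have := hΩ.isFiniteMeasure_surf
  have key : PoincareOn (surfMeasure Ω)
      (fun p : {p : (E (n + 1) → ℝ) × (E (n + 1) → E (n + 1)) // MemLp p.1 2 (surfMeasure Ω) ∧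
        MemLp p.2 2 (surfMeasure Ω) ∧ HasSurfGrad Ω p.1 p.2} => p.1.1)
      (fun p => eLpNorm p.1.2 2 (surfMeasure Ω)) (frontier Ω) := by
    refine poincareOn_of_local (fun p => p.2.1.1) hconn ?_
      (fun O hO hne => hΩ.surfMeasure_ne_zero hO hne) fun x hx => ?_
    · rw [isClosed_frontier.closure_eq]
      exact hΩ.isCompact_frontier
    · rw [isClosed_frontier.closure_eq] at hx
      obtain ⟨N, hN, hxN, C, hC, h⟩ := hΩ.exists_local_poincare_surf hx
      refine ⟨N, hN, hxN, C, hC, fun p => ?_⟩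
      obtain ⟨a, ha⟩ := h p.1.1 p.1.2 p.2.1 p.2.2.1 p.2.2.2
      exact ⟨a, (eLpNorm_mono_measure _
        (Measure.restrict_mono inter_subset_left le_rfl)).trans ha⟩
  obtain ⟨C, hC, h⟩ := key
  refine ⟨2 * C, by finiteness, fun v G hv hG hvG => ?_⟩
  obtain ⟨a, ha⟩ := h ⟨(v, G), hv, hG, hvG⟩
  rw [Measure.restrict_restrict isClosed_frontier.measurableSet, inter_self] at ha
  refine (eLpNorm_sub_average_le hv a).trans ?_
  rw [mul_assoc]
  gcongr

/-! ### The trace operator -/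

/-- A smooth function on `ℝ^d` as an element of `H¹(Ω)`. -/
def smoothBulk {d : ℕ} {Ω : Set (E d)} (hb : Bornology.IsBounded Ω) {φ : E d → ℝ}
    (hφ : ContDiff ℝ ∞ φ) : bulkH1 Ω :=
  ⟨WithLp.toLp 2 ((memLp_of_continuous_of_isBounded hb hφ.continuous).toLp,
    (memLp_of_continuous_of_isBounded hb (continuous_gradient hφ)).toLp),
    (hasWeakGrad_of_contDiff Ω hφ).congr
      (memLp_of_continuous_of_isBounded hb hφ.continuous).coeFn_toLp.symm
      (memLp_of_continuous_of_isBounded hb (continuous_gradient hφ)).coeFn_toLp.symm⟩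

lemma bulkH1_norm_sq {d : ℕ} {Ω : Set (E d)} (u : bulkH1 Ω) :
    ‖u‖ ^ 2 = ‖u.1.fst‖ ^ 2 + ‖u.1.snd‖ ^ 2 :=
  WithLp.prod_norm_sq_eq_of_L2 u.1

lemma Lp_norm_sq_eq {α F : Type*} [MeasurableSpace α] [NormedAddCommGroup F] {μ : Measure α}
    (f : Lp F 2 μ) : ENNReal.ofReal (‖f‖ ^ 2) = ∫⁻ x, ‖f x‖ₑ ^ 2 ∂μ := by
  rw [← eLpNorm_two_sq, ENNReal.ofReal_pow (norm_nonneg _), ofReal_norm, Lp.enorm_def]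

/-- A closed linear relation with a norm bound and dense domain is everywhere defined. -/
lemma exists_mem_of_isClosed_of_dense {X Y : Type*} [NormedAddCommGroup X] [NormedSpace ℝ X]
    [NormedAddCommGroup Y] [NormedSpace ℝ Y] [CompleteSpace X] [CompleteSpace Y]
    (G : Submodule ℝ (X × Y)) (hG : IsClosed (G : Set (X × Y))) {C : ℝ≥0}
    (hC : ∀ q ∈ G, ‖q.2‖ ≤ C * ‖q.1‖) {D : Set X} (hD : Dense D)
    (hsub : ∀ u ∈ D, ∃ w, (u, w) ∈ G) (u : X) : ∃ w, (u, w) ∈ G := by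
  have hcomp : CompleteSpace G := hG.completeSpace_coe
  let P : G →L[ℝ] X := (ContinuousLinearMap.fst ℝ X Y).comp G.subtypeL
  -- The norm bound makes the projection of the complete space G to X bounded below, so its range is
  -- closed; it contains a dense set, hence it is everything.
  have hP : AntilipschitzWith (max 1 C) P := by
    refine P.antilipschitz_of_bound fun q => ?_
    change max ‖q.1.1‖ ‖q.1.2‖ ≤ (max 1 C : ℝ≥0) * ‖q.1.1‖
    rw [NNReal.coe_max, max_le_iff]
    constructor
    · exact le_mul_of_one_le_left (norm_nonneg _) (le_max_left _ _)
    · refine (hC q q.2).trans ?_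
      gcongr
      exact le_max_right _ _
  have hrange : IsClosed (range P) := hP.isClosed_range P.uniformContinuous
  have hDP : D ⊆ range P := fun u hu => by
    obtain ⟨w, hw⟩ := hsub u hu
    exact ⟨⟨_, hw⟩, rfl⟩
  have huniv : closure (range P) = univ := (hD.mono hDP).closure_eq
  rw [hrange.closure_eq] at huniv
  obtain ⟨q, hq⟩ : u ∈ range P := huniv ▸ mem_univ u
  exact ⟨q.1.2, hq ▸ q.2⟩

section Trace

variable {n : ℕ} {Ω : Set (E (n + 1))}

/-- The inequality is a closed condition, so it suffices to check it on smooth functions, where it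
is the trace inequality. -/
lemma IsLipschitzDomain.exists_traceGraph_bound (hΩ : IsLipschitzDomain Ω) :
    ∃ C : ℝ≥0, ∀ q ∈ traceGraph Ω, ‖q.2‖ ≤ C * ‖q.1‖ := by
  obtain ⟨C, hC, h⟩ := hΩ.exists_trace_bound
  refine ⟨NNReal.sqrt C.toNNReal, fun q hq => ?_⟩
  have hclosed : IsClosed {q : bulkH1 Ω × Lp ℝ 2 (surfMeasure Ω) |
      ‖q.2‖ ≤ NNReal.sqrt C.toNNReal * ‖q.1‖} :=
    isClosed_le continuous_snd.norm (continuous_const.mul continuous_fst.norm)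
  suffices hsub : (smoothTraceGraph Ω : Set (bulkH1 Ω × Lp ℝ 2 (surfMeasure Ω))) ⊆
      {q | ‖q.2‖ ≤ NNReal.sqrt C.toNNReal * ‖q.1‖} from closure_minimal hsub hclosed hq
  clear hq q
  intro q hq
  obtain ⟨φ, hφ, h1, h2⟩ := hq
  have h3 : q.1.1.snd =ᵐ[bulkMeasure Ω] gradient φ :=
    HasWeakGrad.unique hΩ.isOpen (HasWeakGrad.congr q.1.2 h1 (EventuallyEq.refl _ _))
      (hasWeakGrad_of_contDiff Ω hφ)
  have key := h φ hφ
  have e1 : ∫⁻ z, ‖φ z‖ₑ ^ 2 ∂(surfMeasure Ω) = ENNReal.ofReal (‖q.2‖ ^ 2) := by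
    rw [Lp_norm_sq_eq]
    exact lintegral_congr_ae (h2.symm.fun_comp fun t => ‖t‖ₑ ^ 2)
  have e2 : ∫⁻ z in Ω, ‖φ z‖ₑ ^ 2 = ENNReal.ofReal (‖q.1.1.fst‖ ^ 2) := by
    rw [Lp_norm_sq_eq]
    exact lintegral_congr_ae (h1.symm.fun_comp fun t => ‖t‖ₑ ^ 2)
  have e3 : ∫⁻ z in Ω, ‖gradient φ z‖ₑ ^ 2 = ENNReal.ofReal (‖q.1.1.snd‖ ^ 2) := by
    rw [Lp_norm_sq_eq]
    exact lintegral_congr_ae (h3.symm.fun_comp fun t => ‖t‖ₑ ^ 2)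
  rw [e1, e2, e3, ← ENNReal.ofReal_add (by positivity) (by positivity), ← bulkH1_norm_sq,
    ← ENNReal.ofReal_toReal hC, ← ENNReal.ofReal_mul ENNReal.toReal_nonneg,
    ENNReal.ofReal_le_ofReal_iff (by positivity)] at key
  refine (pow_le_pow_iff_left₀ (norm_nonneg _) (by positivity) two_ne_zero).1 ?_
  rw [mul_pow, ← NNReal.coe_pow, NNReal.sq_sqrt]
  exact key

lemma IsLipschitzDomain.dense_smoothBulk (hΩ : IsLipschitzDomain Ω) :
    Dense {u : bulkH1 Ω | ∃ (φ : E (n + 1) → ℝ) (hφ : ContDiff ℝ ∞ φ),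
      u = smoothBulk hΩ.isBounded hφ} := by
  refine Metric.dense_iff.2 fun u r hr => ?_
  -- Two components with error ε each give a squared distance of at most r²/2.
  set ε : ℝ := r / 2 with hε
  obtain ⟨φ, hφ, h1, h2⟩ := hΩ.exists_contDiff_approx (Lp.memLp u.1.fst) (Lp.memLp u.1.snd) u.2
    (ε := ENNReal.ofReal ε) (by simp [hε, hr])
  have hε0 : 0 ≤ ε := by positivity
  refine ⟨smoothBulk hΩ.isBounded hφ, ?_, φ, hφ, rfl⟩
  have d1 : ‖(smoothBulk hΩ.isBounded hφ - u).1.fst‖ ≤ ε := by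
    rw [Lp.norm_def, ← ENNReal.ofReal_le_ofReal_iff hε0, ENNReal.ofReal_toReal
      (Lp.eLpNorm_ne_top _)]
    refine le_trans (le_of_eq (eLpNorm_congr_ae ?_)) h1
    refine (Lp.coeFn_sub (smoothBulk hΩ.isBounded hφ).1.fst u.1.fst).trans ?_
    filter_upwards [(memLp_of_continuous_of_isBounded hΩ.isBounded hφ.continuous).coeFn_toLp]
      with x hx
    rw [Pi.sub_apply, ← hx]
    rfl
  have d2 : ‖(smoothBulk hΩ.isBounded hφ - u).1.snd‖ ≤ ε := by
    rw [Lp.norm_def, ← ENNReal.ofReal_le_ofReal_iff hε0, ENNReal.ofReal_toReal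
      (Lp.eLpNorm_ne_top _)]
    refine le_trans (le_of_eq (eLpNorm_congr_ae ?_)) h2
    refine (Lp.coeFn_sub (smoothBulk hΩ.isBounded hφ).1.snd u.1.snd).trans ?_
    filter_upwards [(memLp_of_continuous_of_isBounded hΩ.isBounded
      (continuous_gradient hφ)).coeFn_toLp] with x hx
    rw [Pi.sub_apply, ← hx]
    rfl
  rw [mem_ball_iff_norm]
  refine abs_lt_of_sq_lt_sq' ?_ hr.le |>.2
  rw [bulkH1_norm_sq]
  have := pow_le_pow_left₀ (norm_nonneg _) d1 2
  have := pow_le_pow_left₀ (norm_nonneg _) d2 2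
  have : ε ^ 2 + ε ^ 2 < r ^ 2 := by
    rw [hε]
    nlinarith
  linarith

lemma smoothBulk_mem_traceGraph (hΩ : IsLipschitzDomain Ω) {φ : E (n + 1) → ℝ}
    (hφ : ContDiff ℝ ∞ φ) : ∃ w, (smoothBulk hΩ.isBounded hφ, w) ∈ traceGraph Ω := by
  obtain ⟨C, hC⟩ := hΩ.isCompact_frontier.exists_bound_of_continuousOn hφ.continuous.continuousOn
  have := hΩ.isFiniteMeasure_surf
  have hm : MemLp φ 2 (surfMeasure Ω) :=
    MemLp.of_bound hφ.continuous.aestronglyMeasurable C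
      ((ae_restrict_iff' isClosed_frontier.measurableSet).2 (Eventually.of_forall hC))
  exact ⟨hm.toLp, Submodule.le_topologicalClosure _
    ⟨φ, hφ, (memLp_of_continuous_of_isBounded hΩ.isBounded hφ.continuous).coeFn_toLp,
      hm.coeFn_toLp⟩⟩

lemma IsLipschitzDomain.exists_mem_traceGraph (hΩ : IsLipschitzDomain Ω) (u : bulkH1 Ω) :
    ∃ w, (u, w) ∈ traceGraph Ω := by
  obtain ⟨C, hC⟩ := hΩ.exists_traceGraph_bound
  refine exists_mem_of_isClosed_of_dense (traceGraph Ω)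
    (Submodule.isClosed_topologicalClosure (smoothTraceGraph Ω)) hC hΩ.dense_smoothBulk ?_ u
  rintro _ ⟨φ, hφ, rfl⟩
  exact smoothBulk_mem_traceGraph hΩ hφ

/-- By the norm bound, (0, w) in the trace graph forces w = 0. With existence this makes the choice
in `trace` canonical, and linearity follows from that of the graph. -/
lemma IsLipschitzDomain.traceGraph_unique (hΩ : IsLipschitzDomain Ω) {u : bulkH1 Ω}
    {w w' : Lp ℝ 2 (surfMeasure Ω)} (h : (u, w) ∈ traceGraph Ω) (h' : (u, w') ∈ traceGraph Ω) :
    w = w' := by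
  obtain ⟨C, hC⟩ := hΩ.exists_traceGraph_bound
  have := hC _ ((traceGraph Ω).sub_mem h h')
  simp only [Prod.mk_sub_mk, sub_self, norm_zero, mul_zero, norm_le_zero_iff] at this
  exact sub_eq_zero.1 this

lemma IsLipschitzDomain.trace_mem (hΩ : IsLipschitzDomain Ω) (u : bulkH1 Ω) :
    (u, trace u) ∈ traceGraph Ω := by
  have h := hΩ.exists_mem_traceGraph u
  rw [trace, dif_pos h]
  exact h.choose_spec

lemma IsLipschitzDomain.trace_add (hΩ : IsLipschitzDomain Ω) (u u' : bulkH1 Ω) :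
    trace (u + u') = trace u + trace u' :=
  hΩ.traceGraph_unique (hΩ.trace_mem _)
    ((traceGraph Ω).add_mem (hΩ.trace_mem u) (hΩ.trace_mem u'))

lemma IsLipschitzDomain.trace_smul (hΩ : IsLipschitzDomain Ω) (c : ℝ) (u : bulkH1 Ω) :
    trace (c • u) = c • trace u :=
  hΩ.traceGraph_unique (hΩ.trace_mem _) ((traceGraph Ω).smul_mem c (hΩ.trace_mem u))

lemma IsLipschitzDomain.exists_norm_trace_le (hΩ : IsLipschitzDomain Ω) :
    ∃ C : ℝ, 0 ≤ C ∧ ∀ u : bulkH1 Ω, ‖trace u‖ ≤ C * ‖u‖ := by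
  obtain ⟨C, hC⟩ := hΩ.exists_traceGraph_bound
  exact ⟨C, C.2, fun u => hC (u, trace u) (hΩ.trace_mem u)⟩

/-- The trace operator as a linear map. -/
def traceLM (hΩ : IsLipschitzDomain Ω) : bulkH1 Ω →ₗ[ℝ] Lp ℝ 2 (surfMeasure Ω) where
  toFun := trace
  map_add' := hΩ.trace_add
  map_smul' := hΩ.trace_smul

/-- The trace operator as a continuous linear map. -/
lemma IsLipschitzDomain.exists_traceCLM (hΩ : IsLipschitzDomain Ω) :
    ∃ T : bulkH1 Ω →L[ℝ] Lp ℝ 2 (surfMeasure Ω), ∀ u, T u = trace u := by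
  obtain ⟨C, -, hC⟩ := hΩ.exists_norm_trace_le
  exact ⟨(traceLM hΩ).mkContinuous C hC, fun u => rfl⟩

end Trace

/-! ### The bilinear form of the system -/

/-- Multiplication by a bounded measurable coefficient is bounded on L²; it turns the weighted
integrals of the form into inner products. -/
lemma exists_mulCLM {α F : Type*} [MeasurableSpace α] {μ : Measure α} [NormedAddCommGroup F]
    [NormedSpace ℝ F] {c : α → ℝ} (hc : AEStronglyMeasurable c μ) {M : ℝ}
    (hM : ∀ᵐ x ∂μ, |c x| ≤ M) :
    ∃ T : Lp F 2 μ →L[ℝ] Lp F 2 μ, ∀ f, T f =ᵐ[μ] fun x => c x • f x := by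
  have hle : ∀ f : Lp F 2 μ, ∀ᵐ x ∂μ, ‖c x • f x‖ ≤ M * ‖f x‖ := fun f => by
    filter_upwards [hM] with x hx
    rw [norm_smul]
    exact mul_le_mul_of_nonneg_right hx (norm_nonneg _)
  have hmem : ∀ f : Lp F 2 μ, MemLp (fun x => c x • f x) 2 μ := fun f =>
    (Lp.memLp f).of_le_mul (hc.smul (Lp.aestronglyMeasurable f)) (hle f)
  let T : Lp F 2 μ →ₗ[ℝ] Lp F 2 μ :=
    { toFun := fun f => (hmem f).toLp
      map_add' := fun f g => by
        rw [← MemLp.toLp_add, MemLp.toLp_eq_toLp_iff]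
        filter_upwards [Lp.coeFn_add f g] with x hx
        rw [hx, Pi.add_apply, Pi.add_apply, smul_add]
      map_smul' := fun r f => by
        rw [RingHom.id_apply, ← MemLp.toLp_const_smul, MemLp.toLp_eq_toLp_iff]
        filter_upwards [Lp.coeFn_smul r f] with x hx
        rw [hx, Pi.smul_apply, Pi.smul_apply, smul_comm] }
  refine ⟨T.mkContinuous M fun f => Lp.norm_le_mul_norm_of_ae_le_mul ?_, fun f =>
    (hmem f).coeFn_toLp⟩
  filter_upwards [hle f, (hmem f).coeFn_toLp] with x hx hx'
  have : (T f : α → F) x = c x • f x := hx'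
  rwa [this]

lemma exists_weighted_inner {α F : Type*} [MeasurableSpace α] {μ : Measure α}
    [NormedAddCommGroup F] [InnerProductSpace ℝ F] {c : α → ℝ} (hc : AEStronglyMeasurable c μ)
    {M : ℝ} (hM : ∀ᵐ x ∂μ, |c x| ≤ M) :
    ∃ B : Lp F 2 μ →L[ℝ] Lp F 2 μ →L[ℝ] ℝ, ∀ f g, B f g = ∫ x, c x * inner ℝ (f x) (g x) ∂μ := by
  obtain ⟨T, hT⟩ := exists_mulCLM (F := F) hc hM
  refine ⟨(innerSL ℝ).bilinearComp T (ContinuousLinearMap.id ℝ _), fun f g => ?_⟩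
  rw [ContinuousLinearMap.bilinearComp_apply, innerSL_apply_apply, L2.inner_def]
  refine integral_congr_ae ?_
  filter_upwards [hT f] with x hx
  rw [hx, real_inner_smul_left]
  rfl

section Form

variable {n : ℕ} {Ω : Set (E (n + 1))}

/-- The first component `u ∈ H¹(Ω)` of `(u, v) ∈ ℋ¹`. -/
def fstCLM (Ω : Set (E (n + 1))) : H1 Ω →L[ℝ] bulkH1 Ω :=
  WithLp.fstL 2 ℝ (bulkH1 Ω) (surfH1 Ω)

lemma fstCLM_apply (p : H1 Ω) : fstCLM Ω p = p.fst := rfl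

/-- The component maps of `ℋ¹` as continuous linear maps. -/
def bulkCLM (Ω : Set (E (n + 1))) : H1 Ω →L[ℝ] Lp ℝ 2 (bulkMeasure Ω) :=
  (WithLp.fstL 2 ℝ (Lp ℝ 2 (bulkMeasure Ω)) (Lp (E (n + 1)) 2 (bulkMeasure Ω))).comp
    ((bulkH1 Ω).subtypeL.comp (WithLp.fstL 2 ℝ (bulkH1 Ω) (surfH1 Ω)))

/-- The gradient of the first component. -/
def bulkGradCLM (Ω : Set (E (n + 1))) : H1 Ω →L[ℝ] Lp (E (n + 1)) 2 (bulkMeasure Ω) :=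
  (WithLp.sndL 2 ℝ (Lp ℝ 2 (bulkMeasure Ω)) (Lp (E (n + 1)) 2 (bulkMeasure Ω))).comp
    ((bulkH1 Ω).subtypeL.comp (WithLp.fstL 2 ℝ (bulkH1 Ω) (surfH1 Ω)))

/-- The second component. -/
def surfCLM (Ω : Set (E (n + 1))) : H1 Ω →L[ℝ] Lp ℝ 2 (surfMeasure Ω) :=
  (WithLp.fstL 2 ℝ (Lp ℝ 2 (surfMeasure Ω)) (Lp (E (n + 1)) 2 (surfMeasure Ω))).comp
    ((surfH1 Ω).subtypeL.comp (WithLp.sndL 2 ℝ (bulkH1 Ω) (surfH1 Ω)))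

/-- The surface gradient of the second component. -/
def surfGradCLM (Ω : Set (E (n + 1))) : H1 Ω →L[ℝ] Lp (E (n + 1)) 2 (surfMeasure Ω) :=
  (WithLp.sndL 2 ℝ (Lp ℝ 2 (surfMeasure Ω)) (Lp (E (n + 1)) 2 (surfMeasure Ω))).comp
    ((surfH1 Ω).subtypeL.comp (WithLp.sndL 2 ℝ (bulkH1 Ω) (surfH1 Ω)))

lemma surfCLM_apply (p : H1 Ω) : surfCLM Ω p = p.surf := rfl

lemma H1.norm_sq_eq (p : H1 Ω) :
    ‖p‖ ^ 2 = ‖p.bulk‖ ^ 2 + ‖p.bulkGrad‖ ^ 2 + (‖p.surf‖ ^ 2 + ‖p.surfGrad‖ ^ 2) := by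
  rw [WithLp.prod_norm_sq_eq_of_L2, bulkH1_norm_sq]
  congr 1
  exact WithLp.prod_norm_sq_eq_of_L2 p.snd.1

/-- The jump `β v - u|_Γ`. -/
def jump (β : ℝ) (p : H1 Ω) : Lp ℝ 2 (surfMeasure Ω) := β • p.surf - trace p.fst

lemma IsLipschitzDomain.exists_jumpCLM (hΩ : IsLipschitzDomain Ω) (β : ℝ) :
    ∃ J : H1 Ω →L[ℝ] Lp ℝ 2 (surfMeasure Ω), ∀ p, J p = jump β p := by
  obtain ⟨T, hT⟩ := hΩ.exists_traceCLM
  refine ⟨β • surfCLM Ω - T.comp (fstCLM Ω), fun p => ?_⟩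
  have h : β • surfCLM Ω p - T (fstCLM Ω p) = jump β p := by
    rw [surfCLM_apply, fstCLM_apply, hT]
    rfl
  rw [sub_apply, smul_apply]
  exact h

lemma coeFn_jump (β : ℝ) (p : H1 Ω) :
    jump β p =ᵐ[surfMeasure Ω] fun x => β * p.surf x - trace p.fst x := by
  filter_upwards [Lp.coeFn_sub (β • p.surf) (trace p.fst), Lp.coeFn_smul β p.surf] with x h1 h2
  rw [jump, h1, Pi.sub_apply, h2, Pi.smul_apply, smul_eq_mul]

lemma real_inner_eq_mul (x y : ℝ) : inner ℝ x y = x * y := by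
  simp [mul_comm]

lemma integral_jump_mul_jump (β : ℝ) (p q : H1 Ω) :
    ∫ x, (β * p.surf x - trace p.fst x) * (β * q.surf x - trace q.fst x) ∂(surfMeasure Ω) =
      inner ℝ (jump β p) (jump β q) := by
  rw [L2.inner_def]
  refine integral_congr_ae ?_
  filter_upwards [coeFn_jump β p, coeFn_jump β q] with x h1 h2
  rw [h1, h2, real_inner_eq_mul]

end Form

section Form

variable {n : ℕ} {Ω : Set (E (n + 1))}

lemma isBoundedBilinearMap_of_eq_sum {X Y₁ Y₂ Y₃ : Type*} [NormedAddCommGroup X]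
    [NormedSpace ℝ X] [NormedAddCommGroup Y₁] [NormedSpace ℝ Y₁] [NormedAddCommGroup Y₂]
    [NormedSpace ℝ Y₂] [NormedAddCommGroup Y₃] [InnerProductSpace ℝ Y₃]
    (B₁ : Y₁ →L[ℝ] Y₁ →L[ℝ] ℝ) (B₂ : Y₂ →L[ℝ] Y₂ →L[ℝ] ℝ) (T₁ : X →L[ℝ] Y₁) (T₂ : X →L[ℝ] Y₂)
    (T₃ : X →L[ℝ] Y₃) (c : ℝ) (f : X → X → ℝ)
    (hf : ∀ p q, f p q = B₁ (T₁ p) (T₁ q) + B₂ (T₂ p) (T₂ q) + c * inner ℝ (T₃ p) (T₃ q)) :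
    IsBoundedBilinearMap ℝ fun p : X × X => f p.1 p.2 := by
  let B₃ : X →L[ℝ] X →L[ℝ] ℝ := (innerSL ℝ).bilinearComp T₃ T₃
  have h : (fun p : X × X => f p.1 p.2) = fun p => (B₁.bilinearComp T₁ T₁ +
      B₂.bilinearComp T₂ T₂ + c • B₃) p.1 p.2 := by
    funext p
    rw [hf]
    rfl
  rw [h]
  exact ContinuousLinearMap.isBoundedBilinearMap _

lemma form_eq (L : ℝ≥0∞) (β : ℝ) (a b : E (n + 1) → ℝ) (p q : H1 Ω) : form L β a b p q =
    ∫ x, a x * inner ℝ (p.bulkGrad x) (q.bulkGrad x) ∂(bulkMeasure Ω) +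
      ∫ x, b x * inner ℝ (p.surfGrad x) (q.surfGrad x) ∂(surfMeasure Ω) +
      chi L * inner ℝ (jump β p) (jump β q) := by
  rw [form, integral_jump_mul_jump]

lemma IsLipschitzDomain.isBoundedBilinearMap_form (hΩ : IsLipschitzDomain Ω) (L : ℝ≥0∞) (β : ℝ)
    {a b : E (n + 1) → ℝ} {M : ℝ} (ha : AEStronglyMeasurable a (bulkMeasure Ω))
    (haM : ∀ᵐ x ∂(bulkMeasure Ω), |a x| ≤ M) (hb : AEStronglyMeasurable b (surfMeasure Ω))
    (hbM : ∀ᵐ x ∂(surfMeasure Ω), |b x| ≤ M) :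
    IsBoundedBilinearMap ℝ fun p : H1 Ω × H1 Ω => form L β a b p.1 p.2 := by
  obtain ⟨B₁, h₁⟩ := exists_weighted_inner (F := E (n + 1)) ha haM
  obtain ⟨B₂, h₂⟩ := exists_weighted_inner (F := E (n + 1)) hb hbM
  obtain ⟨J, hJ⟩ := hΩ.exists_jumpCLM β
  have hf : ∀ p q : H1 Ω, form L β a b p q = B₁ (bulkGradCLM Ω p) (bulkGradCLM Ω q) +
      B₂ (surfGradCLM Ω p) (surfGradCLM Ω q) + chi L * inner ℝ (J p) (J q) := fun p q => by
    have e₁ := h₁ p.bulkGrad q.bulkGrad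
    have e₂ := h₂ p.surfGrad q.surfGrad
    exact (form_eq L β a b p q).trans (congrArg₂ (· + ·) (congrArg₂ (· + ·) e₁.symm e₂.symm)
      (congrArg₂ (fun s t => chi L * inner ℝ s t) (hJ p).symm (hJ q).symm))
  exact isBoundedBilinearMap_of_eq_sum B₁ B₂ (bulkGradCLM Ω) (surfGradCLM Ω) J (chi L) _ hf

lemma chi_nonneg (L : ℝ≥0∞) : 0 ≤ chi L := by
  unfold chi
  split_ifs
  · exact le_rfl
  · exact inv_nonneg.2 ENNReal.toReal_nonneg

lemma form_one_self (L : ℝ≥0∞) (β : ℝ) (p : H1 Ω) :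
    form L β (fun _ => 1) (fun _ => 1) p p =
      ‖p.bulkGrad‖ ^ 2 + ‖p.surfGrad‖ ^ 2 + chi L * ‖jump β p‖ ^ 2 := by
  simp only [form, one_mul]
  rw [integral_jump_mul_jump, real_inner_self_eq_norm_sq, ← L2.inner_def, ← L2.inner_def,
    real_inner_self_eq_norm_sq, real_inner_self_eq_norm_sq]

lemma normL_sq (L : ℝ≥0∞) (β : ℝ) (p : H1 Ω) : normL L β p ^ 2 =
    ‖p.bulkGrad‖ ^ 2 + ‖p.surfGrad‖ ^ 2 + chi L * ‖jump β p‖ ^ 2 := by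
  have := chi_nonneg L
  rw [normL, form_one_self, Real.sq_sqrt (by positivity)]

lemma normL_nonneg (L : ℝ≥0∞) (β : ℝ) (p : H1 Ω) : 0 ≤ normL L β p := Real.sqrt_nonneg _

lemma le_integral_weighted {α F : Type*} [MeasurableSpace α] {μ : Measure α}
    [NormedAddCommGroup F] [InnerProductSpace ℝ F] {c : α → ℝ} (hc : AEStronglyMeasurable c μ)
    {m M : ℝ} (hm : ∀ᵐ x ∂μ, m ≤ c x) (hM : ∀ᵐ x ∂μ, |c x| ≤ M) (f : Lp F 2 μ) :
    m * ‖f‖ ^ 2 ≤ ∫ x, c x * inner ℝ (f x) (f x) ∂μ := by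
  rw [← real_inner_self_eq_norm_sq, L2.inner_def, ← integral_const_mul]
  have hint : Integrable (fun x => inner ℝ (f x) (f x)) μ := L2.integrable_inner (𝕜 := ℝ) f f
  refine integral_mono_ae (hint.const_mul m) (hint.bdd_mul hc (c := M) hM) ?_
  filter_upwards [hm] with x hx
  exact mul_le_mul_of_nonneg_right hx real_inner_self_nonneg

/-- The gradient terms carry the factor m and the jump term the factor 1, whence min(1, m). -/
lemma mul_normL_sq_le_form (L : ℝ≥0∞) (β : ℝ) {a b : E (n + 1) → ℝ} {m M : ℝ}
    (ha : AEStronglyMeasurable a (bulkMeasure Ω)) (ham : ∀ᵐ x ∂(bulkMeasure Ω), m ≤ a x)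
    (haM : ∀ᵐ x ∂(bulkMeasure Ω), |a x| ≤ M) (hb : AEStronglyMeasurable b (surfMeasure Ω))
    (hbm : ∀ᵐ x ∂(surfMeasure Ω), m ≤ b x) (hbM : ∀ᵐ x ∂(surfMeasure Ω), |b x| ≤ M) (p : H1 Ω) :
    min 1 m * normL L β p ^ 2 ≤ form L β a b p p := by
  rw [normL_sq, form, integral_jump_mul_jump, real_inner_self_eq_norm_sq]
  have h1 := le_integral_weighted ha ham haM p.bulkGrad
  have h2 := le_integral_weighted hb hbm hbM p.surfGrad
  have h3 : min 1 m * ‖p.bulkGrad‖ ^ 2 ≤ m * ‖p.bulkGrad‖ ^ 2 := by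
    gcongr
    exact min_le_right _ _
  have h4 : min 1 m * ‖p.surfGrad‖ ^ 2 ≤ m * ‖p.surfGrad‖ ^ 2 := by
    gcongr
    exact min_le_right _ _
  have h5 : min 1 m * (chi L * ‖jump β p‖ ^ 2) ≤ chi L * ‖jump β p‖ ^ 2 :=
    mul_le_of_le_one_left (mul_nonneg (chi_nonneg L) (sq_nonneg _)) (min_le_left _ _)
  linarith

end Form

/-! ### Variational problems with a finite-dimensional kernel -/

section AbstractProblem

/-- The Lax–Milgram theorem. -/
lemma _root_.IsCoercive.exists_forall_eq {V : Type*} [NormedAddCommGroup V]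
    [InnerProductSpace ℝ V] [CompleteSpace V] {B : V →L[ℝ] V →L[ℝ] ℝ} (hB : IsCoercive B)
    (F : StrongDual ℝ V) : ∃ p, ∀ q, B p q = F q := by
  refine ⟨hB.continuousLinearEquivOfBilin.symm ((InnerProductSpace.toDual ℝ V).symm F),
    fun q => ?_⟩
  rw [← hB.continuousLinearEquivOfBilin_apply, ContinuousLinearEquiv.apply_symm_apply,
    InnerProductSpace.toDual_symm_apply]

lemma _root_.IsBoundedBilinearMap.comp_subtype {X : Type*} [NormedAddCommGroup X]
    [NormedSpace ℝ X] {f : X → X → ℝ} (hf : IsBoundedBilinearMap ℝ fun p : X × X => f p.1 p.2)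
    (W : Submodule ℝ X) : IsBoundedBilinearMap ℝ fun p : W × W => f p.1 p.2 :=
  (hf.toContinuousLinearMap.bilinearComp W.subtypeL W.subtypeL).isBoundedBilinearMap

variable {X R : Type*} [NormedAddCommGroup X] [InnerProductSpace ℝ X] [NormedAddCommGroup R]
  [NormedSpace ℝ R] {f : X → X → ℝ}

lemma span_annihilates (hf : IsBoundedBilinearMap ℝ fun p : X × X => f p.1 p.2) {S : Set X}
    (hS : ∀ m ∈ S, ∀ q, f m q = 0 ∧ f q m = 0) {m : X} (hm : m ∈ Submodule.span ℝ S) (q : X) :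
    f m q = 0 ∧ f q m = 0 := by
  induction hm using Submodule.span_induction with
  | mem m hm => exact hS m hm q
  | zero => simpa using And.intro (hf.smul_left 0 0 q) (hf.smul_right 0 q 0)
  | add m m' _ _ h h' =>
    have e1 : f (m + m') q = f m q + f m' q := hf.add_left m m' q
    have e2 : f q (m + m') = f q m + f q m' := hf.add_right q m m'
    rw [e1, e2, h.1, h.2, h'.1, h'.2]
    simp
  | smul c m _ h =>
    have e1 : f (c • m) q = c • f m q := hf.smul_left c m q
    have e2 : f q (c • m) = c • f q m := hf.smul_right c q m
    rw [e1, e2, h.1, h.2]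
    simp

lemma apply_eq_zero_of_mem_span (F : StrongDual ℝ X) {S : Set X} (hF : ∀ m ∈ S, F m = 0) {m : X}
    (hm : m ∈ Submodule.span ℝ S) : F m = 0 := by
  have : Submodule.span ℝ S ≤ LinearMap.ker F.toLinearMap :=
    Submodule.span_le.2 fun m hm => hF m hm
  exact this hm

lemma exists_variational_of_coercive_on (V : Submodule ℝ X) [CompleteSpace V]
    (hf : IsBoundedBilinearMap ℝ fun p : X × X => f p.1 p.2) {c : ℝ} (hc : 0 < c)
    (hcoer : ∀ p ∈ V, c * ‖p‖ ^ 2 ≤ f p p) (F : StrongDual ℝ X) :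
    ∃ p ∈ V, ∀ q ∈ V, f p q = F q := by
  let B : V →L[ℝ] V →L[ℝ] ℝ := (hf.comp_subtype V).toContinuousLinearMap
  have hBc : IsCoercive B := by
    refine ⟨c, hc, fun p => ?_⟩
    have h := hcoer p p.2
    rwa [sq, ← mul_assoc] at h
  obtain ⟨p, hp⟩ := hBc.exists_forall_eq (F.comp V.subtypeL)
  exact ⟨p, p.2, fun q hq => hp ⟨q, hq⟩⟩

/-- Unique solvability of a variational problem whose form vanishes on the span of `S` and is
coercive on the kernel of `ℓ`. -/
lemma existsUnique_variational [CompleteSpace X]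
    (hf : IsBoundedBilinearMap ℝ fun p : X × X => f p.1 p.2) (ℓ : X →L[ℝ] R) {S : Set X}
    (hS : ∀ m ∈ S, ∀ q, f m q = 0 ∧ f q m = 0)
    (hdec : ∀ p, ∃ m ∈ Submodule.span ℝ S, ℓ p = ℓ m) {c : ℝ} (hc : 0 < c)
    (hcoer : ∀ p, ℓ p = 0 → c * ‖p‖ ^ 2 ≤ f p p) (F : StrongDual ℝ X)
    (hF : ∀ m ∈ S, F m = 0) : ∃! p, ℓ p = 0 ∧ ∀ q, f p q = F q := by
  have hcomp : CompleteSpace (LinearMap.ker ℓ.toLinearMap) := ℓ.isClosed_ker.completeSpace_coe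
  obtain ⟨p₀, hp₀, h⟩ := exists_variational_of_coercive_on (LinearMap.ker ℓ.toLinearMap) hf hc
    hcoer F
  refine ⟨p₀, ⟨hp₀, fun q => ?_⟩, fun p hp => ?_⟩
  -- Any test element differs from one in the kernel of ℓ by an element of the span of S, on which
  -- both the form and F vanish.
  · obtain ⟨m, hm, hq⟩ := hdec q
    have h3 : f p₀ (q - m) = F (q - m) := h _ (by
      change ℓ (q - m) = 0
      rw [map_sub, hq, sub_self])
    have h2 : f p₀ (q - m) = f p₀ q - f p₀ m := hf.map_sub_right
    rwa [h2, map_sub, (span_annihilates hf hS hm p₀).2, apply_eq_zero_of_mem_span F hF hm,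
      sub_zero, sub_zero] at h3
  -- The difference of two solutions lies in the kernel of ℓ, hence is itself a test element, and
  -- coercivity makes it vanish.
  · have hd : ℓ (p - p₀) = 0 := by
      rw [map_sub, hp.1, sub_eq_zero]
      exact hp₀.symm
    have h1 := hcoer (p - p₀) hd
    have h2 : f (p - p₀) (p - p₀) = f p (p - p₀) - f p₀ (p - p₀) := hf.map_sub_left
    rw [h2, hp.2, h _ hd, sub_self] at h1
    have h4 : ‖p - p₀‖ ^ 2 ≤ 0 := nonpos_of_mul_nonpos_right h1 hc
    exact sub_eq_zero.1 (norm_eq_zero.1 (pow_eq_zero_iff two_ne_zero |>.1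
      (le_antisymm h4 (sq_nonneg _))))

lemma apply_sub_sub_of_mem_span (hf : IsBoundedBilinearMap ℝ fun p : X × X => f p.1 p.2)
    {S : Set X} (hS : ∀ m ∈ S, ∀ q, f m q = 0 ∧ f q m = 0) {m : X}
    (hm : m ∈ Submodule.span ℝ S) (p : X) : f (p - m) (p - m) = f p p := by
  have h1 : f (p - m) (p - m) = f p (p - m) - f m (p - m) := hf.map_sub_left
  have h2 : f p (p - m) = f p p - f p m := hf.map_sub_right
  rw [h1, h2, (span_annihilates hf hS hm p).2, (span_annihilates hf hS hm (p - m)).1]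
  simp

/-- The a priori estimate for the variational problem in terms of a seminorm `√(g p p)`. -/
lemma variational_estimate {g : X → X → ℝ}
    (hg : IsBoundedBilinearMap ℝ fun p : X × X => g p.1 p.2) (ℓ : X →L[ℝ] R) {S : Set X}
    (hS : ∀ m ∈ S, ∀ q, g m q = 0 ∧ g q m = 0)
    (hdec : ∀ p, ∃ m ∈ Submodule.span ℝ S, ℓ p = ℓ m) {c K : ℝ} (hc : 0 < c) (hK : 0 ≤ K)
    (hg0 : ∀ p, 0 ≤ g p p) (hgf : ∀ p, c * g p p ≤ f p p)
    (hpoi : ∀ p, ℓ p = 0 → ‖p‖ ≤ K * √(g p p)) (F : StrongDual ℝ X)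
    (hF : ∀ m ∈ S, F m = 0) {p : X} (hp : ∀ q, f p q = F q) :
    √(g p p) ≤ K / c * ‖F‖ := by
  -- A solution need not satisfy ℓ p = 0. Subtracting m achieves this while changing neither the
  -- seminorm nor the value of F, so the Poincaré inequality applies to p - m.
  obtain ⟨m, hm, hpm⟩ := hdec p
  have h0 : ℓ (p - m) = 0 := by rw [map_sub, hpm, sub_self]
  have h1 := hpoi _ h0
  rw [apply_sub_sub_of_mem_span hg hS hm] at h1
  have h2 : F p = F (p - m) := by
    rw [map_sub, apply_eq_zero_of_mem_span F hF hm, sub_zero]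
  have h3 : F (p - m) ≤ ‖F‖ * ‖p - m‖ := (le_abs_self _).trans (F.le_opNorm _)
  have h4 := hgf p
  rw [hp, h2] at h4
  have h5 : ‖F‖ * ‖p - m‖ ≤ ‖F‖ * (K * √(g p p)) := by gcongr
  have h6 : g p p = √(g p p) * √(g p p) := (Real.mul_self_sqrt (hg0 p)).symm
  -- Testing with p bounds the square of the seminorm by a multiple of the seminorm; one factor is
  -- cancelled if it is not zero.
  rcases (Real.sqrt_nonneg (g p p)).eq_or_lt with h7 | h7
  · rw [← h7]
    positivity
  · have h8 : √(g p p) * (c * √(g p p)) ≤ √(g p p) * (K * ‖F‖) := by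
      nlinarith
    have h9 := le_of_mul_le_mul_left h8 h7
    rw [div_mul_eq_mul_div, le_div_iff₀ hc]
    linarith

end AbstractProblem

/-! ### Means and constants in L² -/

section LpMeans

variable {α : Type*} [MeasurableSpace α] {μ : Measure α} [IsFiniteMeasure μ]

lemma integral_eq_inner_const (f : Lp ℝ 2 μ) : ∫ x, f x ∂μ = inner ℝ (Lp.const 2 μ (1 : ℝ)) f := by
  rw [L2.inner_def]
  refine integral_congr_ae ?_
  filter_upwards [Lp.coeFn_const (p := 2) (μ := μ) (1 : ℝ)] with x hx
  rw [hx, Function.const_apply, real_inner_eq_mul, one_mul]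

lemma norm_Lp_const_two (c : ℝ) : ‖Lp.const 2 μ c‖ = |c| * √(μ.real univ) := by
  rw [Lp.norm_const' 2 μ c two_ne_zero ENNReal.ofNat_ne_top, Real.norm_eq_abs, Real.sqrt_eq_rpow]
  norm_num

lemma abs_integral_le_sqrt_mul_norm (f : Lp ℝ 2 μ) :
    |∫ x, f x ∂μ| ≤ √(μ.real univ) * ‖f‖ := by
  rw [integral_eq_inner_const]
  refine (abs_real_inner_le_norm _ _).trans_eq ?_
  rw [norm_Lp_const_two, abs_one, one_mul]

lemma integral_Lp_const (c : ℝ) : ∫ x, Lp.const 2 μ c x ∂μ = c * μ.real univ := by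
  rw [integral_congr_ae (Lp.coeFn_const (p := 2) (μ := μ) c)]
  simp [mul_comm]

lemma norm_sub_const_eq (f : Lp ℝ 2 μ) (c : ℝ) :
    ENNReal.ofReal ‖f - Lp.const 2 μ c‖ = eLpNorm (fun x => f x - c) 2 μ := by
  rw [ofReal_norm, Lp.enorm_def]
  refine eLpNorm_congr_ae ?_
  filter_upwards [Lp.coeFn_sub f (Lp.const 2 μ c), Lp.coeFn_const (p := 2) (μ := μ) c] with x h1 h2
  rw [h1, Pi.sub_apply, h2, Function.const_apply]

lemma norm_sub_const_le_of_eLpNorm {F : Type*} [NormedAddCommGroup F] {C : ℝ≥0∞} (hC : C ≠ ⊤)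
    (f : Lp ℝ 2 μ) (c : ℝ) (g : Lp F 2 μ)
    (h : eLpNorm (fun x => f x - c) 2 μ ≤ C * eLpNorm g 2 μ) :
    ‖f - Lp.const 2 μ c‖ ≤ C.toReal * ‖g‖ := by
  rw [← norm_sub_const_eq, ← Lp.enorm_def, ← ofReal_norm, ← ENNReal.ofReal_toReal hC,
    ← ENNReal.ofReal_mul ENNReal.toReal_nonneg, ENNReal.ofReal_le_ofReal_iff (by positivity)] at h
  exact h

end LpMeans

/-! ### Poincaré inequalities in norm form, including the trace -/

section Poincare

variable {n : ℕ} {Ω : Set (E (n + 1))}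

lemma IsLipschitzDomain.vol_pos (hΩ : IsLipschitzDomain Ω) : 0 < vol Ω := by
  have := hΩ.isFiniteMeasure_bulk
  refine ENNReal.toReal_pos ?_ (measure_ne_top _ _)
  rw [Measure.restrict_apply_univ]
  exact (hΩ.isOpen.measure_pos _ hΩ.isConnected.nonempty).ne'

/-- A non-empty bounded set is not the whole space, so by connectedness of the space its frontier is
non-empty. -/
lemma IsLipschitzDomain.area_pos (hΩ : IsLipschitzDomain Ω) : 0 < area Ω := by
  have := hΩ.isFiniteMeasure_surf
  refine ENNReal.toReal_pos ?_ (measure_ne_top _ _)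
  have hne : (frontier Ω).Nonempty := by
    rw [nonempty_frontier_iff]
    refine ⟨hΩ.isConnected.nonempty, fun h => ?_⟩
    exact NormedSpace.unbounded_univ ℝ (E (n + 1)) (h ▸ hΩ.isBounded)
  have h := hΩ.surfMeasure_ne_zero isOpen_univ (by rwa [univ_inter])
  exact fun h0 => h (measure_mono_null (subset_univ _) h0)

lemma IsLipschitzDomain.exists_norm_sub_mean_le_bulk (hΩ : IsLipschitzDomain Ω)
    [IsFiniteMeasure (bulkMeasure Ω)] : ∃ C : ℝ, 0 ≤ C ∧ ∀ u : bulkH1 Ω,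
      ‖u.1.fst - Lp.const 2 (bulkMeasure Ω) ((∫ x, u.1.fst x ∂(bulkMeasure Ω)) / vol Ω)‖ ≤
        C * ‖u.1.snd‖ := by
  obtain ⟨C, hC, h⟩ := hΩ.exists_poincare_bulk
  refine ⟨C.toReal, ENNReal.toReal_nonneg, fun u => norm_sub_const_le_of_eLpNorm hC _ _ _ ?_⟩
  have := h _ _ (Lp.memLp u.1.fst) (Lp.memLp u.1.snd) u.2
  rwa [average_eq, smul_eq_mul, inv_mul_eq_div] at this

lemma IsLipschitzDomain.exists_norm_sub_mean_le_surf (hΩ : IsLipschitzDomain Ω)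
    [IsFiniteMeasure (surfMeasure Ω)] (hconn : IsConnected (frontier Ω)) :
    ∃ C : ℝ, 0 ≤ C ∧ ∀ v : surfH1 Ω,
      ‖v.1.fst - Lp.const 2 (surfMeasure Ω) ((∫ x, v.1.fst x ∂(surfMeasure Ω)) / area Ω)‖ ≤
        C * ‖v.1.snd‖ := by
  obtain ⟨C, hC, h⟩ := hΩ.exists_poincare_surf hconn
  refine ⟨C.toReal, ENNReal.toReal_nonneg, fun v => norm_sub_const_le_of_eLpNorm hC _ _ _ ?_⟩
  have := h _ _ (Lp.memLp v.1.fst) (Lp.memLp v.1.snd) v.2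
  rwa [average_eq, smul_eq_mul, inv_mul_eq_div] at this

lemma trace_constBulk (hΩ : IsLipschitzDomain Ω) [IsFiniteMeasure (surfMeasure Ω)] (a : ℝ) :
    trace (constBulk hΩ a) = Lp.const 2 (surfMeasure Ω) a := by
  have := hΩ.isFiniteMeasure_bulk
  refine hΩ.traceGraph_unique (hΩ.trace_mem _) (Submodule.le_topologicalClosure _ ?_)
  exact ⟨fun _ => a, contDiff_const,
    (memLp_const a : MemLp (fun _ => a) 2 (bulkMeasure Ω)).coeFn_toLp, Lp.coeFn_const 2 _ a⟩

/-- The trace bound is applied to u minus its mean over Ω; its full H¹ norm is controlled by the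
gradient alone. The constant subtracted on Γ is thus the bulk mean. -/
lemma IsLipschitzDomain.exists_norm_trace_sub_mean_le (hΩ : IsLipschitzDomain Ω)
    [IsFiniteMeasure (surfMeasure Ω)] : ∃ C : ℝ, 0 ≤ C ∧ ∀ u : bulkH1 Ω,
      ‖trace u - Lp.const 2 (surfMeasure Ω) ((∫ x, u.1.fst x ∂(bulkMeasure Ω)) / vol Ω)‖ ≤
        C * ‖u.1.snd‖ := by
  have := hΩ.isFiniteMeasure_bulk
  obtain ⟨C, hC, h⟩ := hΩ.exists_norm_sub_mean_le_bulk
  obtain ⟨D, hD, h'⟩ := hΩ.exists_norm_trace_le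
  refine ⟨D * (C + 1), by positivity, fun u => ?_⟩
  set a := (∫ x, u.1.fst x ∂(bulkMeasure Ω)) / vol Ω with ha
  have h1 : trace (u - constBulk hΩ a) = trace u - Lp.const 2 (surfMeasure Ω) a := by
    rw [← trace_constBulk hΩ a]
    exact map_sub (traceLM hΩ) u (constBulk hΩ a)
  have h2 : ‖u - constBulk hΩ a‖ ≤ (C + 1) * ‖u.1.snd‖ := by
    have e1 : (u - constBulk hΩ a).1.fst = u.1.fst - Lp.const 2 (bulkMeasure Ω) a := rfl
    have e2 : (u - constBulk hΩ a).1.snd = u.1.snd := sub_zero u.1.snd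
    have e3 := bulkH1_norm_sq (u - constBulk hΩ a)
    rw [e1, e2] at e3
    have e4 := h u
    have e5 : ‖u.1.fst - Lp.const 2 (bulkMeasure Ω) a‖ ^ 2 ≤ (C * ‖u.1.snd‖) ^ 2 :=
      pow_le_pow_left₀ (norm_nonneg _) e4 2
    refine (pow_le_pow_iff_left₀ (norm_nonneg _) (by positivity) two_ne_zero).1 ?_
    have e6 : 0 ≤ C * ‖u.1.snd‖ ^ 2 := by positivity
    rw [e3]
    nlinarith
  rw [← h1]
  refine (h' _).trans ?_
  rw [mul_assoc]
  gcongr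

end Poincare

/-! ### The Poincaré inequality for bulk-surface pairs -/

section Means

variable {n : ℕ} {Ω : Set (E (n + 1))}

lemma bulkGrad_le_normL (L : ℝ≥0∞) (β : ℝ) (p : H1 Ω) : ‖p.bulkGrad‖ ≤ normL L β p := by
  refine (pow_le_pow_iff_left₀ (norm_nonneg _) (normL_nonneg L β p) two_ne_zero).1 ?_
  rw [normL_sq]
  have := mul_nonneg (chi_nonneg L) (sq_nonneg ‖jump β p‖)
  nlinarith [sq_nonneg ‖p.surfGrad‖]

lemma surfGrad_le_normL (L : ℝ≥0∞) (β : ℝ) (p : H1 Ω) : ‖p.surfGrad‖ ≤ normL L β p := by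
  refine (pow_le_pow_iff_left₀ (norm_nonneg _) (normL_nonneg L β p) two_ne_zero).1 ?_
  rw [normL_sq]
  have := mul_nonneg (chi_nonneg L) (sq_nonneg ‖jump β p‖)
  nlinarith [sq_nonneg ‖p.bulkGrad‖]

lemma IsLipschitzDomain.jump_eq_zero (hΩ : IsLipschitzDomain Ω) {β : ℝ} {p : H1 Ω}
    (hp : p ∈ H1L Ω 0 β) : jump β p = 0 :=
  sub_eq_zero.2 (hΩ.traceGraph_unique (mem_H1L_iff.1 hp rfl) (hΩ.trace_mem p.fst))

/-- For L = 0 the jump vanishes by the constraint in the space; for 0 < L < ∞ it is part of the norm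
with the positive weight χ(L). -/
lemma IsLipschitzDomain.exists_jump_le_normL (hΩ : IsLipschitzDomain Ω) {L : ℝ≥0∞} (hL : L ≠ ⊤)
    (β : ℝ) : ∃ C : ℝ, 0 ≤ C ∧ ∀ p ∈ H1L Ω L β, ‖jump β p‖ ≤ C * normL L β p := by
  rcases eq_or_ne L 0 with rfl | h0
  · refine ⟨0, le_rfl, fun p hp => ?_⟩
    rw [hΩ.jump_eq_zero hp, norm_zero, zero_mul]
  · have hchi : 0 < chi L := by
      rw [chi, if_neg (by tauto)]
      exact inv_pos.2 (ENNReal.toReal_pos h0 hL)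
    refine ⟨√(chi L)⁻¹, Real.sqrt_nonneg _, fun p _ => ?_⟩
    have hN := normL_nonneg L β p
    refine (pow_le_pow_iff_left₀ (norm_nonneg _) (by positivity) two_ne_zero).1 ?_
    rw [mul_pow, Real.sq_sqrt (by positivity), normL_sq, le_inv_mul_iff₀ hchi]
    nlinarith [sq_nonneg ‖p.bulkGrad‖, sq_nonneg ‖p.surfGrad‖]

lemma H1.norm_le (p : H1 Ω) : ‖p‖ ≤ ‖p.bulk‖ + ‖p.bulkGrad‖ + ‖p.surf‖ + ‖p.surfGrad‖ := by
  have h1 := norm_nonneg p.bulk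
  have h2 := norm_nonneg p.bulkGrad
  have h3 := norm_nonneg p.surf
  have h4 := norm_nonneg p.surfGrad
  refine (pow_le_pow_iff_left₀ (norm_nonneg _) (by positivity) two_ne_zero).1 ?_
  rw [H1.norm_sq_eq]
  nlinarith [mul_nonneg h1 h2, mul_nonneg h1 h3, mul_nonneg h1 h4, mul_nonneg h2 h3,
    mul_nonneg h2 h4, mul_nonneg h3 h4]

lemma exists_norm_le_normL_of_components {L : ℝ≥0∞} {β : ℝ} {P : H1 Ω → Prop}
    (h : ∃ A B : ℝ, 0 ≤ A ∧ 0 ≤ B ∧ ∀ p, P p →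
      ‖p.bulk‖ ≤ A * normL L β p ∧ ‖p.surf‖ ≤ B * normL L β p) :
    ∃ K : ℝ, 0 < K ∧ ∀ p, P p → ‖p‖ ≤ K * normL L β p := by
  obtain ⟨A, B, hA, hB, h⟩ := h
  refine ⟨A + 1 + B + 1, by positivity, fun p hp => p.norm_le.trans ?_⟩
  have h1 := h p hp
  have h2 := bulkGrad_le_normL L β p
  have h3 := surfGrad_le_normL L β p
  nlinarith [h1.1, h1.2]

/-- The Poincaré inequality for `L = ∞`. -/
lemma IsLipschitzDomain.exists_norm_le_normL_top (hΩ : IsLipschitzDomain Ω)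
    (hconn : IsConnected (frontier Ω)) (β : ℝ) :
    ∃ K : ℝ, 0 < K ∧ ∀ p : H1 Ω, ∫ x, p.bulk x ∂(bulkMeasure Ω) = 0 ∧
      ∫ x, p.surf x ∂(surfMeasure Ω) = 0 → ‖p‖ ≤ K * normL ⊤ β p := by
  have := hΩ.isFiniteMeasure_bulk
  have := hΩ.isFiniteMeasure_surf
  obtain ⟨A, hA, h⟩ := hΩ.exists_norm_sub_mean_le_bulk
  obtain ⟨B, hB, h'⟩ := hΩ.exists_norm_sub_mean_le_surf hconn
  refine exists_norm_le_normL_of_components ⟨A, B, hA, hB, fun p hp => ⟨?_, ?_⟩⟩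
  · have h1 := h p.fst
    change ‖p.bulk - Lp.const 2 _ ((∫ x, p.bulk x ∂(bulkMeasure Ω)) / vol Ω)‖ ≤
      A * ‖p.bulkGrad‖ at h1
    rw [hp.1, zero_div, map_zero, sub_zero] at h1
    exact h1.trans (by gcongr; exact bulkGrad_le_normL _ _ _)
  · have h1 := h' p.snd
    change ‖p.surf - Lp.const 2 _ ((∫ x, p.surf x ∂(surfMeasure Ω)) / area Ω)‖ ≤
      B * ‖p.surfGrad‖ at h1
    rw [hp.2, zero_div, map_zero, sub_zero] at h1
    exact h1.trans (by gcongr; exact surfGrad_le_normL _ _ _)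

/-- Integrating βw - I/V and inserting ∫ w = -βI gives -(I/V)(β²V + S), where S is the total mass of
μ. The coefficient is positive, also for β = 0, so the oscillation bounds the mean I/V. -/
lemma abs_le_of_norm_smul_sub_const_le {α : Type*} [MeasurableSpace α] {μ : Measure α}
    [IsFiniteMeasure μ] (w : Lp ℝ 2 μ) {β I V M : ℝ} (hV : 0 < V) (hμ : 0 < μ.real univ)
    (hmean : β * I + ∫ x, w x ∂μ = 0) (h : ‖β • w - Lp.const 2 μ (I / V)‖ ≤ M) :
    |I / V| ≤ √(μ.real univ) / (β ^ 2 * V + μ.real univ) * M := by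
  set S := μ.real univ with hS
  have hD : 0 < β ^ 2 * V + S := by positivity
  have e₄ : ∫ x, (β • w - Lp.const 2 μ (I / V)) x ∂μ = -(I / V) * (β ^ 2 * V + S) := by
    rw [integral_eq_inner_const, inner_sub_right, real_inner_smul_right,
      ← integral_eq_inner_const, ← integral_eq_inner_const, integral_Lp_const,
      eq_neg_of_add_eq_zero_right hmean, ← hS]
    field_simp
    ring
  have e₅ := abs_integral_le_sqrt_mul_norm (β • w - Lp.const 2 μ (I / V))
  rw [e₄, abs_mul, abs_neg, abs_of_pos hD] at e₅
  rw [div_mul_eq_mul_div, le_div_iff₀ hD]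
  exact e₅.trans (mul_le_mul_of_nonneg_left h (Real.sqrt_nonneg _))

/-- The constant a is the bulk mean of u. On Γ, βv - a is the jump plus the trace of u minus a, both
already controlled; the mean condition then bounds a. -/
lemma IsLipschitzDomain.exists_mean_le_normL (hΩ : IsLipschitzDomain Ω) {L : ℝ≥0∞} (hL : L ≠ ⊤)
    (β : ℝ) [IsFiniteMeasure (bulkMeasure Ω)] [IsFiniteMeasure (surfMeasure Ω)] :
    ∃ C : ℝ, 0 ≤ C ∧ ∀ p : H1 Ω, p ∈ H1L Ω L β →
      β * ∫ x, p.bulk x ∂(bulkMeasure Ω) + ∫ x, p.surf x ∂(surfMeasure Ω) = 0 →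
      ∃ a : ℝ, ‖p.bulk - Lp.const 2 _ a‖ ≤ C * normL L β p ∧
        ‖β • p.surf - Lp.const 2 _ a‖ ≤ C * normL L β p ∧ |a| ≤ C * normL L β p := by
  have hV := hΩ.vol_pos
  have hS := hΩ.area_pos
  obtain ⟨C₁, hC₁, h₁⟩ := hΩ.exists_norm_sub_mean_le_bulk
  obtain ⟨C₂, hC₂, h₂⟩ := hΩ.exists_norm_trace_sub_mean_le
  obtain ⟨C₄, hC₄, h₄⟩ := hΩ.exists_jump_le_normL hL β
  obtain ⟨C₅, hC₅⟩ : ∃ C₅ : ℝ, C₅ = √(area Ω) / (β ^ 2 * vol Ω + area Ω) * (C₄ + C₂) := ⟨_, rfl⟩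
  have hC₅0 : 0 ≤ C₅ := by
    rw [hC₅]
    positivity
  refine ⟨C₁ + (C₄ + C₂) + C₅, by positivity, fun p hp hmean =>
    ⟨(∫ x, p.bulk x ∂(bulkMeasure Ω)) / vol Ω, ?_⟩⟩
  have hg := bulkGrad_le_normL L β p
  have hN := normL_nonneg L β p
  have e₁ := (h₁ p.fst).trans (mul_le_mul_of_nonneg_left hg hC₁)
  have e₂ := (h₂ p.fst).trans (mul_le_mul_of_nonneg_left hg hC₂)
  have e₃ := (norm_add_le (jump β p) _).trans (add_le_add (h₄ p hp) e₂)
  rw [jump, sub_add_sub_cancel, ← add_mul] at e₃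
  have e₄ := abs_le_of_norm_smul_sub_const_le p.surf hV hS hmean e₃
  rw [← mul_assoc] at e₄
  have e₅ : |(∫ x, p.bulk x ∂(bulkMeasure Ω)) / vol Ω| ≤ C₅ * normL L β p := hC₅ ▸ e₄
  have m₁ := mul_nonneg hC₁ hN
  have m₂ := mul_nonneg (add_nonneg hC₄ hC₂) hN
  have m₃ := mul_nonneg hC₅0 hN
  rw [add_mul, add_mul]
  exact ⟨e₁.trans (by linarith), e₃.trans (by linarith), e₅.trans (by linarith)⟩

lemma norm_le_of_norm_sub_const_le {α : Type*} [MeasurableSpace α] {μ : Measure α}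
    [IsFiniteMeasure μ] {f : Lp ℝ 2 μ} {a C N : ℝ} (h : ‖f - Lp.const 2 μ a‖ ≤ C * N)
    (ha : |a| ≤ C * N) : ‖f‖ ≤ (C + C * √(μ.real univ)) * N := by
  have h1 := norm_le_norm_sub_add f (Lp.const 2 μ a)
  rw [norm_Lp_const_two] at h1
  have h2 : |a| * √(μ.real univ) ≤ C * N * √(μ.real univ) := by gcongr
  linarith

/-- The Poincaré inequality for `L < ∞`. -/
lemma IsLipschitzDomain.exists_norm_le_normL (hΩ : IsLipschitzDomain Ω) {L : ℝ≥0∞} (hL : L ≠ ⊤)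
    {β : ℝ} (hconn : β = 0 → IsConnected (frontier Ω)) :
    ∃ K : ℝ, 0 < K ∧ ∀ p : H1 Ω, (p ∈ H1L Ω L β ∧
      β * ∫ x, p.bulk x ∂(bulkMeasure Ω) + ∫ x, p.surf x ∂(surfMeasure Ω) = 0) →
        ‖p‖ ≤ K * normL L β p := by
  have := hΩ.isFiniteMeasure_bulk
  have := hΩ.isFiniteMeasure_surf
  obtain ⟨C, hC, h⟩ := hΩ.exists_mean_le_normL hL β
  -- If β = 0 the estimate of βv is void, but the mean condition says that v has mean zero, and the
  -- Poincaré inequality on the connected boundary applies. Otherwise the bound for βv is divided by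
  -- |β|.
  rcases eq_or_ne β 0 with hβ | hβ
  · obtain ⟨C₃, hC₃, h₃⟩ := hΩ.exists_norm_sub_mean_le_surf (hconn hβ)
    refine exists_norm_le_normL_of_components
      ⟨C + C * √(vol Ω), C₃, add_nonneg hC (mul_nonneg hC (Real.sqrt_nonneg _)), hC₃, fun p hp => ⟨?_, ?_⟩⟩
    · obtain ⟨a, e₁, -, e₃⟩ := h p hp.1 hp.2
      exact norm_le_of_norm_sub_const_le e₁ e₃
    · have h0 : ∫ x, p.surf x ∂(surfMeasure Ω) = 0 := by
        have := hp.2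
        rwa [hβ, zero_mul, zero_add] at this
      have e := h₃ p.snd
      change ‖p.surf - Lp.const 2 _ ((∫ x, p.surf x ∂(surfMeasure Ω)) / area Ω)‖ ≤
        C₃ * ‖p.surfGrad‖ at e
      rw [h0, zero_div, map_zero, sub_zero] at e
      exact e.trans (mul_le_mul_of_nonneg_left (surfGrad_le_normL _ _ _) hC₃)
  · have hβ' : 0 < |β| := abs_pos.2 hβ
    refine exists_norm_le_normL_of_components
      ⟨C + C * √(vol Ω), (C + C * √(area Ω)) / |β|,
        add_nonneg hC (mul_nonneg hC (Real.sqrt_nonneg _)), by positivity, fun p hp => ⟨?_, ?_⟩⟩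
    · obtain ⟨a, e₁, -, e₃⟩ := h p hp.1 hp.2
      exact norm_le_of_norm_sub_const_le e₁ e₃
    · obtain ⟨a, -, e₂, e₃⟩ := h p hp.1 hp.2
      have := norm_le_of_norm_sub_const_le e₂ e₃
      rw [norm_smul, Real.norm_eq_abs] at this
      rw [div_mul_eq_mul_div, le_div_iff₀ hβ', mul_comm]
      exact this

end Means

/-! ### Well-posedness from the Poincaré inequality -/

section WellPosed

/-- Here f is the form with coefficients and g the one with unit coefficients, whose square root is
the seminorm. The Poincaré inequality for g together with c g ≤ f gives coercivity of f with
constant c / K². -/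
lemma existsUnique_and_estimate {X R : Type*} [NormedAddCommGroup X] [InnerProductSpace ℝ X]
    [CompleteSpace X] [NormedAddCommGroup R] [NormedSpace ℝ R] {f g : X → X → ℝ}
    (hf : IsBoundedBilinearMap ℝ fun p : X × X => f p.1 p.2)
    (hg : IsBoundedBilinearMap ℝ fun p : X × X => g p.1 p.2) (ℓ : X →L[ℝ] R) {S : Set X}
    (hSf : ∀ m ∈ S, ∀ q, f m q = 0 ∧ f q m = 0) (hSg : ∀ m ∈ S, ∀ q, g m q = 0 ∧ g q m = 0)
    (hdec : ∀ p, ∃ m ∈ Submodule.span ℝ S, ℓ p = ℓ m) {c K : ℝ} (hc : 0 < c) (hK : 0 < K)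
    (hg0 : ∀ p, 0 ≤ g p p) (hgf : ∀ p, c * g p p ≤ f p p)
    (hpoi : ∀ p, ℓ p = 0 → ‖p‖ ≤ K * √(g p p)) (F : StrongDual ℝ X) (hF : ∀ m ∈ S, F m = 0) :
    (∃! p, ℓ p = 0 ∧ ∀ q, f p q = F q) ∧
      ∀ p, (∀ q, f p q = F q) → √(g p p) ≤ K / c * ‖F‖ := by
  refine ⟨existsUnique_variational hf ℓ hSf hdec (c := c / K ^ 2) (by positivity) (fun p hp => ?_)
    F hF, fun p hp => variational_estimate hg ℓ hSg hdec hc hK.le hg0 hgf hpoi F hF hp⟩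
  have h1 := pow_le_pow_left₀ (norm_nonneg p) (hpoi p hp) 2
  rw [mul_pow, Real.sq_sqrt (hg0 p)] at h1
  refine le_trans ?_ (hgf p)
  rw [div_mul_eq_mul_div, div_le_iff₀ (by positivity)]
  nlinarith

lemma exists_strongDual {X : Type*} [NormedAddCommGroup X] [NormedSpace ℝ X] (F : X → ℝ)
    (hFadd : ∀ p q, F (p + q) = F p + F q) (hFsmul : ∀ (t : ℝ) p, F (t • p) = t * F p) {B : ℝ}
    (hB : 0 ≤ B) (hFB : ∀ p, |F p| ≤ B * ‖p‖) :
    ∃ F' : StrongDual ℝ X, (∀ p, F' p = F p) ∧ ‖F'‖ ≤ B :=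
  let F₀ : X →ₗ[ℝ] ℝ := { toFun := F, map_add' := hFadd, map_smul' := hFsmul }
  ⟨F₀.mkContinuous B hFB, fun _ => rfl, F₀.mkContinuous_norm_le hB hFB⟩

section Restricted

variable {H : Type*} [NormedAddCommGroup H] [InnerProductSpace ℝ H] (W : Submodule ℝ H)
  [CompleteSpace W]

/-- Well-posedness on `W` when the forms annihilate one element `e` and control the elements with
`r p = 0`, where `r e ≠ 0`. -/
lemma existsUnique_and_estimate_of_one {f g : H → H → ℝ}
    (hf : IsBoundedBilinearMap ℝ fun p : H × H => f p.1 p.2)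
    (hg : IsBoundedBilinearMap ℝ fun p : H × H => g p.1 p.2) {r : H → ℝ}
    (hr : IsBoundedLinearMap ℝ r) (e : W)
    (hef : ∀ q, f e q = 0 ∧ f q e = 0) (heg : ∀ q, g e q = 0 ∧ g q e = 0) (hre : r e ≠ 0)
    {c K : ℝ} (hc : 0 < c) (hK : 0 < K) (hg0 : ∀ p, 0 ≤ g p p) (hgf : ∀ p, c * g p p ≤ f p p)
    (hpoi : ∀ p : H, p ∈ W ∧ r p = 0 → ‖p‖ ≤ K * √(g p p)) (F : W → ℝ)
    (hFadd : ∀ p q, F (p + q) = F p + F q) (hFsmul : ∀ (t : ℝ) (p : W), F (t • p) = t * F p)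
    {B : ℝ} (hB : 0 ≤ B) (hFB : ∀ p, |F p| ≤ B * ‖p‖) (hF : F e = 0) :
    (∃! p : W, r p = 0 ∧ ∀ q : W, f p q = F q) ∧
      ∀ p : W, (∀ q : W, f p q = F q) → √(g p p) ≤ K / c * B := by
  let ℓ : W →L[ℝ] ℝ := hr.toContinuousLinearMap.comp W.subtypeL
  have hℓ : ∀ p : W, ℓ p = r p := fun p => rfl
  obtain ⟨F', hF', hF'B⟩ := exists_strongDual F hFadd hFsmul hB hFB
  have key := existsUnique_and_estimate (f := fun p q : W => f p q) (g := fun p q : W => g p q)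
    (hf.comp_subtype W) (hg.comp_subtype W) ℓ (S := {e}) ?_ ?_ ?_
    hc hK (fun p => hg0 p) (fun p => hgf p) (fun p hp => hpoi p ⟨p.2, hp⟩) F' ?_
  · simp only [hℓ, hF'] at key
    refine ⟨key.1, fun p hp => (key.2 p hp).trans ?_⟩
    gcongr
  · rintro _ rfl q
    exact hef q
  · rintro _ rfl q
    exact heg q
  -- The multiple of e with the same value of ℓ; it exists because ℓ is scalar and nonzero at e.
  · refine fun p => ⟨(ℓ p / ℓ e) • e,
      Submodule.smul_mem _ _ (Submodule.mem_span_singleton_self _), ?_⟩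
    rw [map_smul, smul_eq_mul, div_mul_cancel₀]
    exact hre
  · rintro _ rfl
    exact (hF' _).trans hF

/-- Well-posedness on `W` when the forms annihilate two elements `e₁`, `e₂` and control the
elements with `r₁ p = r₂ p = 0`, where `r₁`, `r₂` are dual to `e₁`, `e₂` up to scaling. -/
lemma existsUnique_and_estimate_of_two {f g : H → H → ℝ}
    (hf : IsBoundedBilinearMap ℝ fun p : H × H => f p.1 p.2)
    (hg : IsBoundedBilinearMap ℝ fun p : H × H => g p.1 p.2) {r₁ r₂ : H → ℝ}
    (hr₁ : IsBoundedLinearMap ℝ r₁) (hr₂ : IsBoundedLinearMap ℝ r₂) (e₁ e₂ : W)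
    (hef₁ : ∀ q, f e₁ q = 0 ∧ f q e₁ = 0) (heg₁ : ∀ q, g e₁ q = 0 ∧ g q e₁ = 0)
    (hef₂ : ∀ q, f e₂ q = 0 ∧ f q e₂ = 0) (heg₂ : ∀ q, g e₂ q = 0 ∧ g q e₂ = 0)
    (h₁₁ : r₁ e₁ ≠ 0) (h₁₂ : r₁ e₂ = 0) (h₂₁ : r₂ e₁ = 0) (h₂₂ : r₂ e₂ ≠ 0)
    {c K : ℝ} (hc : 0 < c) (hK : 0 < K) (hg0 : ∀ p, 0 ≤ g p p) (hgf : ∀ p, c * g p p ≤ f p p)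
    (hpoi : ∀ p : H, r₁ p = 0 ∧ r₂ p = 0 → ‖p‖ ≤ K * √(g p p)) (F : W → ℝ)
    (hFadd : ∀ p q, F (p + q) = F p + F q) (hFsmul : ∀ (t : ℝ) (p : W), F (t • p) = t * F p)
    {B : ℝ} (hB : 0 ≤ B) (hFB : ∀ p, |F p| ≤ B * ‖p‖) 
    (hF₁ : F e₁ = 0) (hF₂ : F e₂ = 0) :
    (∃! p : W, (r₁ p = 0 ∧ r₂ p = 0) ∧ ∀ q : W, f p q = F q) ∧
      ∀ p : W, (∀ q : W, f p q = F q) → √(g p p) ≤ K / c * B := by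
  let ℓ : W →L[ℝ] ℝ × ℝ :=
    (hr₁.toContinuousLinearMap.prod hr₂.toContinuousLinearMap).comp W.subtypeL
  have hℓ : ∀ p : W, ℓ p = (r₁ p, r₂ p) := fun p => rfl
  obtain ⟨F', hF', hF'B⟩ := exists_strongDual F hFadd hFsmul hB hFB
  have hℓ0 : ∀ p : W, ℓ p = 0 ↔ r₁ p = 0 ∧ r₂ p = 0 := fun p => by rw [hℓ, Prod.mk_eq_zero]
  have key := existsUnique_and_estimate (f := fun p q : W => f p q) (g := fun p q : W => g p q)
    (hf.comp_subtype W) (hg.comp_subtype W) ℓ (S := {e₁, e₂})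
    ?_ ?_ ?_ hc hK (fun p => hg0 p) (fun p => hgf p) (fun p hp => hpoi p ((hℓ0 p).1 hp)) F' ?_
  · simp only [hℓ0, hF'] at key
    refine ⟨key.1, fun p hp => (key.2 p hp).trans ?_⟩
    gcongr
  · rintro _ (rfl | rfl) q
    exacts [hef₁ q, hef₂ q]
  · rintro _ (rfl | rfl) q
    exacts [heg₁ q, heg₂ q]
  -- The pair of functionals is diagonal on e₁ and e₂, so each coefficient can be matched
  -- separately.
  · refine fun p => ⟨(r₁ p / r₁ e₁) • e₁ + (r₂ p / r₂ e₂) • e₂, Submodule.add_mem _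
        (Submodule.smul_mem _ _ (Submodule.subset_span (mem_insert _ _)))
        (Submodule.smul_mem _ _ (Submodule.subset_span (mem_insert_of_mem _ rfl))), ?_⟩
    rw [map_add, map_smul, map_smul, hℓ, hℓ, hℓ, h₁₂, h₂₁]
    refine Prod.ext ?_ ?_
    · simp [h₁₁]
    · simp [h₂₂]
  · rintro _ (rfl | rfl)
    exacts [(hF' _).trans hF₁, (hF' _).trans hF₂]

end Restricted

variable {n : ℕ} {Ω : Set (E (n + 1))}

/-- The alternatives in `h3` correspond to the two kernels: every pair of constants when χ(L) = 0,
and the pair (β, 1), whose jump vanishes, for any L. -/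
lemma form_eq_zero_of_grad_eq_zero {L : ℝ≥0∞} {β : ℝ} {m : H1 Ω} (h1 : m.bulkGrad = 0)
    (h2 : m.surfGrad = 0) (h3 : chi L = 0 ∨ jump β m = 0) (a b : E (n + 1) → ℝ) (q : H1 Ω) :
    form L β a b m q = 0 ∧ form L β a b q m = 0 := by
  have e1 : ∀ᵐ x ∂(bulkMeasure Ω), m.bulkGrad x = 0 := by
    rw [h1]
    exact Lp.coeFn_zero _ _ _
  have e2 : ∀ᵐ x ∂(surfMeasure Ω), m.surfGrad x = 0 := by
    rw [h2]
    exact Lp.coeFn_zero _ _ _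
  rw [form_eq, form_eq]
  constructor
  · have i1 : ∫ x, a x * inner ℝ (m.bulkGrad x) (q.bulkGrad x) ∂(bulkMeasure Ω) = 0 :=
      integral_eq_zero_of_ae (by filter_upwards [e1] with x hx; simp [hx])
    have i2 : ∫ x, b x * inner ℝ (m.surfGrad x) (q.surfGrad x) ∂(surfMeasure Ω) = 0 :=
      integral_eq_zero_of_ae (by filter_upwards [e2] with x hx; simp [hx])
    rw [i1, i2]
    rcases h3 with h3 | h3 <;> rw [h3]
    · simp
    · rw [inner_zero_left]
      simp
  · have i1 : ∫ x, a x * inner ℝ (q.bulkGrad x) (m.bulkGrad x) ∂(bulkMeasure Ω) = 0 :=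
      integral_eq_zero_of_ae (by filter_upwards [e1] with x hx; simp [hx])
    have i2 : ∫ x, b x * inner ℝ (q.surfGrad x) (m.surfGrad x) ∂(surfMeasure Ω) = 0 :=
      integral_eq_zero_of_ae (by filter_upwards [e2] with x hx; simp [hx])
    rw [i1, i2]
    rcases h3 with h3 | h3 <;> rw [h3]
    · simp
    · rw [inner_zero_right]
      simp

lemma jump_constH1 (hΩ : IsLipschitzDomain Ω) (β : ℝ) : jump β (constH1 hΩ β 1) = 0 := by
  have := hΩ.isFiniteMeasure_surf
  have h1 : trace (constH1 hΩ β 1).fst = Lp.const 2 (surfMeasure Ω) β := trace_constBulk hΩ β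
  have h2 : (constH1 hΩ β 1).surf = Lp.const 2 (surfMeasure Ω) (1 : ℝ) := rfl
  have h3 : β • Lp.const 2 (surfMeasure Ω) (1 : ℝ) = Lp.const 2 (surfMeasure Ω) (β • (1 : ℝ)) :=
    ((Lp.constₗ 2 (surfMeasure Ω) ℝ).map_smul β (1 : ℝ)).symm
  rw [jump, h1, h2, h3, smul_eq_mul, mul_one, sub_self]

lemma integral_constH1_bulk (hΩ : IsLipschitzDomain Ω) (a b : ℝ) :
    ∫ x, (constH1 hΩ a b).bulk x ∂(bulkMeasure Ω) = a * vol Ω := by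
  have := hΩ.isFiniteMeasure_bulk
  exact integral_Lp_const a

lemma integral_constH1_surf (hΩ : IsLipschitzDomain Ω) (a b : ℝ) :
    ∫ x, (constH1 hΩ a b).surf x ∂(surfMeasure Ω) = b * area Ω := by
  have := hΩ.isFiniteMeasure_surf
  exact integral_Lp_const b

lemma isBoundedLinearMap_integral_comp {X α : Type*} [NormedAddCommGroup X] [NormedSpace ℝ X]
    [MeasurableSpace α] {μ : Measure α} [IsFiniteMeasure μ] (T : X →L[ℝ] Lp ℝ 2 μ) :
    IsBoundedLinearMap ℝ fun p => ∫ x, T p x ∂μ := by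
  simp only [integral_eq_inner_const]
  exact ((innerSL ℝ (Lp.const 2 μ (1 : ℝ))).comp T).isBoundedLinearMap

lemma isBoundedLinearMap_integral_bulk [IsFiniteMeasure (bulkMeasure Ω)] :
    IsBoundedLinearMap ℝ fun p : H1 Ω => ∫ x, p.bulk x ∂(bulkMeasure Ω) :=
  isBoundedLinearMap_integral_comp (bulkCLM Ω)

lemma isBoundedLinearMap_integral_surf [IsFiniteMeasure (surfMeasure Ω)] :
    IsBoundedLinearMap ℝ fun p : H1 Ω => ∫ x, p.surf x ∂(surfMeasure Ω) :=
  isBoundedLinearMap_integral_comp (surfCLM Ω)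

lemma IsMobility.comp_bounds {mlow mup : ℝ} {m : ℝ → ℝ} (hm : IsMobility mlow mup m)
    (hmlow : 0 < mlow) {α : Type*} [MeasurableSpace α] {μ : Measure α} {φ : α → ℝ}
    (hφ : AEMeasurable φ μ) (hφ1 : ∀ᵐ x ∂μ, |φ x| ≤ 1) :
    AEStronglyMeasurable (fun x => m (φ x)) μ ∧ (∀ᵐ x ∂μ, mlow ≤ m (φ x)) ∧
      ∀ᵐ x ∂μ, |m (φ x)| ≤ mup := by
  have hle : (-1 : ℝ) ≤ 1 := by norm_num
  refine ⟨?_, ?_, ?_⟩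
  -- The mobility is controlled only on [-1, 1]. Its constant extension beyond that interval is
  -- continuous and gives the same composition a.e., since |φ| ≤ 1 a.e.
  · have hc : Continuous (IccExtend hle (domRestrict (Icc (-1) 1) m)) :=
      (continuousOn_iff_continuous_domRestrict.1 hm.1).Icc_extend'
    refine (hc.measurable.comp_aemeasurable hφ).aestronglyMeasurable.congr ?_
    filter_upwards [hφ1] with x hx
    exact IccExtend_of_mem hle _ (abs_le.1 hx)
  · filter_upwards [hφ1] with x hx
    exact (hm.2 _ (abs_le.1 hx)).1
  · filter_upwards [hφ1] with x hx
    have h := hm.2 _ (abs_le.1 hx)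
    rw [abs_of_pos (hmlow.trans_le h.1)]
    exact h.2

end WellPosed

/-! ### Application to the elliptic system -/

section Main

variable {n : ℕ} {Ω : Set (E (n + 1))}

/-- Admissible coefficients: measurable functions bounded above by `M` and below by `m`. -/
structure IsCoeffPair (Ω : Set (E (n + 1))) (m M : ℝ) (a b : E (n + 1) → ℝ) : Prop where
  meas_bulk : AEStronglyMeasurable a (bulkMeasure Ω)
  le_bulk : ∀ᵐ x ∂(bulkMeasure Ω), m ≤ a x
  abs_le_bulk : ∀ᵐ x ∂(bulkMeasure Ω), |a x| ≤ M
  meas_surf : AEStronglyMeasurable b (surfMeasure Ω)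
  le_surf : ∀ᵐ x ∂(surfMeasure Ω), m ≤ b x
  abs_le_surf : ∀ᵐ x ∂(surfMeasure Ω), |b x| ≤ M

lemma IsMobility.isCoeffPair {mlow mup : ℝ} {mΩ mΓ : ℝ → ℝ} (hΩ : IsMobility mlow mup mΩ)
    (hΓ : IsMobility mlow mup mΓ) (hmlow : 0 < mlow) {φ ψ : E (n + 1) → ℝ}
    (hφ : AEMeasurable φ (bulkMeasure Ω)) (hφ1 : ∀ᵐ x ∂(bulkMeasure Ω), |φ x| ≤ 1)
    (hψ : AEMeasurable ψ (surfMeasure Ω)) (hψ1 : ∀ᵐ x ∂(surfMeasure Ω), |ψ x| ≤ 1) :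
    IsCoeffPair Ω mlow mup (fun x => mΩ (φ x)) (fun x => mΓ (ψ x)) :=
  have e₁ := hΩ.comp_bounds hmlow hφ hφ1
  have e₂ := hΓ.comp_bounds hmlow hψ hψ1
  ⟨e₁.1, e₁.2.1, e₁.2.2, e₂.1, e₂.2.1, e₂.2.2⟩

lemma form_one_self_nonneg (L : ℝ≥0∞) (β : ℝ) (p : H1 Ω) :
    0 ≤ form L β (fun _ => 1) (fun _ => 1) p p := by
  rw [form_one_self]
  have := chi_nonneg L
  positivity

lemma IsLipschitzDomain.mem_V1_iff (hΩ : IsLipschitzDomain Ω) {L : ℝ≥0∞} (hL : L ≠ ⊤) {β : ℝ}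
    {p : H1L Ω L β} : p ∈ V1 Ω L β ↔ β * ∫ x, (p : H1 Ω).bulk x ∂(bulkMeasure Ω) +
      ∫ x, (p : H1 Ω).surf x ∂(surfMeasure Ω) = 0 := by
  have hV := hΩ.vol_pos
  have hS := hΩ.area_pos
  have hD : β ^ 2 * vol Ω + area Ω ≠ 0 := by positivity
  exact ⟨fun h => (div_eq_zero_iff.1 (h.1 hL)).resolve_right hD,
    fun h => ⟨fun _ => by rw [h, zero_div], fun h' => absurd h' hL⟩⟩

lemma IsLipschitzDomain.mem_V1_top_iff (hΩ : IsLipschitzDomain Ω) {β : ℝ} {p : H1L Ω ⊤ β} :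
    p ∈ V1 Ω ⊤ β ↔ ∫ x, (p : H1 Ω).bulk x ∂(bulkMeasure Ω) = 0 ∧
      ∫ x, (p : H1 Ω).surf x ∂(surfMeasure Ω) = 0 :=
  ⟨fun h => ⟨(div_eq_zero_iff.1 (h.2 rfl).1).resolve_right hΩ.vol_pos.ne',
      (div_eq_zero_iff.1 (h.2 rfl).2).resolve_right hΩ.area_pos.ne'⟩,
    fun h => ⟨fun h' => absurd rfl h', fun _ => by rw [h.1, h.2, zero_div, zero_div]; simp⟩⟩

/-- Unique solvability of the elliptic system in `𝒱¹_L` together with the a priori estimate with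
the constant `C`, for all coefficients bounded below by `m`. -/
def IsWellPosed (hΩ : IsLipschitzDomain Ω) (L : ℝ≥0∞) (β m C : ℝ) : Prop :=
  ∀ (M : ℝ) (a b : E (n + 1) → ℝ), IsCoeffPair Ω m M a b → ∀ F ∈ Vdual hΩ L β,
    (∃! p : H1L Ω L β, p ∈ V1 Ω L β ∧
      ∀ q : H1L Ω L β, form L β a b (p : H1 Ω) (q : H1 Ω) = F q) ∧
    ∀ p : H1L Ω L β, (∀ q : H1L Ω L β, form L β a b (p : H1 Ω) (q : H1 Ω) = F q) →
      normL L β (p : H1 Ω) ≤ C * ‖F‖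

lemma IsCoeffPair.isBoundedBilinearMap_form {m M : ℝ} {a b : E (n + 1) → ℝ}
    (hab : IsCoeffPair Ω m M a b) (hΩ : IsLipschitzDomain Ω) (L : ℝ≥0∞) (β : ℝ) :
    IsBoundedBilinearMap ℝ fun p : H1 Ω × H1 Ω => form L β a b p.1 p.2 :=
  hΩ.isBoundedBilinearMap_form L β hab.meas_bulk hab.abs_le_bulk hab.meas_surf hab.abs_le_surf

lemma isCoeffPair_one : IsCoeffPair Ω 1 1 (fun _ => 1) (fun _ => 1) :=
  ⟨aestronglyMeasurable_const, by simp, by simp, aestronglyMeasurable_const, by simp, by simp⟩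

lemma IsCoeffPair.mul_form_one_le {m M : ℝ} {a b : E (n + 1) → ℝ}
    (hab : IsCoeffPair Ω m M a b) (L : ℝ≥0∞) (β : ℝ) (p : H1 Ω) :
    min 1 m * form L β (fun _ => 1) (fun _ => 1) p p ≤ form L β a b p p := by
  have h := mul_normL_sq_le_form L β hab.meas_bulk hab.le_bulk hab.abs_le_bulk hab.meas_surf
    hab.le_surf hab.abs_le_surf p
  rwa [normL, Real.sq_sqrt (form_one_self_nonneg L β p)] at h

lemma form_constL (hΩ : IsLipschitzDomain Ω) (L : ℝ≥0∞) (β : ℝ) (a b : E (n + 1) → ℝ)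
    (q : H1 Ω) : form L β a b (constL hΩ L β : H1 Ω) q = 0 ∧
      form L β a b q (constL hΩ L β : H1 Ω) = 0 :=
  form_eq_zero_of_grad_eq_zero rfl rfl (Or.inr (jump_constH1 hΩ β)) a b q

lemma form_constH1_top (hΩ : IsLipschitzDomain Ω) (β s t : ℝ) (a b : E (n + 1) → ℝ)
    (q : H1 Ω) : form ⊤ β a b (constH1 hΩ s t) q = 0 ∧ form ⊤ β a b q (constH1 hΩ s t) = 0 :=
  form_eq_zero_of_grad_eq_zero rfl rfl (Or.inl (if_pos (Or.inr rfl))) a b q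

lemma dual_add {L : ℝ≥0∞} {β : ℝ} (F : StrongDual ℝ (H1L Ω L β)) (p q : H1L Ω L β) :
    F (p + q) = F p + F q :=
  F.map_add p q

lemma dual_smul {L : ℝ≥0∞} {β : ℝ} (F : StrongDual ℝ (H1L Ω L β)) (t : ℝ) (p : H1L Ω L β) :
    F (t • p) = t * F p :=
  F.map_smul t p

lemma opNorm_nonneg_and_le {H : Type*} [NormedAddCommGroup H] [InnerProductSpace ℝ H]
    (W : Submodule ℝ H) (F : StrongDual ℝ W) : 0 ≤ ‖F‖ ∧ ∀ p, |F p| ≤ ‖F‖ * ‖p‖ :=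
  ⟨norm_nonneg F, fun p => F.le_opNorm p⟩

lemma dual_norm {L : ℝ≥0∞} {β : ℝ} (F : StrongDual ℝ (H1L Ω L β)) :
    0 ≤ ‖F‖ ∧ ∀ p, |F p| ≤ ‖F‖ * ‖p‖ :=
  opNorm_nonneg_and_le (H1L Ω L β) F

lemma isBoundedLinearMap_mean [IsFiniteMeasure (bulkMeasure Ω)]
    [IsFiniteMeasure (surfMeasure Ω)] (β : ℝ) :
    IsBoundedLinearMap ℝ fun p : H1 Ω => β * ∫ x, p.bulk x ∂(bulkMeasure Ω) +
      ∫ x, p.surf x ∂(surfMeasure Ω) :=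
  (isBoundedLinearMap_integral_bulk.smul β).add isBoundedLinearMap_integral_surf

lemma mean_constL (hΩ : IsLipschitzDomain Ω) (L : ℝ≥0∞) (β : ℝ) :
    β * ∫ x, (constL hΩ L β : H1 Ω).bulk x ∂(bulkMeasure Ω) +
      ∫ x, (constL hΩ L β : H1 Ω).surf x ∂(surfMeasure Ω) = β ^ 2 * vol Ω + area Ω := by
  rw [constL, integral_constH1_bulk, integral_constH1_surf]
  ring

/-- The kernel is spanned by (β, 1), on which the mean functional equals β²|Ω| + |Γ| > 0. The upper
bound M serves only to make the form bounded and does not enter the constant. -/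
lemma isWellPosed_of_poincare (hΩ : IsLipschitzDomain Ω) {L : ℝ≥0∞} (hL : L ≠ ⊤) {β m K : ℝ}
    (hm : 0 < m) (hK : 0 < K) (hpoi : ∀ p : H1 Ω, (p ∈ H1L Ω L β ∧
      β * ∫ x, p.bulk x ∂(bulkMeasure Ω) + ∫ x, p.surf x ∂(surfMeasure Ω) = 0) →
        ‖p‖ ≤ K * normL L β p) : IsWellPosed hΩ L β m (K / min 1 m) := by
  intro M a b hab F hF
  have := hΩ.isFiniteMeasure_bulk
  have := hΩ.isFiniteMeasure_surf
  have hV := hΩ.vol_pos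
  have hS := hΩ.area_pos
  have hD : β ^ 2 * vol Ω + area Ω ≠ 0 := by positivity
  have hF0 : F (constL hΩ L β) = 0 := (div_eq_zero_iff.1 (hF.1 hL)).resolve_right hD
  simp only [hΩ.mem_V1_iff hL]
  exact existsUnique_and_estimate_of_one (H1L Ω L β) (hab.isBoundedBilinearMap_form hΩ L β)
    (isCoeffPair_one.isBoundedBilinearMap_form hΩ L β) (isBoundedLinearMap_mean β)
    (constL hΩ L β) (form_constL hΩ L β a b) (form_constL hΩ L β _ _)
    ((mean_constL hΩ L β).trans_ne hD) (lt_min one_pos hm) hK (form_one_self_nonneg L β)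
    (hab.mul_form_one_le L β) hpoi F (dual_add F) (dual_smul F) (dual_norm F).1 (dual_norm F).2
    hF0

/-- Without coupling, (1, 0) and (0, 1) both lie in the kernel, and the bulk and surface means
separate them. -/
lemma IsLipschitzDomain.exists_isWellPosed_top (hΩ : IsLipschitzDomain Ω)
    (hconn : IsConnected (frontier Ω)) (β : ℝ) {m : ℝ} (hm : 0 < m) :
    ∃ C : ℝ, 0 < C ∧ IsWellPosed hΩ ⊤ β m C := by
  have := hΩ.isFiniteMeasure_bulk
  have := hΩ.isFiniteMeasure_surf
  have hV := hΩ.vol_pos.ne'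
  have hS := hΩ.area_pos.ne'
  obtain ⟨K, hK, hpoi⟩ := hΩ.exists_norm_le_normL_top hconn β
  have hmem : ∀ s t : ℝ, constH1 hΩ s t ∈ H1L Ω ⊤ β := fun s t =>
    constH1_mem hΩ fun h => absurd h ENNReal.top_ne_zero
  refine ⟨K / min 1 m, div_pos hK (lt_min one_pos hm), fun M a b hab F hF => ?_⟩
  have key := existsUnique_and_estimate_of_two (H1L Ω ⊤ β) (hab.isBoundedBilinearMap_form hΩ ⊤ β)
    (isCoeffPair_one.isBoundedBilinearMap_form hΩ ⊤ β)
    isBoundedLinearMap_integral_bulk isBoundedLinearMap_integral_surf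
    ⟨constH1 hΩ 1 0, hmem 1 0⟩ ⟨constH1 hΩ 0 1, hmem 0 1⟩
    (form_constH1_top hΩ β _ _ _ _) (form_constH1_top hΩ β _ _ _ _)
    (form_constH1_top hΩ β _ _ _ _) (form_constH1_top hΩ β _ _ _ _)
    (by rw [integral_constH1_bulk, one_mul]; exact hV)
    (by rw [integral_constH1_bulk, zero_mul]) (by rw [integral_constH1_surf, zero_mul])
    (by rw [integral_constH1_surf, one_mul]; exact hS) (lt_min one_pos hm) hK
    (form_one_self_nonneg ⊤ β) (hab.mul_form_one_le ⊤ β) hpoi F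
    (dual_add F) (dual_smul F) (dual_norm F).1 (dual_norm F).2
    ((div_eq_zero_iff.1 (hF.2 rfl).1).resolve_right hV)
    ((div_eq_zero_iff.1 (hF.2 rfl).2).resolve_right hS)
  simp only [hΩ.mem_V1_top_iff]
  exact key

lemma IsLipschitzDomain.exists_isWellPosed (hΩ : IsLipschitzDomain Ω) (L : ℝ≥0∞)
    (β : ℝ) (hΓ : β = 0 ∨ L = ⊤ → IsConnected (frontier Ω)) {m : ℝ} (hm : 0 < m) :
    ∃ C : ℝ, 0 < C ∧ IsWellPosed hΩ L β m C := by
  rcases eq_or_ne L ⊤ with rfl | hL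
  · exact hΩ.exists_isWellPosed_top (hΓ (Or.inr rfl)) β hm
  · obtain ⟨K, hK, hpoi⟩ := hΩ.exists_norm_le_normL hL fun hβ => hΓ (Or.inl hβ)
    exact ⟨_, div_pos hK (lt_min one_pos hm), isWellPosed_of_poincare hΩ hL hm hK hpoi⟩

end Main

end BulkSurface
end

theorem theorem4p1 (n : ℕ) (hn : n = 1 ∨ n = 2) (Ω : Set (BulkSurface.E (n + 1)))
    (hΩ : BulkSurface.IsLipschitzDomain Ω) (L : ℝ≥0∞) (β : ℝ)
    (hΓ : β = 0 ∨ L = ⊤ → IsConnected (frontier Ω)) (mlow : ℝ) (hmlow : 0 < mlow) :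
    ∃ C : ℝ, 0 < C ∧
      ∀ (mup : ℝ) (mΩ mΓ : ℝ → ℝ),
        BulkSurface.IsMobility mlow mup mΩ → BulkSurface.IsMobility mlow mup mΓ →
      ∀ φ ψ : BulkSurface.E (n + 1) → ℝ,
        AEMeasurable φ (BulkSurface.bulkMeasure Ω) →
        (∀ᵐ x ∂(BulkSurface.bulkMeasure Ω), |φ x| ≤ 1) →
        AEMeasurable ψ (BulkSurface.surfMeasure Ω) →
        (∀ᵐ x ∂(BulkSurface.surfMeasure Ω), |ψ x| ≤ 1) →
      ∀ F ∈ BulkSurface.Vdual hΩ L β,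
        (∃! p : BulkSurface.H1L Ω L β,
          p ∈ BulkSurface.V1 Ω L β ∧ BulkSurface.IsWeakSolution mΩ mΓ φ ψ F p) ∧
        ∀ p : BulkSurface.H1L Ω L β, BulkSurface.IsWeakSolution mΩ mΓ φ ψ F p →
          BulkSurface.normL L β (p : BulkSurface.H1 Ω) ≤ C * ‖F‖ := by
  -- The constant is fixed here, before the mobilities, their upper bound, the phase fields and the
  -- data are introduced.
  have h := hΩ.exists_isWellPosed L β hΓ hmlow
  exact h.imp fun C hC => ⟨hC.1, fun mup mΩ mΓ h₁ h₂ φ ψ hφ hφ1 hψ hψ1 =>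
    hC.2 mup _ _ (h₁.isCoeffPair h₂ hmlow hφ hφ1 hψ hψ1)⟩
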